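/- **Setting.** Let $X$ and $D$ be Banach spaces with $D\hookrightarrow X$ injectively, densely and compactly, let $1<p<\infty$, $\frac1p+\frac1q=1$, and let $I=(a,b)$ with $-\infty<a<b<\infty$. For an open interval $J$ bounded from below put $MR^p(J)=L^p(J;D)\cap W^{1,p}(J;X)$ with $$\|u\|_{MR^p(J)}=\big(\|u\|_{L^p(J;X)}^p+\|u\|_{L^p(J;D)}^p+\ell_J^p\|u'\|_{L^p(J;X)}^p\big)^{1/p},$$ where $\ell_J=|J|$ if $J$ is bounded and $\ell_J=1$ otherwise. A map $A:J\to\mathcal L(D,X)$ belongs to $\mathcal{MR}_p(J)$ if $t\mapsto A(t)x$ is in $L^\infty(J;X)$ for all $x\in D$, the norm $\|x\|_X+\|A(t)x\|_X$ is equivalent to $\|x\|_D$ for each $t\in J$, and for each $f\in L^p(J;X)$ there is a unique $u\in MR^p(J)$ with $u'+A u=f$ a.e. on $J$, $u(\inf J)=0$, and $\|u\|_{MR^p(J)}\le K\|f\|_{L^p(J;X)}$ with $K\ge0$ independent of $f$. The infimum of such $K$ is $[A]_{\mathcal{MR}_p(J)}$. For constant maps $A\equiv T\in\mathcal L(D,X)$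 we write $T\in mr_p(J)$ and $[T]_{mr_p(J)}$. Let $\|A\|_\infty$ be the essential supremum over $I$ of $\|A(t)\|_{\mathcal L(D,X)}$. A strongly measurable $A:\overline I\to\mathcal L(D,X)$ (i.e. each $A(\cdot)x$ is Bochner measurable) is *relatively continuous* if for every $\epsilon>0$ there are $\delta>0$, $\eta\ge0$ with $$\|A(t)x-A(s)x\|_X\le\epsilon\|x\|_D+\eta\|x\|_X\qquad(x\in D,\ s,t\in\overline I,\ |t-s|\le\delta);\tag{1}$$ a *range of relative continuity* of $A$ is a map $(\delta_A,\eta_A):(0,\infty)\to(0,\infty)\times[0,\infty)$ such that (1) holds with $(\delta,\eta)=(\delta_A(\epsilon),\eta_A(\epsilon))$ for every $\epsilon>0$. **Assumption (A1).** $A$ is relatively continuous, and there are $A_0:\overline I\to\mathcal L(D,X)$, $B:\overline I\times I\to\mathcal L(D,X)$ and a range of relative continuity $(\delta_A,\eta_A)$ of $A$ such that $A(s)=A_0(t)+B(t,s)$ for all $t\in\overline I$, $s\in I$; $A_0(t)\in mr_p(\mathbb R_+)$ for all $t\in\overline I$; and, with $$K_0(t)=[A_0(t)]_{mr_p(I)},\quad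 M_0(t)=\sup_{\tau\ge0}\|e^{-\tau A_0(t)}\|_{\mathcal L(X)},\quad \epsilon_0(t)=\frac1{2(K_0(t)+1)(M_0(t)+1)},\quad \rho_A=\delta_A\circ\epsilon_0,\quad \mu_A=\eta_A\circ\epsilon_0$$ (where $e^{-\tau A_0(t)}$ is the strongly continuous semigroup on $X$ generated by $-A_0(t)$), for all $x\in D$, $t\in\overline I$, $s\in I$: $$|t-s|\le\rho_A(t)\ \Longrightarrow\ \|B(t,s)x\|_X\le\epsilon_0(t)\|x\|_D+\mu_A(t)\|x\|_X .$$ **Constants.** With $\nu_\pm=\max(\pm\nu,0)$ let $$c_p(\nu)=\Big(\inf_{0<\mu<1}\max\{1+\mu^{1-p}|\nu|^p,(1-\mu)^{1-p}\}\Big)^{1/p}\big(1+e^{p\nu_-}-e^{-p\nu_+}\big)^{1/p},\qquad G(\tau,\mu,M,K)=4(M+1)\,c_p(-4M\tau\mu)\,K .$$ With $w_p=2^{1/q}(p-1)$, for $T>0$ and $C,g\ge0$ (and $\frac1{CT}=+\infty$ if $C=0$), let $Q_p(T,C,g)$ be $$\begin{cases}1+2^{1/q}\max(Cg,\frac gT)&\text{if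 } w_p\frac gT\le1,\\[2pt] \dfrac{2^{1/(pq)}p}{(p-1)^{1/q}}\big(\frac gT\big)^{1/p}&\text{if } 1<w_p\frac gT\le\frac1{CT},\\[4pt] \max(\frac1{CT},1)^{1/p}(1+2^{1/q}Cg)&\text{otherwise.}\end{cases}$$ For $\mathcal T=(\tau_i)_{0\le i\le N}$ and $2\le j\le N$, with $\kappa_{1,j}=\frac{\tau_j-\tau_0}{\tau_{j-1}-\tau_0}$ and $\kappa_{2,j}=\frac{\tau_j-\tau_0}{\tau_j-\tau_{j-1}}$, let $$H_j(p,\mathcal T,C,g)=\kappa_{1,j}+\kappa_{1,j}^{1/p}\kappa_{2,j}^{1/q}\,Q_p(\tau_j-\tau_{j-1},C,g).$$ **Theorem.** Assume (A1). Then $A\in\mathcal{MR}_p(I)$, and there are $N\ge1$, a subdivision $\mathcal T=(\tau_i)_{0\le i\le N}$ of $\overline I$ and centers $(t_i)_{1\le i\le N}$ with $$a=\tau_0\le t_1<\tau_1<t_2<\dots<\tau_{N-1}<t_N\le\tau_N=b,\qquad |t_i-\tau_{i-1}|\le\rho_A(t_i),\quad |t_i-\tau_i|\le\rho_A(t_i)\quad(1\le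 i\le N),$$ such that $\tau_i-\tau_{i-1}\le2\rho_A(t_i)$ for $1\le i\le N$, $\rho_A(t_i)\le\tau_i-\tau_{i-1}$ for $1<i<N$, and, if $N\ge2$, $\frac12\rho_A(t_i)\le\tau_i-\tau_{i-1}$ for $i\in\{1,N\}$; and, with $G_i=G(\tau_i-\tau_{i-1},\mu_A(t_i),M_0(t_i),K_0(t_i))$, $$[A]_{\mathcal{MR}_p(I)}\le K:=\sum_{i=1}^N\frac{\tau_i-\tau_0}{\tau_i-\tau_{i-1}}\Big(\prod_{j=i+1}^N H_j(p,\mathcal T,\|A\|_\infty,G_j)\Big)G_i .$$ Moreover, for each $C\ge0$ and $2\le j\le N$ the function $g\mapsto H_j(p,\mathcal T,C,g)$ on $[0,\infty)$ grows at most linearly: $H_j(p,\mathcal T,C,g)\le L(1+g)$ for some $L$ independent of $g$. -/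

import Mathlib

open Set Filter Topology MeasureTheory
open scoped NNReal ENNReal

noncomputable section

namespace MaxReg

/-! Throughout, `D` and `X` are Banach spaces, `ι : D →L[ℝ] X` is the embedding of `D` into `X`, and a
time interval is a set `I ⊆ ℝ` (it will be `Ioo a b` or `Ioi 0`).  Functions on `I` are total functions
on `ℝ` of which only the values on `I` matter. Scalars are real; complex Banach spaces are covered by
restriction of scalars, which changes none of the norms and none of the notions below. -/

section Spaces

variable {D X : Type*} [NormedAddCommGroup D] [NormedSpace ℝ D]
  [NormedAddCommGroup X] [NormedSpace ℝ X]

/-- The norm of `L^p(I; Y)`. -/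
def lpNormOn {Y : Type*} [NormedAddCommGroup Y] (p : ℝ) (I : Set ℝ) (f : ℝ → Y) : ℝ :=
  (eLpNorm f (ENNReal.ofReal p) (volume.restrict I)).toReal

/-- Membership in `L^p(I; Y)`. -/
def MemLpOn {Y : Type*} [NormedAddCommGroup Y] (p : ℝ) (I : Set ℝ) (f : ℝ → Y) : Prop :=
  MemLp f (ENNReal.ofReal p) (volume.restrict I)

/-- `dw` is a weak derivative of `w` on the open set `I`. -/
def HasWeakDerivOn {Y : Type*} [NormedAddCommGroup Y] [NormedSpace ℝ Y]
    (I : Set ℝ) (w dw : ℝ → Y) : Prop :=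
  ∀ φ : ℝ → ℝ, ContDiff ℝ (⊤ : ℕ∞) φ → HasCompactSupport φ → tsupport φ ⊆ I →
    -(∫ t in I, deriv φ t • w t) = ∫ t in I, φ t • dw t

/-- `u ∈ MR^p(I) = L^p(I; D) ∩ W^{1,p}(I; X)`, with weak derivative `du`.
(`ι ∘ u ∈ L^p(I; X)` is automatic, as `ι` is bounded.) -/
structure IsMRFun (ι : D →L[ℝ] X) (p : ℝ) (I : Set ℝ) (u : ℝ → D) (du : ℝ → X) : Prop where
  memLp : MemLpOn p I u
  memLp_deriv : MemLpOn p I du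
  hasWeakDeriv : HasWeakDerivOn I (fun t => ι (u t)) du

/-- The weight of the time derivative in the norm of `MR^p(I)`: the length `|I|` if `I` is bounded,
and `1` if `I` is unbounded. -/
def timeScale (I : Set ℝ) : ℝ :=
  if volume I = ∞ then 1 else (volume I).toReal

/-- The norm of `MR^p(I)`. -/
def mrNorm (ι : D →L[ℝ] X) (p : ℝ) (I : Set ℝ) (u : ℝ → D) (du : ℝ → X) : ℝ :=
  (lpNormOn p I (fun t => ι (u t)) ^ p + lpNormOn p I u ^ p
    + timeScale I ^ p * lpNormOn p I du ^ p) ^ (1 / p)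

/-- The initial condition `u(inf I) = 0`, for the representative of `u` that is continuous
with values in `X` on the closure of `I`. -/
def VanishesAtLeftEnd (ι : D →L[ℝ] X) (I : Set ℝ) (u : ℝ → D) : Prop :=
  ∃ w : ℝ → X, ContinuousOn w (closure I) ∧ (∀ᵐ t ∂(volume.restrict I), w t = ι (u t)) ∧
    w (sInf I) = 0

/-- `u ∈ MR^p(I)`, with weak derivative `du`, solves `u' + A u = f` on `I`, `u(inf I) = 0`. -/
structure IsStrongSolution (ι : D →L[ℝ] X) (p : ℝ) (I : Set ℝ) (A : ℝ → D →L[ℝ] X) (f : ℝ → X)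
    (u : ℝ → D) (du : ℝ → X) : Prop where
  isMRFun : IsMRFun ι p I u du
  equation : ∀ᵐ t ∂(volume.restrict I), du t + A t (u t) = f t
  initial : VanishesAtLeftEnd ι I u

/-- The graph norm `x ↦ ‖x‖_X + ‖T x‖_X` is equivalent to the norm of `D`. -/
def GraphNormEquiv (ι : D →L[ℝ] X) (T : D →L[ℝ] X) : Prop :=
  ∃ c C : ℝ, 0 < c ∧ 0 < C ∧
    ∀ x : D, c * ‖x‖ ≤ ‖ι x‖ + ‖T x‖ ∧ ‖ι x‖ + ‖T x‖ ≤ C * ‖x‖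

/-- `‖v_f‖_{MR^p(I)} ≤ K ‖f‖_{L^p(I;X)}` for all `f ∈ L^p(I; X)`. -/
def MRBound (ι : D →L[ℝ] X) (p : ℝ) (I : Set ℝ) (A : ℝ → D →L[ℝ] X) (K : ℝ) : Prop :=
  ∀ f : ℝ → X, MemLpOn p I f → ∀ (u : ℝ → D) (du : ℝ → X),
    IsStrongSolution ι p I A f u du → mrNorm ι p I u du ≤ K * lpNormOn p I f

/-- `A` belongs to the class `MR_p(I)` of nonautonomous operators with `L^p` maximal regularity. -/
structure IsMaxReg (ι : D →L[ℝ] X) (p : ℝ) (I : Set ℝ) (A : ℝ → D →L[ℝ] X) : Prop where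
  /-- `A ∈ L^∞(I; L(D; X))`: `A` is strongly measurable and each `‖A(·) x‖_X` is in `L^∞(I)`. -/
  memLinfty : ∀ x : D, MemLp (fun t => A t x) ∞ (volume.restrict I)
  graphNorm : ∀ t ∈ I, GraphNormEquiv ι (A t)
  exists_solution : ∀ f : ℝ → X, MemLpOn p I f →
    ∃ (u : ℝ → D) (du : ℝ → X), IsStrongSolution ι p I A f u du
  unique_solution : ∀ f : ℝ → X, MemLpOn p I f →
    ∀ (u₁ u₂ : ℝ → D) (du₁ du₂ : ℝ → X), IsStrongSolution ι p I A f u₁ du₁ →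
      IsStrongSolution ι p I A f u₂ du₂ → ∀ᵐ t ∂(volume.restrict I), u₁ t = u₂ t
  exists_bound : ∃ K : ℝ, 0 ≤ K ∧ MRBound ι p I A K

/-- The maximal regularity constant of `A` on `I`: the infimum of the admissible `K`. -/
def mrConst (ι : D →L[ℝ] X) (p : ℝ) (I : Set ℝ) (A : ℝ → D →L[ℝ] X) : ℝ :=
  sInf {K : ℝ | 0 ≤ K ∧ MRBound ι p I A K}

/-- A single operator `T` belongs to the autonomous class `mr_p(I)`. -/
def IsAutMaxReg (ι : D →L[ℝ] X) (p : ℝ) (I : Set ℝ) (T : D →L[ℝ] X) : Prop :=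
  IsMaxReg ι p I (fun _ => T)

/-- The autonomous maximal regularity constant of `T` on `I`. -/
def autMrConst (ι : D →L[ℝ] X) (p : ℝ) (I : Set ℝ) (T : D →L[ℝ] X) : ℝ :=
  mrConst ι p I (fun _ => T)

/-- `S` is a strongly continuous semigroup on `X` whose generator is `-T`, with domain `ι(D)`;
that is, `S τ = e^{-τ T}`. -/
structure IsSemigroupOf (ι : D →L[ℝ] X) (T : D →L[ℝ] X) (S : ℝ≥0 → X →L[ℝ] X) : Prop where
  zero : S 0 = ContinuousLinearMap.id ℝ X
  add : ∀ r s : ℝ≥0, S (r + s) = (S r).comp (S s)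
  continuous : ∀ x : X, Continuous fun r : ℝ≥0 => S r x
  generator : ∀ x y : X,
    Tendsto (fun h : ℝ≥0 => (h : ℝ)⁻¹ • (S h x - x)) (𝓝[>] 0) (𝓝 y) ↔
      ∃ d : D, ι d = x ∧ y = -(T d)

/-- `sup_{τ ≥ 0} ‖e^{-τ T}‖`. A semigroup is determined by its generator, so at most one `S`
occurs here; for `T ∈ mr_p(ℝ₊)` it exists and is bounded. -/
def semigroupBound (ι : D →L[ℝ] X) (T : D →L[ℝ] X) : ℝ :=
  sSup {m : ℝ | ∃ S : ℝ≥0 → X →L[ℝ] X, IsSemigroupOf ι T S ∧ ∃ r : ℝ≥0, m = ‖S r‖}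

/-- The norm `‖A‖_∞` of `L^∞(I; L(D; X))`: the essential supremum of `‖A(t)‖`. -/
def opLinftyNorm (I : Set ℝ) (A : ℝ → D →L[ℝ] X) : ℝ :=
  (essSup (fun t => ‖A t‖ₑ) (volume.restrict I)).toReal

/-- The ranges of relative continuity `r_A^*(ε)` of `A` on `[a, b]`: the set of all `(δ, η)`. -/
def relRange (ι : D →L[ℝ] X) (a b : ℝ) (A : ℝ → D →L[ℝ] X) (ε : ℝ) : Set (ℝ × ℝ) :=
  {r | 0 < r.1 ∧ 0 ≤ r.2 ∧ ∀ x : D, ∀ t ∈ Icc a b, ∀ s ∈ Icc a b, |t - s| ≤ r.1 →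
    ‖A t x - A s x‖ ≤ ε * ‖x‖ + r.2 * ‖ι x‖}

/-- `A ∈ RC(I; (D; X))`: `A` is strongly measurable and relatively continuous on `[a, b]`. -/
structure IsRelCont (ι : D →L[ℝ] X) (a b : ℝ) (A : ℝ → D →L[ℝ] X) : Prop where
  stronglyMeasurable : ∀ x : D, AEStronglyMeasurable (fun t => A t x) (volume.restrict (Icc a b))
  relCont : ∀ ε : ℝ, 0 < ε → (relRange ι a b A ε).Nonempty

/-- `K_0(t)`, the maximal regularity constant of `A_0(t)` on the bounded interval `(a, b)`. -/
def K₀ (ι : D →L[ℝ] X) (p a b : ℝ) (A₀ : ℝ → D →L[ℝ] X) (t : ℝ) : ℝ :=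
  autMrConst ι p (Ioo a b) (A₀ t)

/-- `M_0(t) = sup_{τ ≥ 0} ‖e^{-τ A_0(t)}‖`. -/
def M₀ (ι : D →L[ℝ] X) (A₀ : ℝ → D →L[ℝ] X) (t : ℝ) : ℝ :=
  semigroupBound ι (A₀ t)

/-- `ε_0(t) = 1 / (2 (K_0(t) + 1) (M_0(t) + 1))`. -/
def eps₀ (ι : D →L[ℝ] X) (p a b : ℝ) (A₀ : ℝ → D →L[ℝ] X) (t : ℝ) : ℝ :=
  1 / (2 * (K₀ ι p a b A₀ t + 1) * (M₀ ι A₀ t + 1))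

/-- Assumption (A1) on `A`, with the decomposition `A(s) = A_0(t) + B(t, s)` and the range of
relative continuity `ε ↦ (δ(ε), η(ε))`. Here `ρ_A = δ ∘ ε_0` and `μ_A = η ∘ ε_0`. -/
structure AssumptionA1 (ι : D →L[ℝ] X) (p a b : ℝ) (A A₀ : ℝ → D →L[ℝ] X)
    (B : ℝ → ℝ → D →L[ℝ] X) (δ η : ℝ → ℝ) : Prop where
  relCont : IsRelCont ι a b A
  decomposition : ∀ t ∈ Icc a b, ∀ s ∈ Ioo a b, A s = A₀ t + B t s
  pointwise_mr : ∀ t ∈ Icc a b, IsAutMaxReg ι p (Ioi 0) (A₀ t)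
  range : ∀ ε : ℝ, 0 < ε → (δ ε, η ε) ∈ relRange ι a b A ε
  perturbation : ∀ x : D, ∀ t ∈ Icc a b, ∀ s ∈ Ioo a b, |t - s| ≤ δ (eps₀ ι p a b A₀ t) →
    ‖B t s x‖ ≤ eps₀ ι p a b A₀ t * ‖x‖ + η (eps₀ ι p a b A₀ t) * ‖ι x‖

end Spaces

/-! ### The explicit constants -/

/-- The function `κ_p`: `|ν| + κ_p(ν)` is the `p`-th root of the infimum over `0 < μ < 1` of
`max (1 + μ^{1-p} |ν|^p) ((1-μ)^{1-p})`. -/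
def kappa (p ν : ℝ) : ℝ :=
  (⨅ μ : Ioo (0 : ℝ) 1,
    max (1 + (μ : ℝ) ^ (1 - p) * |ν| ^ p) ((1 - (μ : ℝ)) ^ (1 - p))) ^ (1 / p) - |ν|

/-- `c_p(ν) = (|ν| + κ_p(ν)) (1 + e^{p ν_-} - e^{-p ν_+})^{1/p}`. -/
def cp (p ν : ℝ) : ℝ :=
  (|ν| + kappa p ν) *
    (1 + Real.exp (p * max (-ν) 0) - Real.exp (-(p * max ν 0))) ^ (1 / p)

/-- `G(τ, μ, M, K) = 4 (M + 1) c_p(-4 M τ μ) K`. -/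
def G (p τ μ M K : ℝ) : ℝ :=
  4 * (M + 1) * cp p (-(4 * M * τ * μ)) * K

/-- The function `Q_p(T, C, G)` for `T > 0`, `C, G ≥ 0`, where `q` is the exponent conjugate to `p`
and `w_p = 2^{1/q} (p - 1)`. The three cases are `w_p G / T ≤ 1`, then `1 < w_p G / T ≤ 1 / (C T)`
(no upper restriction if `C = 0`), then `w_p G / T > max 1 (1 / (C T))`. -/
def Q (p T C G : ℝ) : ℝ :=
  let q := Real.conjExponent p
  let w := 2 ^ (1 / q) * (p - 1)
  if w * (G / T) ≤ 1 then 1 + 2 ^ (1 / q) * max (C * G) (G / T)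
  else if w * (G / T) * (C * T) ≤ 1 then
    2 ^ (1 / (p * q)) * p / (p - 1) ^ (1 / q) * (G / T) ^ (1 / p)
  else (max (1 / (C * T)) 1) ^ (1 / p) * (1 + 2 ^ (1 / q) * (C * G))

/-- The gluing factor `H_j(p, 𝒯, C, G)` of a subdivision `𝒯 = (τ_i)`, for `2 ≤ j`. -/
def H (p : ℝ) (τ : ℕ → ℝ) (j : ℕ) (C G : ℝ) : ℝ :=
  let κ₁ := (τ j - τ 0) / (τ (j - 1) - τ 0)
  let κ₂ := (τ j - τ 0) / (τ j - τ (j - 1))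
  κ₁ + κ₁ ^ (1 / p) * κ₂ ^ (1 / Real.conjExponent p) * Q p (τ j - τ (j - 1)) C G

/-- `K = ∑_{i=1}^N (τ_i - τ_0)/(τ_i - τ_{i-1}) (∏_{j=i+1}^N H_j(p, 𝒯, C, g_j)) g_i`. -/
def Kbound (p : ℝ) (N : ℕ) (τ : ℕ → ℝ) (C : ℝ) (g : ℕ → ℝ) : ℝ :=
  ∑ i ∈ Finset.Icc 1 N, (τ i - τ 0) / (τ i - τ (i - 1)) *
    (∏ j ∈ Finset.Icc (i + 1) N, H p τ j C (g j)) * g i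

/-- `τ_0, …, τ_N` is a subdivision of `[a, b]` with centers `t_1, …, t_N`, adapted to `ρ`:
`a = τ_0 ≤ t_1 < τ_1 < t_2 < … < τ_{N-1} < t_N ≤ τ_N = b`, where the cells have the sizes
prescribed by `ρ`. Only `τ 0, …, τ N` and `t 1, …, t N` matter. -/
structure IsAdaptedSubdivision (a b : ℝ) (ρ : ℝ → ℝ) (N : ℕ) (τ t : ℕ → ℝ) : Prop where
  one_le : 1 ≤ N
  left : τ 0 = a
  right : τ N = b
  first : a ≤ t 1
  last : t N ≤ b
  interlaced : ∀ i : ℕ, 1 ≤ i → i < N → t i < τ i ∧ τ i < t (i + 1)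
  /-- every cell `[τ_{i-1}, τ_i]` is contained in `[t_i - ρ(t_i), t_i + ρ(t_i)]` -/
  dist : ∀ i : ℕ, 1 ≤ i → i ≤ N → |t i - τ (i - 1)| ≤ ρ (t i) ∧ |t i - τ i| ≤ ρ (t i)
  upper : ∀ i : ℕ, 1 ≤ i → i ≤ N → τ i - τ (i - 1) ≤ 2 * ρ (t i)
  /-- lower bound for the interior cells -/
  lower : ∀ i : ℕ, 1 < i → i < N → ρ (t i) ≤ τ i - τ (i - 1)
  /-- lower bound for the two cells that touch the end points, if there is more than one cell -/
  lower_end : 2 ≤ N → ∀ i : ℕ, i = 1 ∨ i = N → ρ (t i) / 2 ≤ τ i - τ (i - 1)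

end MaxReg

end

/-! The operator is frozen on short cells, each cell is treated as a perturbation of an autonomous
problem, and the cells are glued.

Autonomous input. A solution on a bounded interval extends to a half-line solution with source cut
off (`aut_bound_zero`), so maximal regularity of `A₀ t` on the half line passes to bounded
intervals, and the constant `K₀` of `(a, b)` serves on every subinterval (`aut_wp_K₀`). Null
solutions started in `ι(D)` form a bounded semigroup, which has generator `-T` and is the only one
with this generator (`AutReg.null_bound`, `OrbitFamily.isSemigroupOf`,
`OrbitFamily.eq_of_isSemigroupOf`); hence `M₀` really bounds its norms. Variation of constants and
Young's inequality for an exponential kernel give `λ ‖(d/dt + T + λ)⁻¹ g‖ ≤ M ‖g‖` in `L^p(X)`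
(`Sol.mul_lpNormOn_le`).

One cell (`WP.of_close`). There `A = T + B` with `‖B x‖ ≤ ε ‖x‖_D + μ ‖x‖_X`. After the shift by `λ
= 4 M μ` the lower order part of `B` has relative size at most `1/4`. The shifted problem has
constant `K (M + 1)`, so the choice of `ε₀` makes the other part at most `1/2`. A contraction with
factor `3/4` yields the constant `4 (M + 1) K`, and undoing the shift with an exponential weight
costs `c_p`; the product is `G`.

Gluing (`WP.glue`). A solution on `(a, c)` is continued beyond `c` by its reflection at `c`, run at
speed `r`; this has the right trace, and its source is removed by a solution on `(c, d)` with zero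
initial value. Optimizing `r` gives `Q`, and the weights by interval length give the ratios in `H`.
Induction over the cells gives `Kbound`.

Subdivision (`exists_isAdaptedSubdivision`). From a minimal finite cover by the intervals of radius
`ρ` around their centers, the cuts are the midpoints of consecutive overlaps. Every interval of the
cover owns a point that no other covers, and these points give the lower bounds on the cells.

All of this is done with the equation in integrated form, `ι u = x + ∫ du`, which is equivalent to
the weak form by the du Bois-Reymond lemma (`StartsAt.isStrongSolution_iff`). -/

noncomputable section

namespace MaxReg

/-! ### The `L^p` norm on subsets of the line. -/

section LpToolkit

variable {Y Z : Type*} [NormedAddCommGroup Y] [NormedAddCommGroup Z] {p : ℝ} {I J : Set ℝ}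
  {f g : ℝ → Y}

theorem lpNormOn_nonneg : 0 ≤ lpNormOn p I f := ENNReal.toReal_nonneg

theorem lpNormOn_rpow_nonneg : 0 ≤ lpNormOn p I f ^ p := Real.rpow_nonneg lpNormOn_nonneg p

theorem lpNormOn_congr (h : ∀ᵐ t ∂(volume.restrict I), f t = g t) :
    lpNormOn p I f = lpNormOn p I g := by
  rw [lpNormOn, lpNormOn, eLpNorm_congr_ae h]

theorem one_le_ofReal (hp : 1 < p) : 1 ≤ ENNReal.ofReal p := ENNReal.one_le_ofReal.2 hp.le

theorem ofReal_ne_zero (hp : 1 < p) : ENNReal.ofReal p ≠ 0 :=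
  (zero_lt_one.trans_le (one_le_ofReal hp)).ne'

theorem lpNormOn_add_le (hp : 1 < p) (hf : MemLpOn p I f) (hg : MemLpOn p I g) :
    lpNormOn p I (fun t => f t + g t) ≤ lpNormOn p I f + lpNormOn p I g := by
  unfold lpNormOn
  rw [← ENNReal.toReal_add hf.2.ne hg.2.ne]
  exact ENNReal.toReal_mono (ENNReal.add_ne_top.2 ⟨hf.2.ne, hg.2.ne⟩)
    (eLpNorm_add_le hf.1 hg.1 (one_le_ofReal hp))

theorem lpNormOn_neg : lpNormOn p I (fun t => -f t) = lpNormOn p I f := by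
  unfold lpNormOn
  exact congrArg ENNReal.toReal (eLpNorm_neg f _ _)

theorem lpNormOn_sub_le (hp : 1 < p) (hf : MemLpOn p I f) (hg : MemLpOn p I g) :
    lpNormOn p I (fun t => f t - g t) ≤ lpNormOn p I f + lpNormOn p I g := by
  have h : MemLpOn p I (fun t => -g t) := MemLp.neg hg
  simpa only [sub_eq_add_neg, lpNormOn_neg] using lpNormOn_add_le hp hf h

theorem lpNormOn_const_smul [NormedSpace ℝ Y] (c : ℝ) :
    lpNormOn p I (fun t => c • f t) = |c| * lpNormOn p I f := by
  unfold lpNormOn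
  have := eLpNorm_const_smul (p := ENNReal.ofReal p) c f (volume.restrict I)
  change (eLpNorm (c • f) _ _).toReal = _
  rw [this, ENNReal.toReal_mul]; simp

theorem lpNormOn_le_mul {g : ℝ → Z} (hg : MemLpOn p I g) {c : ℝ} (hc : 0 ≤ c)
    (h : ∀ᵐ t ∂(volume.restrict I), ‖f t‖ ≤ c * ‖g t‖) :
    lpNormOn p I f ≤ c * lpNormOn p I g := by
  unfold lpNormOn
  have := eLpNorm_le_mul_eLpNorm_of_ae_le_mul h (ENNReal.ofReal p)
  refine (ENNReal.toReal_mono (ENNReal.mul_ne_top ENNReal.ofReal_ne_top hg.2.ne) this).trans ?_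
  rw [ENNReal.toReal_mul, ENNReal.toReal_ofReal hc]

theorem lpNormOn_mono_set (h : I ⊆ J) (hf : MemLpOn p J f) : lpNormOn p I f ≤ lpNormOn p J f :=
  ENNReal.toReal_mono hf.2.ne (eLpNorm_mono_measure f (Measure.restrict_mono h le_rfl))

theorem MemLpOn.mono (hf : MemLpOn p J f) (h : I ⊆ J) : MemLpOn p I f :=
  hf.mono_measure (Measure.restrict_mono h le_rfl)

theorem MemLpOn.of_le_mul {g : ℝ → Z} (hg : MemLpOn p I g) {c : ℝ}
    (hf : AEStronglyMeasurable f (volume.restrict I))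
    (h : ∀ᵐ t ∂(volume.restrict I), ‖f t‖ ≤ c * ‖g t‖) : MemLpOn p I f :=
  MemLp.of_le_mul hg hf h

theorem memLpOn_const (c : Y) {α β : ℝ} : MemLpOn p (Ioo α β) (fun _ => c) := memLp_const c

theorem memLpOn_zero : MemLpOn p I (fun _ => (0 : Y)) := MemLp.zero'

theorem lpNormOn_zero : lpNormOn p I (fun _ => (0 : Y)) = 0 := by
  simp [lpNormOn]

theorem lpNormOn_rpow (hp : 1 < p) (hf : MemLpOn p I f) :
    lpNormOn p I f ^ p = ∫ t in I, ‖f t‖ ^ p := by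
  have h0 : 0 < p := by linarith
  have := hf.eLpNorm_eq_integral_rpow_norm (ofReal_ne_zero hp) ENNReal.ofReal_ne_top
  unfold lpNormOn
  rw [this, ENNReal.toReal_ofReal h0.le, ENNReal.toReal_ofReal (by positivity),
    ← Real.rpow_mul (integral_nonneg fun t => by positivity), inv_mul_cancel₀ h0.ne',
    Real.rpow_one]

theorem MemLpOn.integrable_rpow (hp : 1 < p) (hf : MemLpOn p I f) :
    IntegrableOn (fun t => ‖f t‖ ^ p) I := by
  have := MemLp.integrable_norm_rpow hf (ofReal_ne_zero hp) ENNReal.ofReal_ne_top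
  rwa [ENNReal.toReal_ofReal (by linarith)] at this

theorem ae_Ioo_split {α γ β : ℝ} (h₁ : α < γ) (h₂ : γ < β) :
    (Ioo α β : Set ℝ) =ᵐ[volume] (Ioo α γ ∪ Ioo γ β : Set ℝ) := by
  rw [← Ioo_union_Ico_eq_Ioo h₁ h₂.le]
  exact (ae_eq_refl _).union Ioo_ae_eq_Ico.symm

theorem lpNormOn_rpow_split (hp : 1 < p) {α γ β : ℝ} (h₁ : α < γ) (h₂ : γ < β)
    (hf : MemLpOn p (Ioo α β) f) :
    lpNormOn p (Ioo α β) f ^ p = lpNormOn p (Ioo α γ) f ^ p + lpNormOn p (Ioo γ β) f ^ p := by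
  have hs₁ : Ioo α γ ⊆ Ioo α β := Ioo_subset_Ioo_right h₂.le
  have hs₂ : Ioo γ β ⊆ Ioo α β := Ioo_subset_Ioo_left h₁.le
  rw [lpNormOn_rpow hp hf, lpNormOn_rpow hp (hf.mono hs₁), lpNormOn_rpow hp (hf.mono hs₂),
    setIntegral_congr_set (ae_Ioo_split h₁ h₂), setIntegral_union]
  · exact Set.disjoint_left.2 fun t ht ht' => by linarith [ht.2, ht'.1]
  · exact measurableSet_Ioo
  · exact (hf.mono hs₁).integrable_rpow hp
  · exact (hf.mono hs₂).integrable_rpow hp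

theorem lpNormOn_eq_zero (hp : 1 < p) (hf : MemLpOn p I f) (h : lpNormOn p I f = 0) :
    ∀ᵐ t ∂(volume.restrict I), f t = 0 := by
  have : eLpNorm f (ENNReal.ofReal p) (volume.restrict I) = 0 :=
    ((ENNReal.toReal_eq_zero_iff _).1 h).resolve_right hf.2.ne
  exact (eLpNorm_eq_zero_iff hf.1 (ofReal_ne_zero hp)).1 this

theorem lpNormOn_const (hp : 1 < p) (c : Y) {α β : ℝ} (h : α ≤ β) :
    lpNormOn p (Ioo α β) (fun _ => c) = (β - α) ^ (1 / p) * ‖c‖ := by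
  unfold lpNormOn
  rw [eLpNorm_const' c (ofReal_ne_zero hp) ENNReal.ofReal_ne_top, ENNReal.toReal_mul,
    ← ENNReal.toReal_rpow, ENNReal.toReal_ofReal (by linarith)]
  simp [h, mul_comm]

theorem MemLpOn.intervalIntegrable (hp : 1 < p) (hf : MemLpOn p J f) {a b : ℝ} (hab : a ≤ b)
    (hs : Ioo a b ⊆ J) : IntervalIntegrable f volume a b := by
  rw [intervalIntegrable_iff_integrableOn_Ioo_of_le hab]
  exact MemLp.integrable (one_le_ofReal hp) (hf.mono hs)

/-- Hölder's inequality against the constant function `1`. -/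
theorem norm_integral_le_lpNormOn [NormedSpace ℝ Y] (hp : 1 < p) {a b : ℝ} (hab : a ≤ b)
    (hf : MemLpOn p (Ioo a b) f) :
    ‖∫ s in a..b, f s‖ ≤ (b - a) ^ (1 - 1 / p) * lpNormOn p (Ioo a b) f := by
  have h1 := eLpNorm_le_eLpNorm_mul_rpow_measure_univ (μ := volume.restrict (Ioo a b))
    (one_le_ofReal hp) hf.1
  rw [intervalIntegral.integral_of_le hab, integral_Ioc_eq_integral_Ioo]
  have h2 := enorm_integral_le_lintegral_enorm (μ := volume.restrict (Ioo a b)) f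
  rw [← eLpNorm_one_eq_lintegral_enorm] at h2
  have h3 := h2.trans h1
  have h4 := ENNReal.toReal_mono (ENNReal.mul_ne_top hf.2.ne
    (ENNReal.rpow_ne_top_of_nonneg (by
      rw [ENNReal.toReal_one, ENNReal.toReal_ofReal (by linarith), sub_nonneg, div_one]
      exact div_le_one_of_le₀ hp.le (by linarith))
      (by simp))) h3
  rw [toReal_enorm, ENNReal.toReal_mul, ← ENNReal.toReal_rpow] at h4
  simp only [ENNReal.toReal_one, ENNReal.toReal_ofReal (by linarith : (0 : ℝ) ≤ p),
    Measure.restrict_apply_univ, Real.volume_Ioo, ENNReal.toReal_ofReal (sub_nonneg.2 hab)] at h4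
  simpa [mul_comm, lpNormOn] using h4

/-- Affine change of variables in `L^p`. -/
theorem MemLpOn.comp_affine (hp : 1 < p) (hf : MemLpOn p J f) {c r : ℝ} (hr : r ≠ 0)
    (hm : ∀ s ∈ I, c + r * s ∈ J) :
    MemLpOn p I (fun s => f (c + r * s)) ∧
      lpNormOn p I (fun s => f (c + r * s)) ≤ (|r|⁻¹) ^ (1 / p) * lpNormOn p J f := by
  let e : ℝ ≃ₜ ℝ := (Homeomorph.mulLeft₀ r hr).trans (Homeomorph.addLeft c)
  have he : ∀ s, e s = c + r * s := fun s => rfl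
  have hmap : Measure.map e volume = ENNReal.ofReal |r⁻¹| • (volume : Measure ℝ) := by
    have : (e : ℝ → ℝ) = (fun x => c + x) ∘ (fun x => r * x) := rfl
    rw [this, ← Measure.map_map (by fun_prop) (by fun_prop), Real.map_volume_mul_left hr,
      Measure.map_smul, map_add_left_eq_self]
  have hmem : MeasurableEmbedding e := e.measurableEmbedding
  have hle : Measure.map e (volume.restrict I) ≤ ENNReal.ofReal |r⁻¹| • volume.restrict J := by
    have : I ⊆ e ⁻¹' (e '' I) := subset_preimage_image _ _
    calc Measure.map e (volume.restrict I)
        = Measure.map e (volume.restrict (e ⁻¹' (e '' I))) := by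
          rw [preimage_image_eq _ e.injective]
      _ = (Measure.map e volume).restrict (e '' I) := by
          rw [hmem.restrict_map]
      _ = ENNReal.ofReal |r⁻¹| • volume.restrict (e '' I) := by rw [hmap, Measure.restrict_smul]
      _ ≤ _ := by
          gcongr
          rintro _ ⟨s, hs, rfl⟩; exact hm s hs
  have h1 : MemLp f (ENNReal.ofReal p) (Measure.map e (volume.restrict I)) :=
    (MemLp.smul_measure hf ENNReal.ofReal_ne_top).mono_measure hle
  have h2 : MemLpOn p I (fun s => f (c + r * s)) :=
    (hmem.memLp_map_measure_iff).1 h1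
  refine ⟨h2, ?_⟩
  unfold lpNormOn
  have h3 : eLpNorm (fun s => f (c + r * s)) (ENNReal.ofReal p) (volume.restrict I) ≤
      ENNReal.ofReal |r⁻¹| ^ (1 / p) * eLpNorm f (ENNReal.ofReal p) (volume.restrict J) := by
    have : (fun s => f (c + r * s)) = f ∘ e := rfl
    rw [this, ← hmem.eLpNorm_map_measure]
    refine (eLpNorm_mono_measure f hle).trans ?_
    rw [eLpNorm_smul_measure_of_ne_top ENNReal.ofReal_ne_top, ENNReal.toReal_div,
      ENNReal.toReal_ofReal (by linarith : (0 : ℝ) ≤ p)]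
    simp
  refine (ENNReal.toReal_mono (ENNReal.mul_ne_top ?_ hf.2.ne) h3).trans ?_
  · exact ENNReal.rpow_ne_top_of_nonneg (by positivity) ENNReal.ofReal_ne_top
  · rw [ENNReal.toReal_mul, ← ENNReal.toReal_rpow, ENNReal.toReal_ofReal (abs_nonneg _), abs_inv]

end LpToolkit

/-! ### Fubini's theorem on a triangle. -/

section Fubini

variable {E : Type*} [NormedAddCommGroup E] [NormedSpace ℝ E]

/-- Fubini's theorem on a triangle, with the integrability of the inner integrals. -/
theorem integral_triangle_swap' {F : ℝ → ℝ → E} {a b : ℝ} (hab : a ≤ b)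
    (hF : Integrable (Function.uncurry F)
      ((volume.restrict (Ioc a b)).prod (volume.restrict (Ioc a b)))) :
    ∫ s in a..b, ∫ r in a..s, F s r = ∫ r in a..b, ∫ s in r..b, F s r ∧
    IntervalIntegrable (fun s => ∫ r in a..s, F s r) volume a b ∧
    IntervalIntegrable (fun r => ∫ s in r..b, F s r) volume a b := by
  let T : Set (ℝ × ℝ) := {z | z.2 ≤ z.1}
  have hT : MeasurableSet T := measurableSet_le measurable_snd measurable_fst
  have h1 : Integrable (Function.uncurry fun s r => T.indicator (Function.uncurry F) (s, r))
      ((volume.restrict (Ioc a b)).prod (volume.restrict (Ioc a b))) := hF.indicator hT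
  have e1 : ∀ s ∈ Ioc a b, ∫ r in a..s, F s r =
      ∫ r in Ioc a b, T.indicator (Function.uncurry F) (s, r) := by
    intro s hs
    rw [intervalIntegral.integral_of_le hs.1.le]
    have : (fun r => T.indicator (Function.uncurry F) (s, r)) = (Iic s).indicator (F s) := by
      ext r; simp only [indicator, T, mem_ofPred_eq, mem_Iic, Function.uncurry]
    rw [this, setIntegral_indicator measurableSet_Iic, Ioc_inter_Iic, min_eq_right hs.2]
  have e2 : ∀ r ∈ Ioc a b, ∫ s in r..b, F s r =
      ∫ s in Ioc a b, T.indicator (Function.uncurry F) (s, r) := by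
    intro r hr
    rw [intervalIntegral.integral_of_le hr.2]
    have : (fun s => T.indicator (Function.uncurry F) (s, r)) =
        (Ici r).indicator (fun s => F s r) := by
      ext s; simp only [indicator, T, mem_ofPred_eq, mem_Ici, Function.uncurry]
    rw [this, setIntegral_indicator measurableSet_Ici, ← integral_Icc_eq_integral_Ioc]
    congr 2
    ext s; simp only [mem_inter_iff, mem_Ioc, mem_Ici, mem_Icc]
    exact ⟨fun h => ⟨⟨hr.1.trans_le h.1, h.2⟩, h.1⟩, fun h => ⟨h.2, h.1.2⟩⟩
  refine ⟨?_, ?_, ?_⟩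
  · rw [intervalIntegral.integral_of_le hab, intervalIntegral.integral_of_le hab,
      setIntegral_congr_fun measurableSet_Ioc e1, setIntegral_congr_fun measurableSet_Ioc e2]
    exact integral_integral_swap h1
  · rw [intervalIntegrable_iff_integrableOn_Ioc_of_le hab]
    exact IntegrableOn.congr_fun h1.integral_prod_left (fun s hs => (e1 s hs).symm)
      measurableSet_Ioc
  · rw [intervalIntegrable_iff_integrableOn_Ioc_of_le hab]
    exact IntegrableOn.congr_fun h1.integral_prod_right (fun s hs => (e2 s hs).symm)
      measurableSet_Ioc

theorem integral_triangle_swap {F : ℝ → ℝ → E} {a b : ℝ} (hab : a ≤ b)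
    (hF : Integrable (Function.uncurry F)
      ((volume.restrict (Ioc a b)).prod (volume.restrict (Ioc a b)))) :
    ∫ s in a..b, ∫ r in a..s, F s r = ∫ r in a..b, ∫ s in r..b, F s r :=
  (integral_triangle_swap' hab hF).1

end Fubini

/-! ### Sobolev functions in integrated form: affine substitution and concatenation. -/

section Sobolev

variable {D X : Type*} [NormedAddCommGroup D] [NormedSpace ℝ D]
  [NormedAddCommGroup X] [NormedSpace ℝ X]

/-- `J` is an open interval with left end point `α`. -/
structure StartsAt (J : Set ℝ) (α : ℝ) : Prop where
  isOpen : IsOpen J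
  subset_Ioi : J ⊆ Ioi α
  Ioc_subset : ∀ t ∈ J, Ioc α t ⊆ J

theorem startsAt_Ioo (α β : ℝ) : StartsAt (Ioo α β) α :=
  ⟨isOpen_Ioo, fun _ h => h.1, fun _ ht _ hs => ⟨hs.1, hs.2.trans_lt ht.2⟩⟩

theorem startsAt_Ioi (α : ℝ) : StartsAt (Ioi α) α :=
  ⟨isOpen_Ioi, fun _ h => h, fun _ _ _ hs => hs.1⟩

theorem StartsAt.measurableSet {J : Set ℝ} {α : ℝ} (h : StartsAt J α) : MeasurableSet J :=
  h.isOpen.measurableSet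

theorem StartsAt.Ioo_subset {J : Set ℝ} {α : ℝ} (h : StartsAt J α) {t : ℝ} (ht : t ∈ J) :
    Ioo α t ⊆ J := Ioo_subset_Ioc_self.trans (h.Ioc_subset t ht)

/-- `u ∈ MR^p(J)` has weak derivative `du` and initial value `x` at the left end `α` of `J`,
in integrated form. -/
structure Sob (ι : D →L[ℝ] X) (p : ℝ) (J : Set ℝ) (α : ℝ) (x : X) (u : ℝ → D) (du : ℝ → X) :
    Prop where
  memLp : MemLpOn p J u
  memLp_deriv : MemLpOn p J du
  prim : ∀ᵐ t ∂(volume.restrict J), ι (u t) = x + ∫ s in α..t, du s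

variable {ι : D →L[ℝ] X} {p : ℝ} {J : Set ℝ} {α : ℝ} {x y : X} {u v : ℝ → D} {du dv : ℝ → X}

theorem MemLpOn.clm {Y Z : Type*} [NormedAddCommGroup Y] [NormedSpace ℝ Y]
    [NormedAddCommGroup Z] [NormedSpace ℝ Z] {f : ℝ → Y} (hf : MemLpOn p J f) (T : Y →L[ℝ] Z) :
    MemLpOn p J (fun t => T (f t)) := T.comp_memLp' hf

omit [NormedSpace ℝ X] in
theorem StartsAt.intervalIntegrable (hJ : StartsAt J α) (hp : 1 < p) (hf : MemLpOn p J du)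
    {t : ℝ} (ht : t ∈ J) : IntervalIntegrable du volume α t :=
  hf.intervalIntegrable hp (hJ.subset_Ioi ht).le (hJ.Ioo_subset ht)

theorem Sob.add (hp : 1 < p) (hJ : StartsAt J α) (hu : Sob ι p J α x u du)
    (hv : Sob ι p J α y v dv) :
    Sob ι p J α (x + y) (fun t => u t + v t) (fun t => du t + dv t) := by
  refine ⟨MemLp.add hu.1 hv.1, MemLp.add hu.2 hv.2, ?_⟩
  filter_upwards [hu.3, hv.3, ae_restrict_mem hJ.measurableSet] with t h1 h2 ht
  rw [map_add, h1, h2, intervalIntegral.integral_add (hJ.intervalIntegrable hp hu.2 ht)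
    (hJ.intervalIntegrable hp hv.2 ht)]
  abel

theorem Sob.const_smul (hu : Sob ι p J α x u du) (c : ℝ) :
    Sob ι p J α (c • x) (fun t => c • u t) (fun t => c • du t) := by
  refine ⟨MemLp.const_smul hu.1 c, MemLp.const_smul hu.2 c, ?_⟩
  filter_upwards [hu.3] with t h1
  rw [map_smul, h1, intervalIntegral.integral_smul, smul_add]

theorem Sob.sub (hp : 1 < p) (hJ : StartsAt J α) (hu : Sob ι p J α x u du)
    (hv : Sob ι p J α y v dv) :
    Sob ι p J α (x - y) (fun t => u t - v t) (fun t => du t - dv t) := by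
  simpa [sub_eq_add_neg] using hu.add hp hJ (hv.const_smul (-1))

theorem Sob.zero : Sob ι p J α 0 (fun _ => 0) (fun _ => 0) :=
  ⟨memLpOn_zero, memLpOn_zero, by simp⟩

theorem Sob.mono {I : Set ℝ} (hu : Sob ι p J α x u du) (h : I ⊆ J) : Sob ι p I α x u du :=
  ⟨hu.1.mono h, hu.2.mono h, ae_restrict_of_ae_restrict_of_subset h hu.3⟩

theorem integral_congr_of_ae_restrict {Y : Type*} [NormedAddCommGroup Y] [NormedSpace ℝ Y]
    {f g : ℝ → Y} {a b : ℝ} (hab : a ≤ b) (h : ∀ᵐ t ∂(volume.restrict (Ioo a b)), f t = g t) :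
    ∫ s in a..b, f s = ∫ s in a..b, g s := by
  rw [intervalIntegral.integral_of_le hab, intervalIntegral.integral_of_le hab,
    integral_Ioc_eq_integral_Ioo, integral_Ioc_eq_integral_Ioo]
  exact integral_congr_ae h

/-- The left end of `I` may be sent anywhere in the closure of `J`, so the new initial value is the
trace of `u` there. Negative `r` is allowed; this is how reflections enter. -/
theorem Sob.comp_affine (hp : 1 < p) (hJ : StartsAt J α) (hu : Sob ι p J α x u du) {I : Set ℝ}
    {γ c r : ℝ} (hI : StartsAt I γ)
    (hr : r ≠ 0) (hm : ∀ s ∈ I, c + r * s ∈ J) (hi : IntervalIntegrable du volume α (c + r * γ)) :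
    Sob ι p I γ (x + ∫ s in α..(c + r * γ), du s) (fun s => u (c + r * s))
      (fun s => r • du (c + r * s)) := by
  refine ⟨(hu.1.comp_affine hp hr hm).1, MemLp.const_smul (hu.2.comp_affine hp hr hm).1 r, ?_⟩
  have hq : Measure.QuasiMeasurePreserving (fun s : ℝ => c + r * s) volume volume := by
    refine ⟨by fun_prop, ?_⟩
    have : (fun s : ℝ => c + r * s) = (fun x => c + x) ∘ (fun x => r * x) := rfl
    rw [this, ← Measure.map_map (by fun_prop) (by fun_prop), Real.map_volume_mul_left hr,
      Measure.map_smul, map_add_left_eq_self]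
    exact Measure.smul_absolutelyContinuous
  have h3 := hq.ae ((ae_restrict_iff' hJ.measurableSet).1 hu.3)
  rw [ae_restrict_iff' hI.measurableSet]
  filter_upwards [h3] with s hs hsI
  rw [hs (hm s hsI), intervalIntegral.integral_smul, intervalIntegral.smul_integral_comp_add_mul,
    add_assoc, intervalIntegral.integral_add_adjacent_intervals hi]
  exact hi.symm.trans (hJ.intervalIntegrable hp hu.2 (hm s hsI))

theorem Sob.restart (hp : 1 < p) {β γ : ℝ} (hu : Sob ι p (Ioo α β) α x u du) (h1 : α ≤ γ)
    (h2 : γ ≤ β) : Sob ι p (Ioo γ β) γ (x + ∫ s in α..γ, du s) u du := by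
  have := hu.comp_affine hp (startsAt_Ioo α β) (I := Ioo γ β) (γ := γ) (c := 0) (r := 1)
    (startsAt_Ioo γ β) one_ne_zero (fun s hs => by simpa using ⟨h1.trans_lt hs.1, hs.2⟩)
    (by simpa using hu.2.intervalIntegrable hp h1 (Ioo_subset_Ioo_right h2))
  simpa using this

/-- Concatenation at time `γ`. -/
def concat {Y : Type*} (γ : ℝ) (u v : ℝ → Y) : ℝ → Y := fun t => if t < γ then u t else v t

theorem concat_ae_left {Y : Type*} {γ : ℝ} {u v : ℝ → Y} :
    ∀ᵐ t ∂(volume.restrict (Ioo α γ)), concat γ u v t = u t := by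
  filter_upwards [ae_restrict_mem measurableSet_Ioo] with t ht
  simp [concat, ht.2]

theorem concat_ae_right {Y : Type*} {γ : ℝ} {u v : ℝ → Y} :
    ∀ᵐ t ∂(volume.restrict (J ∩ Ioi γ)), concat γ u v t = v t := by
  filter_upwards [ae_restrict_of_ae_restrict_of_subset inter_subset_right
    (ae_restrict_mem measurableSet_Ioi)] with t ht
  simp [concat, not_lt.2 (le_of_lt (show γ < t from ht))]

theorem StartsAt.ae_split {γ : ℝ} (hJ : StartsAt J α) (hγ : γ ∈ J) :
    J =ᵐ[volume] (Ioo α γ ∪ (J ∩ Ioi γ) : Set ℝ) := by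
  have h : J = insert γ (Ioo α γ ∪ (J ∩ Ioi γ)) := by
    ext t
    simp only [mem_insert_iff, mem_union, mem_Ioo, mem_inter_iff, mem_Ioi]
    constructor
    · intro ht
      rcases lt_trichotomy t γ with h | h | h
      · exact Or.inr (Or.inl ⟨hJ.subset_Ioi ht, h⟩)
      · exact Or.inl h
      · exact Or.inr (Or.inr ⟨ht, h⟩)
    · rintro (h | h | h)
      · exact h ▸ hγ
      · exact hJ.Ioo_subset hγ h
      · exact h.1
  conv_lhs => rw [h]
  exact insert_ae_eq_self _ _

theorem StartsAt.memLpOn_concat {Y : Type*} [NormedAddCommGroup Y] {γ : ℝ} {u v : ℝ → Y}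
    (hJ : StartsAt J α) (hu : MemLpOn p (Ioo α γ) u) (hv : MemLpOn p (J ∩ Ioi γ) v) :
    MemLpOn p J (concat γ u v) := by
  have h : concat γ u v = (Iio γ).piecewise u v := by
    ext t; simp [concat, Set.piecewise]
  unfold MemLpOn at *
  rw [h]
  refine MemLp.piecewise measurableSet_Iio ?_ ?_
  · rw [Measure.restrict_restrict measurableSet_Iio]
    have hs : Iio γ ∩ J ⊆ Ioo α γ := fun t ht => ⟨hJ.subset_Ioi ht.2, ht.1⟩
    exact hu.mono_measure (Measure.restrict_mono hs le_rfl)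
  · rw [Measure.restrict_restrict measurableSet_Iio.compl, compl_Iio, inter_comm,
      ← Measure.restrict_congr_set ((ae_eq_refl J).inter (Ioi_ae_eq_Ici (a := γ)))]
    exact hv

theorem StartsAt.ae_of_split {γ : ℝ} (hJ : StartsAt J α) (hγ : γ ∈ J) {P : ℝ → Prop}
    (h1 : ∀ᵐ t ∂(volume.restrict (Ioo α γ)), P t)
    (h2 : ∀ᵐ t ∂(volume.restrict (J ∩ Ioi γ)), P t) : ∀ᵐ t ∂(volume.restrict J), P t := by
  rw [Measure.restrict_congr_set (hJ.ae_split hγ)]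
  exact (ae_restrict_union_iff _ _ _).2 ⟨h1, h2⟩

/-- The initial value of `v` is the trace of `u` at `γ`, so the two primitives join without a jump
and no point mass appears in the derivative. -/
theorem Sob.concat {γ : ℝ} (hp : 1 < p) (hJ : StartsAt J α) (hγ : γ ∈ J)
    (hu : Sob ι p (Ioo α γ) α x u du)
    (hv : Sob ι p (J ∩ Ioi γ) γ (x + ∫ s in α..γ, du s) v dv) :
    Sob ι p J α x (concat γ u v) (concat γ du dv) := by
  have hαγ : α ≤ γ := (hJ.subset_Ioi hγ).le
  refine ⟨hJ.memLpOn_concat hu.1 hv.1, hJ.memLpOn_concat hu.2 hv.2, ?_⟩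
  refine hJ.ae_of_split hγ ?_ ?_
  · filter_upwards [hu.3, concat_ae_left (u := u) (v := v), ae_restrict_mem measurableSet_Ioo]
      with t h1 h2 ht
    rw [h2, h1]
    congr 1
    exact integral_congr_of_ae_restrict ht.1.le ((ae_restrict_of_ae_restrict_of_subset
      (Ioo_subset_Ioo_right ht.2.le) concat_ae_left).mono fun _ h => h.symm)
  · filter_upwards [hv.3, concat_ae_right (u := u) (v := v),
      ae_restrict_mem (hJ.measurableSet.inter measurableSet_Ioi)] with t h1 h2 ht
    have hs : Ioo γ t ⊆ J ∩ Ioi γ := fun s hs =>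
      ⟨hJ.Ioc_subset t ht.1 ⟨hαγ.trans_lt hs.1, hs.2.le⟩, hs.1⟩
    have e1 : ∫ s in α..γ, MaxReg.concat γ du dv s = ∫ s in α..γ, du s :=
      integral_congr_of_ae_restrict hαγ concat_ae_left
    have e2 : ∫ s in γ..t, MaxReg.concat γ du dv s = ∫ s in γ..t, dv s :=
      integral_congr_of_ae_restrict (le_of_lt ht.2)
        (ae_restrict_of_ae_restrict_of_subset hs concat_ae_right)
    have hm := hJ.memLpOn_concat hu.2 hv.2
    rw [h2, h1, ← intervalIntegral.integral_add_adjacent_intervals (b := γ)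
      (hm.intervalIntegrable hp hαγ (hJ.Ioo_subset hγ))
      (hm.intervalIntegrable hp (le_of_lt ht.2) (hs.trans inter_subset_left)), e1, e2, add_assoc]

theorem Ioo_inter_Ioi' {β γ : ℝ} (h : α ≤ γ) : Ioo α β ∩ Ioi γ = Ioo γ β := by
  ext t; simp only [mem_inter_iff, mem_Ioo, mem_Ioi]
  exact ⟨fun h => ⟨h.2, h.1.2⟩, fun h' => ⟨⟨h.trans_lt h'.1, h'.2⟩, h'.1⟩⟩

theorem Ioi_inter_Ioi' {γ : ℝ} (h : α ≤ γ) : Ioi α ∩ Ioi γ = Ioi γ := by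
  rw [Ioi_inter_Ioi, max_eq_right h]

end Sobolev

/-! ### Product rule for primitives of integrable functions. -/

section ProductRule

variable {E : Type*} [NormedAddCommGroup E] [NormedSpace ℝ E] [CompleteSpace E]

omit [CompleteSpace E] in
/-- The primitive `t ↦ ∫_α^t w` of a function in `L^p(J)` has a continuous version on `ℝ`. -/
theorem StartsAt.exists_continuous_primitive {p : ℝ} {J : Set ℝ} {α : ℝ} {w : ℝ → E}
    (hp : 1 < p) (hJ : StartsAt J α) (hw : MemLpOn p J w) :
    ∃ W : ℝ → E, Continuous W ∧ W α = 0 ∧ ∀ t, α ≤ t → Ioo α t ⊆ J → W t = ∫ s in α..t, w s := by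
  have h1 : MemLp (J.indicator w) (ENNReal.ofReal p) volume :=
    (memLp_indicator_iff_restrict hJ.measurableSet).2 hw
  have h2 : LocallyIntegrable (J.indicator w) volume := h1.locallyIntegrable (one_le_ofReal hp)
  have h3 : ∀ a b, IntervalIntegrable (J.indicator w) volume a b := fun a b =>
    intervalIntegrable_iff.mpr
      ((h2.integrableOn_isCompact isCompact_uIcc).mono_set uIoc_subset_uIcc)
  refine ⟨fun t => ∫ s in α..t, J.indicator w s, intervalIntegral.continuous_primitive h3 α,
    intervalIntegral.integral_same, fun t ht hs => ?_⟩
  refine integral_congr_of_ae_restrict ht ?_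
  filter_upwards [ae_restrict_mem measurableSet_Ioo] with s hs'
  exact indicator_of_mem (hs hs') _

/-- Product rule for the primitive of an integrable function. -/
theorem integral_product_rule {φ φ' : ℝ → ℝ} {w : ℝ → E} {a t : ℝ} (hat : a ≤ t) (x : E)
    (hφ : ∀ s, HasDerivAt φ (φ' s) s) (hφ' : Continuous φ') (hw : IntervalIntegrable w volume a t) :
    ∫ s in a..t, (φ' s • (x + ∫ r in a..s, w r) + φ s • w s) =
      φ t • (x + ∫ r in a..t, w r) - φ a • x := by
  have hc : Continuous φ := continuous_iff_continuousAt.2 fun s => (hφ s).continuousAt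
  have hW : ContinuousOn (fun s => ∫ r in a..s, w r) (uIcc a t) := by
    refine intervalIntegral.continuousOn_primitive_interval ?_
    rw [uIcc_of_le hat, integrableOn_Icc_iff_integrableOn_Ioc]
    exact (intervalIntegrable_iff_integrableOn_Ioc_of_le hat).1 hw
  have hint : ∀ r ∈ uIcc a t, ∫ s in r..t, φ' s = φ t - φ r := fun r _ =>
    intervalIntegral.integral_eq_sub_of_hasDerivAt (fun s _ => hφ s)
      (hφ'.intervalIntegrable _ _)
  -- Integrating `φ'` first over the triangle `r ≤ s` avoids differentiating the primitive, so `w`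
  -- need only be integrable.
  have e1 : ∫ s in a..t, φ' s • (∫ r in a..s, w r) = ∫ r in a..t, (φ t - φ r) • w r := by
    have hF : Integrable (Function.uncurry fun s r => φ' s • w r)
        ((volume.restrict (Ioc a t)).prod (volume.restrict (Ioc a t))) :=
      Integrable.smul_prod (f := φ') (g := w)
        ((hφ'.integrableOn_Icc (a := a) (b := t)).mono_set Ioc_subset_Icc_self)
        ((intervalIntegrable_iff_integrableOn_Ioc_of_le hat).1 hw)
    have h := integral_triangle_swap hat hF
    simp only [intervalIntegral.integral_smul, intervalIntegral.integral_smul_const] at h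
    rw [h]
    refine intervalIntegral.integral_congr fun r hr => ?_
    rw [hint r hr]
  have i1 : IntervalIntegrable (fun s => φ' s • x) volume a t :=
    (hφ'.smul continuous_const).intervalIntegrable _ _
  have i2 : IntervalIntegrable (fun s => φ' s • (∫ r in a..s, w r)) volume a t :=
    (hφ'.continuousOn.smul hW).intervalIntegrable
  have i3 : IntervalIntegrable (fun s => φ s • w s) volume a t :=
    hw.continuousOn_smul hc.continuousOn
  have i4 : IntervalIntegrable (fun s => φ t • w s) volume a t := hw.smul (φ t)
  simp only [smul_add]
  rw [intervalIntegral.integral_add (i1.add i2) i3, intervalIntegral.integral_add i1 i2, e1,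
    intervalIntegral.integral_smul_const, hint a left_mem_uIcc]
  simp only [sub_smul]
  rw [intervalIntegral.integral_sub i4 i3, intervalIntegral.integral_smul]
  abel

end ProductRule

/-! ### The integrated form implies the weak form. -/

section WeakDerivative

variable {D X : Type*} [NormedAddCommGroup D] [NormedSpace ℝ D]
  [NormedAddCommGroup X] [NormedSpace ℝ X] [CompleteSpace X]
  {ι : D →L[ℝ] X} {p : ℝ} {J : Set ℝ} {α : ℝ} {x y : X} {u v : ℝ → D} {du dv : ℝ → X}

theorem MemLpOn.continuous_smul {Y : Type*} [NormedAddCommGroup Y] [NormedSpace ℝ Y] {ψ : ℝ → ℝ}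
    {f : ℝ → Y} {α β : ℝ} (hf : MemLpOn p (Ioo α β) f) (hψ : Continuous ψ) :
    MemLpOn p (Ioo α β) (fun t => ψ t • f t) := by
  obtain ⟨c, hc⟩ := (isCompact_Icc (a := α) (b := β)).exists_bound_of_continuousOn hψ.continuousOn
  refine hf.of_le_mul (c := c) (hψ.aestronglyMeasurable.smul hf.1) ?_
  filter_upwards [ae_restrict_mem measurableSet_Ioo] with t ht
  rw [norm_smul]
  exact mul_le_mul_of_nonneg_right (hc t (Ioo_subset_Icc_self ht)) (norm_nonneg _)

theorem Sob.smul {β : ℝ} {φ φ' : ℝ → ℝ} (hp : 1 < p) (hu : Sob ι p (Ioo α β) α x u du)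
    (hφ : ∀ s, HasDerivAt φ (φ' s) s) (hφ' : Continuous φ') :
    Sob ι p (Ioo α β) α (φ α • x) (fun t => φ t • u t) (fun t => φ' t • ι (u t) + φ t • du t) := by
  have hc : Continuous φ := continuous_iff_continuousAt.2 fun s => (hφ s).continuousAt
  refine ⟨hu.1.continuous_smul hc,
    MemLp.add ((hu.1.clm ι).continuous_smul hφ') (hu.2.continuous_smul hc), ?_⟩
  filter_upwards [hu.3, ae_restrict_mem measurableSet_Ioo] with t h1 ht
  have hs : Ioo α t ⊆ Ioo α β := Ioo_subset_Ioo_right ht.2.le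
  have h2 := integral_product_rule ht.1.le x hφ hφ' (hu.2.intervalIntegrable hp ht.1.le hs)
  have h4 : ∫ s in α..t, (φ' s • ι (u s) + φ s • du s) =
      ∫ s in α..t, (φ' s • (x + ∫ r in α..s, du r) + φ s • du s) := by
    refine integral_congr_of_ae_restrict ht.1.le ?_
    filter_upwards [ae_restrict_of_ae_restrict_of_subset hs hu.3] with s h3
    rw [h3]
  rw [map_smul, h1, h4, h2, add_sub_cancel]

/-- Smooth compactly supported test functions. -/
structure IsTest (J : Set ℝ) (φ : ℝ → ℝ) : Prop where
  contDiff : ContDiff ℝ (⊤ : ℕ∞) φ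
  compact : HasCompactSupport φ
  subset : tsupport φ ⊆ J

/-- The point `c₂` replaces integrals over the possibly unbounded `J` by interval integrals from
`α`. The point `t₀` is adjoined to the support so that its extreme points exist even for `φ = 0`. -/
theorem StartsAt.exists_bounds (hJ : StartsAt J α) (hne : J.Nonempty) {φ : ℝ → ℝ}
    (hφ : IsTest J φ) : ∃ c₁ c₂, α < c₁ ∧ c₁ ≤ c₂ ∧ c₂ ∈ J ∧ tsupport φ ⊆ Ioo c₁ c₂ := by
  obtain ⟨t₀, ht₀⟩ := hne
  obtain ⟨K, hK, hKJ⟩ : ∃ K, K = insert t₀ (tsupport φ) ∧ K ⊆ J :=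
    ⟨_, rfl, insert_subset ht₀ hφ.subset⟩
  have hc : IsCompact K := hK ▸ IsCompact.insert hφ.compact t₀
  have hKn : K.Nonempty := ⟨t₀, hK ▸ mem_insert _ _⟩
  obtain ⟨m, hm⟩ := hc.exists_isLeast hKn
  obtain ⟨M, hM⟩ := hc.exists_isGreatest hKn
  obtain ⟨c₂, h1, h2⟩ : ∃ c₂, M < c₂ ∧ c₂ ∈ J := by
    have := mem_nhdsGT_iff_exists_Ioo_subset.1
      (mem_nhdsWithin_of_mem_nhds (hJ.isOpen.mem_nhds (hKJ hM.1)) : J ∈ 𝓝[>] M)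
    obtain ⟨u, hu, hs⟩ := this
    exact ⟨(M + u) / 2, by linarith [mem_Ioi.1 hu],
      hs ⟨by linarith [mem_Ioi.1 hu], by linarith [mem_Ioi.1 hu]⟩⟩
  have h3 : α < m := hJ.subset_Ioi (hKJ hm.1)
  have h4 : m ≤ M := hm.2 hM.1
  refine ⟨(α + m) / 2, c₂, by linarith, by linarith, h2, fun t ht => ?_⟩
  have ht' : t ∈ K := hK ▸ mem_insert_of_mem _ ht
  exact ⟨by linarith [hm.2 ht'], by linarith [hM.2 ht']⟩

theorem eq_zero_of_notMem_tsupport {φ : ℝ → ℝ} {t : ℝ} (h : t ∉ tsupport φ) : φ t = 0 :=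
  image_eq_zero_of_notMem_tsupport h

theorem deriv_eq_zero_of_notMem_tsupport {φ : ℝ → ℝ} {t : ℝ} (h : t ∉ tsupport φ) :
    deriv φ t = 0 := by
  by_contra h'
  exact h (support_deriv_subset h')

theorem IsTest.hasDerivAt {φ : ℝ → ℝ} (hφ : IsTest J φ) (s : ℝ) :
    HasDerivAt φ (deriv φ s) s :=
  (hφ.contDiff.differentiable (by simp) s).hasDerivAt

theorem IsTest.continuous_deriv {φ : ℝ → ℝ} (hφ : IsTest J φ) : Continuous (deriv φ) :=
  hφ.contDiff.continuous_deriv (by simp)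

omit [CompleteSpace X] in
theorem StartsAt.setIntegral_eq (hJ : StartsAt J α) {c₂ : ℝ} (h2 : c₂ ∈ J)
    {g : ℝ → X} (hg : ∀ t, t ∉ Ioo α c₂ → g t = 0) : ∫ t in J, g t = ∫ t in α..c₂, g t := by
  rw [intervalIntegral.integral_of_le (hJ.subset_Ioi h2).le]
  refine setIntegral_eq_of_subset_of_forall_sdiff_eq_zero hJ.measurableSet (hJ.Ioc_subset _ h2) ?_
  exact fun t ht => hg t fun h => ht.2 (Ioo_subset_Ioc_self h)

/-- Integration by parts against a test function. -/
theorem StartsAt.weakDeriv_primitive (hp : 1 < p) (hJ : StartsAt J α) (hne : J.Nonempty) {w : ℝ → X}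
    (hw : MemLpOn p J w) (x : X) {φ : ℝ → ℝ} (hφ : IsTest J φ) :
    ∃ c ∈ J, (∀ t, t ∉ Ioo α c → φ t = 0 ∧ deriv φ t = 0) ∧
    ∫ t in α..c, deriv φ t • (x + ∫ s in α..t, w s) = - ∫ t in α..c, φ t • w t := by
  obtain ⟨c₁, c, h1, h12, h2, hs⟩ := hJ.exists_bounds hne hφ
  have h0 : ∀ t, t ∉ Ioo α c → φ t = 0 ∧ deriv φ t = 0 := fun t ht => by
    have : t ∉ tsupport φ := fun h => ht ⟨h1.trans (hs h).1, (hs h).2⟩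
    exact ⟨eq_zero_of_notMem_tsupport this, deriv_eq_zero_of_notMem_tsupport this⟩
  refine ⟨c, h2, h0, ?_⟩
  have hac : α ≤ c := (hJ.subset_Ioi h2).le
  have hw' := hJ.intervalIntegrable hp hw h2
  have h := integral_product_rule hac x hφ.hasDerivAt hφ.continuous_deriv hw'
  have hW : ContinuousOn (fun s => ∫ r in α..s, w r) (uIcc α c) := by
    refine intervalIntegral.continuousOn_primitive_interval ?_
    rw [uIcc_of_le hac, integrableOn_Icc_iff_integrableOn_Ioc]
    exact (intervalIntegrable_iff_integrableOn_Ioc_of_le hac).1 hw'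
  rw [intervalIntegral.integral_add, (h0 c (by simp)).1, (h0 α (by simp)).1] at h
  · simpa using eq_neg_of_add_eq_zero_left (by simpa using h)
  · exact (hφ.continuous_deriv.continuousOn.smul (continuousOn_const.add hW)).intervalIntegrable
  · exact hw'.continuousOn_smul hφ.contDiff.continuous.continuousOn

theorem Sob.hasWeakDerivOn (hp : 1 < p) (hJ : StartsAt J α) (hu : Sob ι p J α x u du) :
    HasWeakDerivOn J (fun t => ι (u t)) du := by
  intro φ h1 h2 h3
  have hφ : IsTest J φ := ⟨h1, h2, h3⟩
  rcases J.eq_empty_or_nonempty with rfl | hne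
  · simp
  obtain ⟨c, hc, h0, h⟩ := hJ.weakDeriv_primitive hp hne hu.2 x hφ
  have e1 : ∫ t in J, φ t • du t = ∫ t in α..c, φ t • du t :=
    hJ.setIntegral_eq hc (fun t ht => by rw [(h0 t ht).1, zero_smul])
  have e2 : ∫ t in J, deriv φ t • ι (u t) = ∫ t in α..c, deriv φ t • ι (u t) :=
    hJ.setIntegral_eq hc (fun t ht => by rw [(h0 t ht).2, zero_smul])
  rw [e1, e2, neg_eq_iff_eq_neg, ← h]
  refine integral_congr_of_ae_restrict (hJ.subset_Ioi hc).le ?_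
  filter_upwards [ae_restrict_of_ae_restrict_of_subset (hJ.Ioo_subset hc) hu.3] with t ht
  rw [ht]

end WeakDerivative

/-! ### The du Bois-Reymond lemma: the weak form implies the integrated form. -/

section DuBoisReymond

variable {D X : Type*} [NormedAddCommGroup D] [NormedSpace ℝ D]
  [NormedAddCommGroup X] [NormedSpace ℝ X] [CompleteSpace X]
  {ι : D →L[ℝ] X} {p : ℝ} {J : Set ℝ} {α : ℝ} {x y : X} {u v : ℝ → D} {du dv : ℝ → X}

omit [CompleteSpace X] in
theorem StartsAt.integrableOn_test_smul (hJ : StartsAt J α) (hne : J.Nonempty) {g : ℝ → X}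
    (hg : ∀ t ∈ J, IntervalIntegrable g volume α t) {φ : ℝ → ℝ} (hφ : IsTest J φ) :
    Integrable (fun t => φ t • g t) volume := by
  obtain ⟨c₁, c, h1, h12, h2, hs⟩ := hJ.exists_bounds hne hφ
  have h3 := (hg c h2).continuousOn_smul (hφ.contDiff.continuous.continuousOn)
  rw [intervalIntegrable_iff_integrableOn_Ioc_of_le (hJ.subset_Ioi h2).le] at h3
  refine (integrableOn_iff_integrable_of_support_subset fun t ht => ?_).1 h3
  have : t ∈ tsupport φ := by
    by_contra h
    exact ht (by simp [eq_zero_of_notMem_tsupport h])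
  exact ⟨h1.trans (hs this).1, (hs this).2.le⟩

/-- A test function with vanishing integral is the derivative of a test function. -/
theorem IsTest.exists_primitive (hJ : StartsAt J α) (hne : J.Nonempty) {φ : ℝ → ℝ}
    (hφ : IsTest J φ) (h0 : ∫ t, φ t = 0) : ∃ χ, IsTest J χ ∧ deriv χ = φ := by
  obtain ⟨c₁, c, h1, h12, h2, hs⟩ := hJ.exists_bounds hne hφ
  have hc : Continuous φ := hφ.contDiff.continuous
  have hz : ∀ t, t ∉ Ioo c₁ c → φ t = 0 := fun t ht =>
    eq_zero_of_notMem_tsupport fun h => ht (hs h)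
  let χ : ℝ → ℝ := fun t => ∫ s in c₁..t, φ s
  have hd : ∀ t, HasDerivAt χ (φ t) t := fun t =>
    intervalIntegral.integral_hasDerivAt_right (hc.intervalIntegrable _ _)
      hc.aestronglyMeasurable.stronglyMeasurableAtFilter hc.continuousAt
  have hder : deriv χ = φ := funext fun t => (hd t).deriv
  have hsm : ContDiff ℝ (⊤ : ℕ∞) χ := by
    refine contDiff_infty_iff_deriv.2 ⟨fun t => (hd t).differentiableAt, ?_⟩
    rw [hder]; exact hφ.contDiff
  have hχ : Function.support χ ⊆ Icc c₁ c := by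
    intro t ht
    by_contra h
    refine ht ?_
    rw [mem_Icc, not_and_or, not_le, not_le] at h
    rcases h with h | h
    · change ∫ s in c₁..t, φ s = 0
      rw [intervalIntegral.integral_symm, intervalIntegral.integral_of_le h.le,
        integral_Ioc_eq_integral_Ioo, setIntegral_eq_zero_of_forall_eq_zero, neg_zero]
      exact fun s hs => hz s fun h' => by linarith [h'.1, hs.2]
    -- To the right of the support `χ` is the full integral of `φ`, which vanishes by hypothesis.
    · change ∫ s in c₁..t, φ s = 0
      rw [intervalIntegral.integral_of_le (h12.trans h.le), ← h0]
      refine setIntegral_eq_integral_of_forall_compl_eq_zero fun s hs => hz s fun h' => hs ?_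
      exact ⟨h'.1, (h'.2.trans h).le⟩
  have hts : tsupport χ ⊆ Icc c₁ c := closure_minimal hχ isClosed_Icc
  refine ⟨χ, ⟨hsm, isCompact_Icc.of_isClosed_subset (isClosed_tsupport _) hts,
    hts.trans fun t ht => hJ.Ioc_subset c h2 ⟨h1.trans_le ht.1, ht.2⟩⟩, hder⟩

theorem exists_isTest_integral_one (hJ : IsOpen J) (hne : J.Nonempty) :
    ∃ ψ, IsTest J ψ ∧ ∫ t, ψ t = 1 := by
  obtain ⟨c, hc⟩ := hne
  obtain ⟨r, hr, hb⟩ := Metric.isOpen_iff.1 hJ c hc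
  let f : ContDiffBump c := ⟨r / 4, r / 2, by positivity, by linarith⟩
  refine ⟨f.normed volume, ⟨f.contDiff_normed, f.hasCompactSupport_normed, ?_⟩, f.integral_normed⟩
  rw [f.tsupport_normed_eq]
  exact (Metric.closedBall_subset_ball (by change r / 2 < r; linarith)).trans hb

/-- Fix a test function `ψ` of integral one. Each `φ` is `(∫ φ) ψ` plus a test function of mean
zero, that is, a derivative, against which `g` integrates to zero. Hence `g - ∫ ψ g` integrates to
zero against every `φ`. -/
theorem StartsAt.ae_eq_const_of_weakDeriv_zero (hJ : StartsAt J α) (hne : J.Nonempty) {g : ℝ → X}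
    (hg : ∀ t ∈ J, IntervalIntegrable g volume α t)
    (h : ∀ φ, IsTest J φ → ∫ t, deriv φ t • g t = 0) :
    ∃ x, ∀ᵐ t ∂(volume.restrict J), g t = x := by
  obtain ⟨ψ, hψ, hψ1⟩ := exists_isTest_integral_one hJ.isOpen hne
  refine ⟨∫ t, ψ t • g t, ?_⟩
  set x := ∫ t, ψ t • g t with hx
  have hk : ∀ φ, IsTest J φ → ∫ t, φ t • (g t - x) = 0 := by
    intro φ hφ
    have iφ : Integrable φ := hφ.contDiff.continuous.integrable_of_hasCompactSupport hφ.compact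
    have iψ : Integrable ψ := hψ.contDiff.continuous.integrable_of_hasCompactSupport hψ.compact
    obtain ⟨m, hm⟩ : ∃ m, m = ∫ t, φ t := ⟨_, rfl⟩
    have hts : tsupport (fun t => φ t - m * ψ t) ⊆ tsupport φ ∪ tsupport ψ := by
      refine closure_minimal (fun t ht => ?_) ((isClosed_tsupport _).union (isClosed_tsupport _))
      by_contra hh
      rw [mem_union, not_or] at hh
      exact ht (by simp [eq_zero_of_notMem_tsupport hh.1, eq_zero_of_notMem_tsupport hh.2])
    have h1 : IsTest J (fun t => φ t - m * ψ t) := by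
      refine ⟨hφ.contDiff.sub (contDiff_const.mul hψ.contDiff), ?_, ?_⟩
      · exact (IsCompact.union hφ.compact hψ.compact).of_isClosed_subset (isClosed_tsupport _) hts
      · exact hts.trans (union_subset hφ.subset hψ.subset)
    obtain ⟨χ, hχ, hd⟩ := h1.exists_primitive hJ hne (by
      rw [integral_sub iφ (iψ.const_mul m), integral_const_mul, hψ1, hm]; ring)
    have h2 := h χ hχ
    rw [hd] at h2
    have i1 := hJ.integrableOn_test_smul hne hg hφ
    have i2 := hJ.integrableOn_test_smul hne hg hψ
    simp only [sub_smul, mul_smul] at h2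
    have i3 : Integrable (fun t => m • ψ t • g t) volume := i2.smul m
    rw [integral_sub i1 i3, integral_smul, ← hx] at h2
    simp only [smul_sub]
    rw [integral_sub i1 (iφ.smul_const x), integral_smul_const, ← hm, h2]
  have hloc : LocallyIntegrableOn (fun t => g t - x) J := by
    refine LocallyIntegrableOn.sub ?_ (locallyIntegrableOn_const x)
    rw [locallyIntegrableOn_iff hJ.isOpen.isLocallyClosed]
    intro K hKJ hK
    rcases K.eq_empty_or_nonempty with rfl | hKn
    · simp
    obtain ⟨M, hM⟩ := hK.exists_isGreatest hKn
    refine IntegrableOn.mono_set ((intervalIntegrable_iff_integrableOn_Ioc_of_le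
      (hJ.subset_Ioi (hKJ hM.1)).le).1 (hg M (hKJ hM.1))) fun t ht => ?_
    exact ⟨hJ.subset_Ioi (hKJ ht), hM.2 ht⟩
  have := hJ.isOpen.ae_eq_zero_of_integral_contDiff_smul_eq_zero hloc
    fun φ h1 h2 h3 => hk φ ⟨h1, h2, h3⟩
  rw [ae_restrict_iff' hJ.measurableSet]
  filter_upwards [this] with t ht htJ using sub_eq_zero.1 (ht htJ)

/-- The difference of `ι u` and the primitive of `du` has weak derivative zero; the constant it
equals is the initial value. -/
theorem IsMRFun.exists_sob (hp : 1 < p) (hJ : StartsAt J α) (hne : J.Nonempty)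
    (h : IsMRFun ι p J u du) : ∃ x, Sob ι p J α x u du := by
  obtain ⟨h1, h2, h3⟩ := h
  have hint : ∀ t ∈ J, IntervalIntegrable (fun t => ι (u t)) volume α t := fun t ht =>
    hJ.intervalIntegrable hp (h1.clm ι) ht
  have hprim : ∀ t ∈ J, IntervalIntegrable (fun t => ∫ s in α..t, du s) volume α t := by
    intro t ht
    have hat : α ≤ t := le_of_lt (hJ.subset_Ioi ht)
    refine (intervalIntegral.continuousOn_primitive_interval ?_).intervalIntegrable
    rw [uIcc_of_le hat, integrableOn_Icc_iff_integrableOn_Ioc]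
    exact (intervalIntegrable_iff_integrableOn_Ioc_of_le hat).1 (hJ.intervalIntegrable hp h2 ht)
  obtain ⟨x, hx⟩ := hJ.ae_eq_const_of_weakDeriv_zero hne
    (g := fun t => ι (u t) - ∫ s in α..t, du s) (fun t ht => (hint t ht).sub (hprim t ht)) (by
      intro φ hφ
      have hφ' : IsTest J (deriv φ) := ⟨(contDiff_infty_iff_deriv.1 hφ.contDiff).2,
        hφ.compact.deriv, (tsupport_deriv_subset).trans hφ.subset⟩
      obtain ⟨c, hc, h0, hw⟩ := hJ.weakDeriv_primitive hp hne h2 0 hφ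
      have e1 := h3 φ hφ.contDiff hφ.compact hφ.subset
      rw [hJ.setIntegral_eq hc (g := fun t => φ t • du t)
        (fun t ht => by rw [(h0 t ht).1, zero_smul]), ← neg_eq_iff_eq_neg.2 hw, neg_inj] at e1
      simp only [zero_add] at e1
      have i1 := hJ.integrableOn_test_smul hne hint hφ'
      have i2 := hJ.integrableOn_test_smul hne hprim hφ'
      simp only [smul_sub]
      have e2 := setIntegral_eq_integral_of_forall_compl_eq_zero (μ := volume) (s := J)
        (f := fun t => deriv φ t • ι (u t)) (fun t ht => by
          rw [deriv_eq_zero_of_notMem_tsupport fun h => ht (hφ.subset h), zero_smul])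
      have e3 := setIntegral_eq_integral_of_forall_compl_eq_zero (μ := volume) (s := J)
        (f := fun t => deriv φ t • ∫ s in α..t, du s) (fun t ht => by
          rw [deriv_eq_zero_of_notMem_tsupport fun h => ht (hφ.subset h), zero_smul])
      have e4 := hJ.setIntegral_eq hc (g := fun t => deriv φ t • ∫ s in α..t, du s)
        (fun t ht => by rw [(h0 t ht).2, zero_smul])
      rw [integral_sub i1 i2, ← e2, ← e3, e4, e1, sub_self])
  refine ⟨x, h1, h2, ?_⟩
  filter_upwards [hx] with t ht
  rw [← ht]; abel

/-- `u` solves `u' + A u = f` on `J` with initial value `x`, in integrated form. -/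
structure Sol (ι : D →L[ℝ] X) (p : ℝ) (J : Set ℝ) (α : ℝ) (A : ℝ → D →L[ℝ] X) (x : X) (f : ℝ → X)
    (u : ℝ → D) (du : ℝ → X) : Prop where
  sob : Sob ι p J α x u du
  equation : ∀ᵐ t ∂(volume.restrict J), du t + A t (u t) = f t

/-- The continuous version in the initial condition and `x + ∫ du` are continuous and agree almost
everywhere on `J`, hence everywhere on `J`, hence in the limit at the left end; so the initial
condition says `x = 0`. -/
theorem StartsAt.isStrongSolution_iff (hp : 1 < p) (hJ : StartsAt J α) (hne : J.Nonempty)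
    {A : ℝ → D →L[ℝ] X} {f : ℝ → X} :
    IsStrongSolution ι p J A f u du ↔ Sol ι p J α A 0 f u du := by
  obtain ⟨t₀, ht₀⟩ := hne
  have hα : α < t₀ := hJ.subset_Ioi ht₀
  have hsub : Ioo α t₀ ⊆ J := hJ.Ioo_subset ht₀
  have hcl : α ∈ closure J := closure_mono hsub (by
    rw [closure_Ioo hα.ne]; exact left_mem_Icc.2 hα.le)
  have hinf : sInf J = α := by
    refine IsGLB.csInf_eq ⟨fun t ht => (hJ.subset_Ioi ht).le, fun b hb => ?_⟩ ⟨t₀, ht₀⟩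
    exact (isGLB_Ioo hα).2 fun t ht => hb (hsub ht)
  constructor
  · rintro ⟨h1, h2, w, hw, hwu, hw0⟩
    obtain ⟨x, hx⟩ := h1.exists_sob hp hJ ⟨t₀, ht₀⟩
    obtain ⟨W, hW, hW0, hWe⟩ := hJ.exists_continuous_primitive hp hx.2
    have he : EqOn w (fun t => x + W t) J := by
      refine Measure.eqOn_open_of_ae_eq (μ := volume) ?_ hJ.isOpen (hw.mono subset_closure)
        (by fun_prop)
      filter_upwards [hwu, hx.3, ae_restrict_mem hJ.measurableSet] with t h3 h4 h5
      rw [h3, h4, hWe t (hJ.subset_Ioi h5).le (hJ.Ioo_subset h5)]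
    have hnb : (𝓝[J] α).NeBot := mem_closure_iff_nhdsWithin_neBot.1 hcl
    have t1 : Tendsto w (𝓝[J] α) (𝓝 (w α)) :=
      (hw α hcl).mono_left (nhdsWithin_mono _ subset_closure)
    have t2 : Tendsto w (𝓝[J] α) (𝓝 (x + W α)) := by
      refine Tendsto.congr' ?_ (((continuous_const.add hW).tendsto α).mono_left nhdsWithin_le_nhds)
      filter_upwards [self_mem_nhdsWithin] with t ht using (he ht).symm
    have h3 := tendsto_nhds_unique t1 t2
    rw [hinf] at hw0
    rw [hw0, hW0, add_zero] at h3
    subst h3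
    exact ⟨hx, h2⟩
  · rintro ⟨h1, h2⟩
    refine ⟨⟨h1.1, h1.2, h1.hasWeakDerivOn hp hJ⟩, h2, ?_⟩
    obtain ⟨W, hW, hW0, hWe⟩ := hJ.exists_continuous_primitive hp h1.2
    refine ⟨W, hW.continuousOn, ?_, hinf ▸ hW0⟩
    filter_upwards [h1.3, ae_restrict_mem hJ.measurableSet] with t h3 h5
    rw [h3, hWe t (hJ.subset_Ioi h5).le (hJ.Ioo_subset h5), zero_add]

end DuBoisReymond

/-! ### The `ℓ^p` norm of triples, the shape of the norm of `MR^p`. -/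

section TripleNorm

/-- The `ℓ^p` norm of a triple. -/
def tripleNorm (p x y z : ℝ) : ℝ := (x ^ p + y ^ p + z ^ p) ^ (1 / p)

variable {p x y z x' y' z' : ℝ}

theorem tripleNorm_nonneg (hx : 0 ≤ x) (hy : 0 ≤ y) (hz : 0 ≤ z) : 0 ≤ tripleNorm p x y z := by
  unfold tripleNorm; positivity

theorem tripleNorm_mono (hp : 1 < p) (hx : 0 ≤ x) (hy : 0 ≤ y) (hz : 0 ≤ z) (hx' : x ≤ x')
    (hy' : y ≤ y') (hz' : z ≤ z') : tripleNorm p x y z ≤ tripleNorm p x' y' z' := by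
  unfold tripleNorm
  have : 0 ≤ p := by linarith
  gcongr

theorem tripleNorm_add_le (hp : 1 < p) (hx : 0 ≤ x) (hy : 0 ≤ y) (hz : 0 ≤ z) (hx' : 0 ≤ x')
    (hy' : 0 ≤ y') (hz' : 0 ≤ z') : tripleNorm p (x + x') (y + y') (z + z') ≤
      tripleNorm p x y z + tripleNorm p x' y' z' := by
  have h := Real.Lp_add_le_of_nonneg (s := (Finset.univ : Finset (Fin 3))) (f := ![x, y, z])
    (g := ![x', y', z']) hp.le (by intro i _; fin_cases i <;> simpa)
    (by intro i _; fin_cases i <;> simpa)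
  simpa [Fin.sum_univ_three, tripleNorm] using h

theorem tripleNorm_rpow (hp : 1 < p) (hx : 0 ≤ x) (hy : 0 ≤ y) (hz : 0 ≤ z) :
    tripleNorm p x y z ^ p = x ^ p + y ^ p + z ^ p := by
  unfold tripleNorm
  rw [← Real.rpow_mul (by positivity), one_div_mul_cancel (by linarith), Real.rpow_one]

theorem tripleNorm_le_iff (hp : 1 < p) (hx : 0 ≤ x) (hy : 0 ≤ y) (hz : 0 ≤ z) {m : ℝ}
    (hm : 0 ≤ m) : tripleNorm p x y z ≤ m ↔ x ^ p + y ^ p + z ^ p ≤ m ^ p := by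
  rw [← tripleNorm_rpow hp hx hy hz,
    Real.rpow_le_rpow_iff (tripleNorm_nonneg hx hy hz) hm (by linarith)]

theorem le_tripleNorm_snd (hp : 1 < p) (hx : 0 ≤ x) (hy : 0 ≤ y) (hz : 0 ≤ z) :
    y ≤ tripleNorm p x y z := by
  rw [← Real.rpow_le_rpow_iff hy (tripleNorm_nonneg hx hy hz) (by linarith : 0 < p),
    tripleNorm_rpow hp hx hy hz]
  have := Real.rpow_nonneg hx p
  have := Real.rpow_nonneg hz p
  linarith

theorem le_tripleNorm_thd (hp : 1 < p) (hx : 0 ≤ x) (hy : 0 ≤ y) (hz : 0 ≤ z) :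
    z ≤ tripleNorm p x y z := by
  rw [← Real.rpow_le_rpow_iff hz (tripleNorm_nonneg hx hy hz) (by linarith : 0 < p),
    tripleNorm_rpow hp hx hy hz]
  have := Real.rpow_nonneg hx p
  have := Real.rpow_nonneg hy p
  linarith

theorem tripleNorm_mul (hp : 1 < p) (hx : 0 ≤ x) (hy : 0 ≤ y) (hz : 0 ≤ z) {c : ℝ} (hc : 0 ≤ c) :
    tripleNorm p (c * x) (c * y) (c * z) = c * tripleNorm p x y z := by
  unfold tripleNorm
  rw [Real.mul_rpow hc hx, Real.mul_rpow hc hy, Real.mul_rpow hc hz, ← mul_add, ← mul_add,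
    Real.mul_rpow (by positivity) (by positivity), ← Real.rpow_mul hc,
    mul_one_div_cancel (by linarith), Real.rpow_one]

theorem tripleNorm_le_add (hp : 1 < p) (hx : 0 ≤ x) (hy : 0 ≤ y) (hz : 0 ≤ z) :
    tripleNorm p x y z ≤ x + y + z := by
  rw [tripleNorm_le_iff hp hx hy hz (by positivity)]
  exact (add_le_add_left (Real.add_rpow_le_rpow_add hx hy hp.le) _).trans
    (Real.add_rpow_le_rpow_add (by positivity) hz hp.le)

/-- Hölder's inequality for two terms. -/
theorem add_le_two_rpow_mul_tripleNorm (hp : 1 < p) (hx : 0 ≤ x) (hy : 0 ≤ y) (hz : 0 ≤ z) :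
    y + z ≤ 2 ^ (1 - 1 / p) * tripleNorm p x y z := by
  have hp0 : 0 < p := by linarith
  have h1 : (y + z) ^ p ≤ 2 ^ (p - 1) * (y ^ p + z ^ p) := by
    lift y to ℝ≥0 using hy
    lift z to ℝ≥0 using hz
    exact_mod_cast NNReal.rpow_add_le_mul_rpow_add_rpow y z hp.le
  rw [← Real.rpow_le_rpow_iff (by positivity)
    (mul_nonneg (by positivity) (tripleNorm_nonneg hx hy hz)) hp0,
    Real.mul_rpow (by positivity) (tripleNorm_nonneg hx hy hz), tripleNorm_rpow hp hx hy hz,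
    ← Real.rpow_mul (by norm_num)]
  have e : (1 - 1 / p) * p = p - 1 := by field_simp
  rw [e]
  refine h1.trans ?_
  gcongr
  have := Real.rpow_nonneg hx p
  linarith

end TripleNorm

/-! ### Measurability of `A u`. -/

section Measurability

variable {D X : Type*} [NormedAddCommGroup D] [NormedSpace ℝ D]
  [NormedAddCommGroup X] [NormedSpace ℝ X]

/-- Only `A(·) x` for fixed `x` is known to be measurable. For simple `u` the map `A u` is a finite
sum of such functions cut off to measurable sets; the general case is a pointwise limit. -/
theorem aestronglyMeasurable_clm_apply {μ : Measure ℝ} {A : ℝ → D →L[ℝ] X}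
    (hA : ∀ x, AEStronglyMeasurable (fun t => A t x) μ) {u : ℝ → D}
    (hu : AEStronglyMeasurable u μ) : AEStronglyMeasurable (fun t => A t (u t)) μ := by
  obtain ⟨v, hv, huv⟩ := hu
  suffices h : AEStronglyMeasurable (fun t => A t (v t)) μ from
    h.congr (huv.mono fun t ht => by simp only [ht])
  refine aestronglyMeasurable_of_tendsto_ae atTop (f := fun n t => A t (hv.approx n t))
    (fun n => ?_)
    (ae_of_all _ fun t => ((A t).continuous.tendsto _).comp (hv.tendsto_approx t))
  have h : (fun t => A t (hv.approx n t)) = fun t => ∑ y ∈ (hv.approx n).range,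
      ((hv.approx n) ⁻¹' {y}).indicator (fun t => A t y) t := by
    ext t
    rw [Finset.sum_eq_single (hv.approx n t)]
    · simp
    · intro y _ hy
      exact indicator_of_notMem (fun h => hy h.symm) _
    · intro h
      exact absurd (SimpleFunc.mem_range_self _ _) h
  rw [h]
  exact Finset.aestronglyMeasurable_fun_sum _ fun y _ =>
    (hA y).indicator ((hv.approx n).measurableSet_fiber y)

theorem memLpOn_clm_apply {p : ℝ} {J : Set ℝ} {A : ℝ → D →L[ℝ] X}
    (hA : ∀ x, AEStronglyMeasurable (fun t => A t x) (volume.restrict J)) {C : ℝ}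
    (hC : ∀ᵐ t ∂(volume.restrict J), ∀ x, ‖A t x‖ ≤ C * ‖x‖) {u : ℝ → D} (hu : MemLpOn p J u) :
    MemLpOn p J (fun t => A t (u t)) :=
  hu.of_le_mul (aestronglyMeasurable_clm_apply hA hu.1) (hC.mono fun t ht => ht (u t))

end Measurability

/-! ### Solutions, their norm, and well-posedness on an interval. -/

section WellPosed

variable {D X : Type*} [NormedAddCommGroup D] [NormedSpace ℝ D]
  [NormedAddCommGroup X] [NormedSpace ℝ X]
  {ι : D →L[ℝ] X} {p : ℝ} {J : Set ℝ} {α β : ℝ} {x y : X} {u v : ℝ → D} {du dv f g : ℝ → X}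
  {A : ℝ → D →L[ℝ] X}

theorem Sol.add (hp : 1 < p) (hJ : StartsAt J α) (hu : Sol ι p J α A x f u du)
    (hv : Sol ι p J α A y g v dv) :
    Sol ι p J α A (x + y) (fun t => f t + g t) (fun t => u t + v t) (fun t => du t + dv t) := by
  refine ⟨hu.1.add hp hJ hv.1, ?_⟩
  filter_upwards [hu.2, hv.2] with t h1 h2
  rw [← h1, ← h2, map_add]; abel

theorem Sol.sub (hp : 1 < p) (hJ : StartsAt J α) (hu : Sol ι p J α A x f u du)
    (hv : Sol ι p J α A y g v dv) :
    Sol ι p J α A (x - y) (fun t => f t - g t) (fun t => u t - v t) (fun t => du t - dv t) := by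
  refine ⟨hu.1.sub hp hJ hv.1, ?_⟩
  filter_upwards [hu.2, hv.2] with t h1 h2
  rw [← h1, ← h2, map_sub]; abel

theorem Sol.const_smul (hu : Sol ι p J α A x f u du) (c : ℝ) :
    Sol ι p J α A (c • x) (fun t => c • f t) (fun t => c • u t) (fun t => c • du t) := by
  refine ⟨hu.1.const_smul c, ?_⟩
  filter_upwards [hu.2] with t h1
  rw [← h1, map_smul, smul_add]

theorem Sol.mono {I : Set ℝ} (hu : Sol ι p J α A x f u du) (h : I ⊆ J) :
    Sol ι p I α A x f u du :=
  ⟨hu.1.mono h, ae_restrict_of_ae_restrict_of_subset h hu.2⟩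

theorem Sol.congr_rhs (hu : Sol ι p J α A x f u du) (h : ∀ᵐ t ∂(volume.restrict J), f t = g t) :
    Sol ι p J α A x g u du :=
  ⟨hu.1, by filter_upwards [hu.2, h] with t h1 h2 using h1.trans h2⟩

theorem Sol.zero : Sol ι p J α A 0 (fun _ => 0) (fun _ => 0) (fun _ => 0) :=
  ⟨Sob.zero, by simp⟩

theorem timeScale_Ioo (h : α ≤ β) : timeScale (Ioo α β) = β - α := by
  unfold timeScale
  rw [if_neg (by simp), Real.volume_Ioo, ENNReal.toReal_ofReal (by linarith)]

theorem timeScale_Ioi : timeScale (Ioi α) = 1 := by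
  unfold timeScale
  rw [if_pos Real.volume_Ioi]

theorem timeScale_nonneg : 0 ≤ timeScale J := by
  unfold timeScale; split_ifs <;> simp

theorem mrNorm_eq : mrNorm ι p J u du = tripleNorm p (lpNormOn p J (fun t => ι (u t)))
    (lpNormOn p J u) (timeScale J * lpNormOn p J du) := by
  unfold mrNorm tripleNorm
  rw [Real.mul_rpow timeScale_nonneg lpNormOn_nonneg]

theorem mrNorm_nonneg : 0 ≤ mrNorm ι p J u du := by
  rw [mrNorm_eq]
  exact tripleNorm_nonneg lpNormOn_nonneg lpNormOn_nonneg
    (mul_nonneg timeScale_nonneg lpNormOn_nonneg)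

theorem lpNormOn_le_mrNorm (hp : 1 < p) : lpNormOn p J u ≤ mrNorm ι p J u du := by
  rw [mrNorm_eq]
  exact le_tripleNorm_snd hp lpNormOn_nonneg lpNormOn_nonneg
    (mul_nonneg timeScale_nonneg lpNormOn_nonneg)

theorem lpNormOn_deriv_le_mrNorm (hp : 1 < p) :
    timeScale J * lpNormOn p J du ≤ mrNorm ι p J u du := by
  rw [mrNorm_eq]
  exact le_tripleNorm_thd hp lpNormOn_nonneg lpNormOn_nonneg
    (mul_nonneg timeScale_nonneg lpNormOn_nonneg)

theorem mrNorm_add_le (hp : 1 < p) (hu : MemLpOn p J u) (hdu : MemLpOn p J du)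
    (hv : MemLpOn p J v) (hdv : MemLpOn p J dv) :
    mrNorm ι p J (fun t => u t + v t) (fun t => du t + dv t) ≤
      mrNorm ι p J u du + mrNorm ι p J v dv := by
  simp only [mrNorm_eq]
  have hs : 0 ≤ timeScale J := timeScale_nonneg
  refine (tripleNorm_mono hp lpNormOn_nonneg lpNormOn_nonneg (mul_nonneg hs lpNormOn_nonneg)
    ?_ (lpNormOn_add_le hp hu hv) ?_).trans (tripleNorm_add_le hp lpNormOn_nonneg lpNormOn_nonneg
      (mul_nonneg hs lpNormOn_nonneg) lpNormOn_nonneg lpNormOn_nonneg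
      (mul_nonneg hs lpNormOn_nonneg))
  · simp only [map_add]
    exact lpNormOn_add_le hp (hu.clm ι) (hv.clm ι)
  · rw [← mul_add]
    exact mul_le_mul_of_nonneg_left (lpNormOn_add_le hp hdu hdv) hs

theorem mrNorm_congr (h : ∀ᵐ t ∂(volume.restrict J), u t = v t)
    (hd : ∀ᵐ t ∂(volume.restrict J), du t = dv t) :
    mrNorm ι p J u du = mrNorm ι p J v dv := by
  rw [mrNorm_eq, mrNorm_eq, lpNormOn_congr h, lpNormOn_congr hd,
    lpNormOn_congr (h.mono fun t ht => congrArg ι ht)]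

/-- Existence of solutions and the a priori bound (which yields uniqueness) on `(α, β)`. -/
structure WP (ι : D →L[ℝ] X) (p α β : ℝ) (A : ℝ → D →L[ℝ] X) (K : ℝ) : Prop where
  exists_sol : ∀ f : ℝ → X, MemLpOn p (Ioo α β) f → ∃ u du, Sol ι p (Ioo α β) α A 0 f u du
  bound : ∀ f : ℝ → X, MemLpOn p (Ioo α β) f → ∀ u du, Sol ι p (Ioo α β) α A 0 f u du →
    mrNorm ι p (Ioo α β) u du ≤ K * lpNormOn p (Ioo α β) f

theorem WP.unique {K : ℝ} (hp : 1 < p) (h : WP ι p α β A K)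
    (hu : Sol ι p (Ioo α β) α A x f u du) (hv : Sol ι p (Ioo α β) α A x f v dv) :
    ∀ᵐ t ∂(volume.restrict (Ioo α β)), u t = v t := by
  have h1 := hu.sub hp (startsAt_Ioo α β) hv
  rw [sub_self] at h1
  have h2 := h.bound _ (memLpOn_zero) _ _ (h1.congr_rhs (g := fun _ => 0) (by simp))
  rw [lpNormOn_zero, mul_zero] at h2
  have h3 := le_antisymm ((lpNormOn_le_mrNorm hp).trans h2) lpNormOn_nonneg
  filter_upwards [lpNormOn_eq_zero hp h1.1.1 h3] with t ht using sub_eq_zero.1 ht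

theorem Sol.deriv_eq (h : Sol ι p J α A x f u du) (h' : Sol ι p J α A y f v dv)
    (he : ∀ᵐ t ∂(volume.restrict J), u t = v t) : ∀ᵐ t ∂(volume.restrict J), du t = dv t := by
  filter_upwards [h.2, h'.2, he] with t h1 h2 h3
  rw [← h2, h3] at h1
  exact add_right_cancel h1

theorem WP.mono {K K' : ℝ} (h : WP ι p α β A K) (hK : K ≤ K') : WP ι p α β A K' :=
  ⟨h.1, fun f hf u du hu => (h.2 f hf u du hu).trans
    (mul_le_mul_of_nonneg_right hK lpNormOn_nonneg)⟩

end WellPosed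

/-! ### From the half line to bounded intervals. -/

section Autonomous

variable {D X : Type*} [NormedAddCommGroup D] [NormedSpace ℝ D]
  [NormedAddCommGroup X] [NormedSpace ℝ X]
  {ι : D →L[ℝ] X} {p : ℝ} {J : Set ℝ} {α β γ : ℝ} {x y : X} {u v : ℝ → D} {du dv f g : ℝ → X}
  {A : ℝ → D →L[ℝ] X} {T : D →L[ℝ] X}

theorem Sol.concat (hp : 1 < p) (hJ : StartsAt J α) (hγ : γ ∈ J)
    (hu : Sol ι p (Ioo α γ) α A x f u du)
    (hv : Sol ι p (J ∩ Ioi γ) γ A (x + ∫ s in α..γ, du s) g v dv) :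
    Sol ι p J α A x (concat γ f g) (concat γ u v) (concat γ du dv) := by
  refine ⟨hu.1.concat hp hJ hγ hv.1, hJ.ae_of_split hγ ?_ ?_⟩
  · filter_upwards [hu.2, ae_restrict_mem measurableSet_Ioo] with t h1 h2
    simp only [MaxReg.concat, if_pos h2.2]; exact h1
  · filter_upwards [hv.2, ae_restrict_mem (hJ.measurableSet.inter measurableSet_Ioi)] with t h1 h2
    simp only [MaxReg.concat, if_neg (not_lt.2 (le_of_lt (mem_Ioi.1 h2.2)))]; exact h1

theorem quasiMeasurePreserving_affine {c r : ℝ} (hr : r ≠ 0) :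
    Measure.QuasiMeasurePreserving (fun s : ℝ => c + r * s) volume volume := by
  refine ⟨by fun_prop, ?_⟩
  have : (fun s : ℝ => c + r * s) = (fun x => c + x) ∘ (fun x => r * x) := rfl
  rw [this, ← Measure.map_map (by fun_prop) (by fun_prop), Real.map_volume_mul_left hr,
    Measure.map_smul, map_add_left_eq_self]
  exact Measure.smul_absolutelyContinuous

theorem ae_comp_affine {P : ℝ → Prop} {I : Set ℝ} {c r : ℝ} (hr : r ≠ 0) (hI : MeasurableSet I)
    (hJ : MeasurableSet J) (hm : ∀ s ∈ I, c + r * s ∈ J)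
    (h : ∀ᵐ t ∂(volume.restrict J), P t) : ∀ᵐ s ∂(volume.restrict I), P (c + r * s) := by
  rw [ae_restrict_iff' hI]
  filter_upwards [(quasiMeasurePreserving_affine hr).ae ((ae_restrict_iff' hJ).1 h)] with s hs hsI
    using hs (hm s hsI)

theorem ae_comp_add {P : ℝ → Prop} {I : Set ℝ} {c : ℝ} (hI : MeasurableSet I)
    (hJ : MeasurableSet J) (hm : ∀ s ∈ I, c + s ∈ J)
    (h : ∀ᵐ t ∂(volume.restrict J), P t) : ∀ᵐ s ∂(volume.restrict I), P (c + s) := by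
  simpa using ae_comp_affine (c := c) one_ne_zero hI hJ (by simpa using hm) h

theorem MemLpOn.comp_add {Y : Type*} [NormedAddCommGroup Y] {f : ℝ → Y} (hp : 1 < p)
    (hf : MemLpOn p J f) {I : Set ℝ} {c : ℝ} (hm : ∀ s ∈ I, c + s ∈ J) :
    MemLpOn p I (fun s => f (c + s)) ∧ lpNormOn p I (fun s => f (c + s)) ≤ lpNormOn p J f := by
  simpa using hf.comp_affine hp one_ne_zero (c := c) (by simpa using hm)

theorem Sob.comp_add (hp : 1 < p) (hJ : StartsAt J α) (hu : Sob ι p J α x u du)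
    {I : Set ℝ} {c : ℝ} (hI : StartsAt I γ) (hm : ∀ s ∈ I, c + s ∈ J) (hc : c + γ = α) :
    Sob ι p I γ x (fun s => u (c + s)) (fun s => du (c + s)) := by
  simpa [hc] using hu.comp_affine hp hJ hI (c := c) one_ne_zero (by simpa using hm)
    (by simp [hc])

theorem Sol.comp_add (hp : 1 < p) (hJ : StartsAt J α) (hu : Sol ι p J α A x f u du)
    {I : Set ℝ} {c : ℝ} (hI : StartsAt I γ) (hm : ∀ s ∈ I, c + s ∈ J) (hc : c + γ = α) :
    Sol ι p I γ (fun s => A (c + s)) x (fun s => f (c + s)) (fun s => u (c + s))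
      (fun s => du (c + s)) :=
  ⟨hu.1.comp_add hp hJ hI hm hc, ae_comp_add hI.measurableSet hJ.measurableSet hm hu.2⟩

theorem lpNormOn_concat_zero_right {Y : Type*} [NormedAddCommGroup Y] {f : ℝ → Y}
    (hJ : StartsAt J α) (hγ : γ ∈ J) :
    lpNormOn p J (concat γ f (fun _ => 0)) = lpNormOn p (Ioo α γ) f := by
  have h : ∀ᵐ t ∂(volume.restrict J), concat γ f (fun _ => 0) t = (Ioo α γ).indicator f t := by
    filter_upwards [ae_restrict_mem hJ.measurableSet] with t ht
    have : α < t := hJ.subset_Ioi ht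
    by_cases h : t < γ <;> simp [concat, indicator, h, this]
  rw [lpNormOn_congr h]
  unfold lpNormOn
  rw [eLpNorm_indicator_eq_eLpNorm_restrict measurableSet_Ioo,
    Measure.restrict_restrict measurableSet_Ioo, inter_eq_left.2 (hJ.Ioo_subset hγ)]

theorem StartsAt.memLpOn_concat_zero_right {Y : Type*} [NormedAddCommGroup Y] {f : ℝ → Y}
    (hJ : StartsAt J α) (hf : MemLpOn p (Ioo α γ) f) :
    MemLpOn p J (MaxReg.concat γ f (fun _ => 0)) := hJ.memLpOn_concat hf memLpOn_zero

/-- Reflection at the right end point, followed by extension by zero. -/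
theorem Sob.exists_extension {τ : ℝ} (hp : 1 < p) (hτ : 0 < τ)
    (hu : Sob ι p (Ioo 0 τ) 0 0 u du) :
    ∃ z dz, Sob ι p (Ioi 0) 0 0 z dz ∧ (∀ᵐ t ∂(volume.restrict (Ioo 0 τ)), z t = u t) ∧
      ∀ᵐ t ∂(volume.restrict (Ioo 0 τ)), dz t = du t := by
  have hi : IntervalIntegrable du volume 0 τ := hu.2.intervalIntegrable hp hτ.le le_rfl
  have h1 := hu.comp_affine hp (startsAt_Ioo 0 τ) (I := Ioo τ (2 * τ)) (γ := τ) (c := 2 * τ)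
    (r := -1) (startsAt_Ioo _ _) (by norm_num)
    (fun s hs => ⟨by linarith [hs.2], by linarith [hs.1]⟩)
    (by convert hi using 1; ring)
  have e : 2 * τ + -1 * τ = τ := by ring
  rw [e] at h1
  -- The reflected piece is back at the initial value `0` at time `2 τ`, so it can be continued by
  -- zero.
  have h2 : Sob ι p (Ioi τ ∩ Ioi (2 * τ)) (2 * τ) ((0 + ∫ s in (0 : ℝ)..τ, du s) +
      ∫ s in τ..(2 * τ), (-1 : ℝ) • du (2 * τ + -1 * s)) (fun _ => 0) (fun _ => 0) := by
    have : (0 + ∫ s in (0 : ℝ)..τ, du s) +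
      ∫ s in τ..(2 * τ), (-1 : ℝ) • du (2 * τ + -1 * s) = 0 := by
      rw [intervalIntegral.integral_smul, intervalIntegral.smul_integral_comp_add_mul,
        show 2 * τ + -1 * τ = τ by ring, show 2 * τ + -1 * (2 * τ) = 0 by ring,
        intervalIntegral.integral_symm 0 τ]
      simp
    rw [this]
    exact Sob.zero
  have h3 := h1.concat hp (startsAt_Ioi τ) (show 2 * τ ∈ Ioi τ by simp; linarith) h2
  rw [← Ioi_inter_Ioi' hτ.le] at h3
  have h4 := hu.concat hp (startsAt_Ioi 0) (show τ ∈ Ioi 0 from hτ) h3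
  exact ⟨_, _, h4, concat_ae_left, concat_ae_left⟩

theorem nonempty_Ioi' : (Ioi α).Nonempty := ⟨α + 1, by simp⟩

variable [CompleteSpace X]

theorem aut_exists_sol (hp : 1 < p) (hT : IsAutMaxReg ι p (Ioi 0) T)
    (hf : MemLpOn p (Ioo α β) f) : ∃ u du, Sol ι p (Ioo α β) α (fun _ => T) 0 f u du := by
  have h1 : MemLpOn p (Ioo 0 (β - α)) (fun s => f (α + s)) :=
    (hf.comp_add hp fun s hs => ⟨by linarith [hs.1], by linarith [hs.2]⟩).1
  obtain ⟨u, du, hu⟩ := hT.exists_solution _ ((startsAt_Ioi 0).memLpOn_concat_zero_right h1)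
  rw [(startsAt_Ioi 0).isStrongSolution_iff hp nonempty_Ioi'] at hu
  have hu2 := (hu.mono (I := Ioo 0 (β - α)) Ioo_subset_Ioi_self).congr_rhs concat_ae_left
  have hu3 := hu2.comp_add hp (startsAt_Ioo _ _) (I := Ioo α β) (γ := α) (c := -α)
    (startsAt_Ioo _ _) (fun s hs => ⟨by linarith [hs.1], by linarith [hs.2]⟩) (by ring)
  exact ⟨_, _, hu3.congr_rhs (by simp)⟩

/-- The given solution lives on `(0, τ)` only. Extended by reflection it solves a half-line problem
whose source `F` is not controlled by `f` beyond `τ`. Subtracting the solution that starts from zero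
at `τ` with source `F` leaves `u` unchanged on `(0, τ)` and replaces `F` by `f` extended by zero, to
which the half-line bound applies. Applied to differences of solutions, this also gives uniqueness
on `(0, τ)`. -/
theorem aut_bound_zero (hp : 1 < p) (hT : IsAutMaxReg ι p (Ioi 0) T) {K : ℝ}
    (hK : MRBound ι p (Ioi 0) (fun _ => T) K) {τ : ℝ} (hτ : 0 < τ)
    (hf : MemLpOn p (Ioo 0 τ) f) (hu : Sol ι p (Ioo 0 τ) 0 (fun _ => T) 0 f u du) :
    lpNormOn p (Ioo 0 τ) u ≤ K * lpNormOn p (Ioo 0 τ) f ∧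
      lpNormOn p (Ioo 0 τ) du ≤ K * lpNormOn p (Ioo 0 τ) f := by
  obtain ⟨z, dz, hz, hzu, hzd⟩ := hu.1.exists_extension hp hτ
  obtain ⟨F, hF⟩ : ∃ F : ℝ → X, F = fun t => dz t + T (z t) := ⟨_, rfl⟩
  have hFm : MemLpOn p (Ioi 0) F := hF ▸ MemLp.add hz.2 (hz.1.clm T)
  have hFf : ∀ᵐ t ∂(volume.restrict (Ioo 0 τ)), F t = f t := by
    filter_upwards [hzu, hzd, hu.2] with t h1 h2 h3
    rw [hF, ← h3, ← h1, ← h2]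
  have hZ : Sol ι p (Ioi 0) 0 (fun _ => T) 0 F z dz := ⟨hz, by simp [hF]⟩
  have hGm : MemLpOn p (Ioi 0) (fun s => F (τ + s)) :=
    (hFm.comp_add hp fun s hs => by simp only [mem_Ioi] at *; linarith).1
  obtain ⟨y, dy, hy⟩ := hT.exists_solution _ hGm
  rw [(startsAt_Ioi 0).isStrongSolution_iff hp nonempty_Ioi'] at hy
  have hy2 := hy.comp_add hp (startsAt_Ioi 0) (I := Ioi τ) (γ := τ) (c := -τ) (startsAt_Ioi _)
    (fun s hs => by simp only [mem_Ioi] at *; linarith) (by ring)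
  simp only [add_neg_cancel_left] at hy2
  rw [← Ioi_inter_Ioi' hτ.le] at hy2
  have hY := Sol.concat hp (startsAt_Ioi 0) (show τ ∈ Ioi 0 from hτ)
    (Sol.zero (ι := ι) (p := p) (J := Ioo 0 τ) (α := 0) (A := fun _ => T)) (by simpa using hy2)
  have hW := hZ.sub hp (startsAt_Ioi 0) hY
  rw [sub_self] at hW
  have hτm : τ ∈ Ioi (0 : ℝ) := hτ
  have hW2 := hW.congr_rhs (g := concat τ f (fun _ => 0)) <| by
    refine (startsAt_Ioi 0).ae_of_split hτm ?_ ?_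
    · filter_upwards [hFf, ae_restrict_mem measurableSet_Ioo] with t h1 h2
      simp [concat, h2.2, h1]
    · filter_upwards [ae_restrict_mem (measurableSet_Ioi.inter measurableSet_Ioi)] with t h2
      have : ¬ t < τ := not_lt.2 (le_of_lt (mem_Ioi.1 h2.2))
      simp [concat, this]
  have hb := hK _ ((startsAt_Ioi 0).memLpOn_concat_zero_right hf) _ _
    (((startsAt_Ioi 0).isStrongSolution_iff hp nonempty_Ioi').2 hW2)
  rw [lpNormOn_concat_zero_right (startsAt_Ioi 0) hτm] at hb
  have hsub : Ioo 0 τ ⊆ Ioi (0 : ℝ) := Ioo_subset_Ioi_self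
  constructor
  · refine le_trans (le_of_eq ?_) ((lpNormOn_mono_set hsub hW2.1.1).trans
      ((lpNormOn_le_mrNorm hp).trans hb))
    refine lpNormOn_congr ?_
    filter_upwards [hzu, ae_restrict_mem measurableSet_Ioo] with t h1 h2
    simp [concat, h2.2, h1]
  · have h5 := (lpNormOn_deriv_le_mrNorm hp).trans hb
    rw [timeScale_Ioi, one_mul] at h5
    refine le_trans (le_of_eq ?_) ((lpNormOn_mono_set hsub hW2.1.2).trans h5)
    refine lpNormOn_congr ?_
    filter_upwards [hzd, ae_restrict_mem measurableSet_Ioo] with t h1 h2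
    simp [concat, h2.2, h1]

/-- Maximal regularity on the half line yields uniform estimates on bounded intervals. -/
theorem aut_bound (hp : 1 < p) (hT : IsAutMaxReg ι p (Ioi 0) T) {K : ℝ}
    (hK : MRBound ι p (Ioi 0) (fun _ => T) K) (h : α < β)
    (hf : MemLpOn p (Ioo α β) f) (hu : Sol ι p (Ioo α β) α (fun _ => T) 0 f u du) :
    lpNormOn p (Ioo α β) u ≤ K * lpNormOn p (Ioo α β) f ∧
      lpNormOn p (Ioo α β) du ≤ K * lpNormOn p (Ioo α β) f := by
  have hm : ∀ s ∈ Ioo 0 (β - α), α + s ∈ Ioo α β :=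
    fun s hs => ⟨by linarith [hs.1], by linarith [hs.2]⟩
  have hm' : ∀ s ∈ Ioo α β, -α + s ∈ Ioo 0 (β - α) :=
    fun s hs => ⟨by linarith [hs.1], by linarith [hs.2]⟩
  have h1 := hf.comp_add hp hm
  have h2 := hu.comp_add hp (startsAt_Ioo _ _) (startsAt_Ioo 0 (β - α)) hm (by ring)
  have h3 := aut_bound_zero hp hT hK (sub_pos.2 h) h1.1 h2
  have h4 := (h2.1.1.comp_add hp hm').2
  have h5 := (h2.1.2.comp_add hp hm').2
  simp only [add_neg_cancel_left] at h4 h5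
  have h7 : K * lpNormOn p (Ioo 0 (β - α)) (fun s => f (α + s)) ≤ K * lpNormOn p (Ioo α β) f := by
    have h8 := (h1.1.comp_add hp hm').2
    simp only [add_neg_cancel_left] at h8
    rw [le_antisymm h8 h1.2]
  exact ⟨(h4.trans h3.1).trans h7, (h5.trans h3.2).trans h7⟩

end Autonomous

/-! ### Maximal regularity constants and their monotonicity in the interval. -/

section Constants

variable {D X : Type*} [NormedAddCommGroup D] [NormedSpace ℝ D]
  [NormedAddCommGroup X] [NormedSpace ℝ X] [CompleteSpace X]
  {ι : D →L[ℝ] X} {p : ℝ} {J : Set ℝ} {α β γ a b : ℝ} {x y : X} {u v : ℝ → D} {du dv f g : ℝ → X}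
  {A : ℝ → D →L[ℝ] X} {T : D →L[ℝ] X} {K : ℝ}

theorem isStrongSolution_Ioo_iff (hp : 1 < p) (h : α < β) :
    IsStrongSolution ι p (Ioo α β) A f u du ↔ Sol ι p (Ioo α β) α A 0 f u du :=
  (startsAt_Ioo α β).isStrongSolution_iff hp (nonempty_Ioo.2 h)

theorem WP.mrBound (hp : 1 < p) (h : α < β) (hA : WP ι p α β A K) : MRBound ι p (Ioo α β) A K :=
  fun f hf u du hu => hA.2 f hf u du ((isStrongSolution_Ioo_iff hp h).1 hu)

theorem WP.mrConst_le (hp : 1 < p) (h : α < β) (hA : WP ι p α β A K) (hK : 0 ≤ K) :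
    mrConst ι p (Ioo α β) A ≤ K :=
  csInf_le ⟨0, fun _ h => h.1⟩ ⟨hK, hA.mrBound hp h⟩

omit [CompleteSpace X] in
theorem mrConst_nonneg : 0 ≤ mrConst ι p J A := Real.sInf_nonneg fun _ h => h.1

/-- The maximal regularity constant is itself an admissible bound. -/
theorem WP.mrConst_wp (hp : 1 < p) (h : α < β) (hA : WP ι p α β A K) (hK : 0 ≤ K) :
    WP ι p α β A (mrConst ι p (Ioo α β) A) := by
  refine ⟨hA.1, fun f hf u du hu => ?_⟩
  rcases (lpNormOn_nonneg (p := p) (I := Ioo α β) (f := f)).eq_or_lt with h0 | h0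
  · have := hA.2 f hf u du hu
    rw [← h0, mul_zero] at this ⊢
    exact this
  -- The quotient of the two norms is below every admissible bound, hence below their infimum.
  · rw [← div_le_iff₀ h0]
    refine le_csInf ⟨K, hK, hA.mrBound hp h⟩ fun K' hK' => ?_
    rw [div_le_iff₀ h0]
    exact hK'.2 f hf u du ((isStrongSolution_Ioo_iff hp h).2 hu)

theorem WP.isMaxReg (hp : 1 < p) (h : α < β) (hA : WP ι p α β A K) (hK : 0 ≤ K)
    (h1 : ∀ x : D, MemLp (fun t => A t x) ∞ (volume.restrict (Ioo α β)))
    (h2 : ∀ t ∈ Ioo α β, GraphNormEquiv ι (A t)) : IsMaxReg ι p (Ioo α β) A := by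
  refine ⟨h1, h2, fun f hf => ?_, fun f _ u₁ u₂ du₁ du₂ hu₁ hu₂ => ?_, K, hK, hA.mrBound hp h⟩
  · obtain ⟨u, du, hu⟩ := hA.1 f hf
    exact ⟨u, du, (isStrongSolution_Ioo_iff hp h).2 hu⟩
  · rw [isStrongSolution_Ioo_iff hp h] at hu₁ hu₂
    exact hA.unique hp hu₁ hu₂

theorem aut_wp (hp : 1 < p) (hT : IsAutMaxReg ι p (Ioi 0) T) (h : α < β) :
    ∃ K, 0 ≤ K ∧ WP ι p α β (fun _ => T) K := by
  obtain ⟨K, hK0, hK⟩ := hT.exists_bound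
  refine ⟨‖ι‖ * K + K + (β - α) * K, ?_, fun f hf => aut_exists_sol hp hT hf,
    fun f hf u du hu => ?_⟩
  · have := sub_pos.2 h
    positivity
  · obtain ⟨h1, h2⟩ := aut_bound hp hT hK h hf hu
    have h3 : lpNormOn p (Ioo α β) (fun t => ι (u t)) ≤ ‖ι‖ * lpNormOn p (Ioo α β) u :=
      lpNormOn_le_mul hu.1.1 (norm_nonneg _) (ae_of_all _ fun t => ι.le_opNorm _)
    rw [mrNorm_eq, timeScale_Ioo h.le]
    have h4 := sub_pos.2 h
    refine (tripleNorm_le_add hp lpNormOn_nonneg lpNormOn_nonneg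
      (mul_nonneg h4.le lpNormOn_nonneg)).trans ?_
    rw [add_mul, add_mul, mul_assoc, mul_assoc]
    gcongr
    exact h3.trans (mul_le_mul_of_nonneg_left h1 (norm_nonneg _))

omit [CompleteSpace X] in
/-- Monotonicity of the autonomous maximal regularity constant in the interval. -/
theorem WP.of_longer {K' : ℝ} (hp : 1 < p) (hT : WP ι p a b (fun _ => T) K)
    (hT' : WP ι p α β (fun _ => T) K') (h : α < β) (hl : β - α < b - a) :
    WP ι p α β (fun _ => T) K := by
  refine ⟨hT'.1, fun f hf u du hu => ?_⟩
  set e := a + (β - α) with he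
  set c := α - a with hc
  have hm : ∀ s ∈ Ioo a e, c + s ∈ Ioo α β :=
    fun s hs => ⟨by rw [hc]; linarith [hs.1], by rw [hc]; rw [he] at hs; linarith [hs.2]⟩
  have hm' : ∀ s ∈ Ioo α β, -c + s ∈ Ioo a e :=
    fun s hs => ⟨by rw [hc]; linarith [hs.1], by rw [hc, he]; linarith [hs.2]⟩
  have hem : e ∈ Ioo a b := ⟨by rw [he]; linarith, by rw [he]; linarith⟩
  have hsub : Ioo a e ⊆ Ioo a b := Ioo_subset_Ioo_right hem.2.le
  have h1 := hf.comp_add hp hm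
  -- Extending the source by zero costs nothing. By uniqueness the solution on the long interval
  -- restricts to the given one, and the weight of its derivative is larger.
  have h3 := (startsAt_Ioo a b).memLpOn_concat_zero_right h1.1
  obtain ⟨w, dw, hw⟩ := hT.1 _ h3
  have h4 := hT.2 _ h3 w dw hw
  rw [lpNormOn_concat_zero_right (startsAt_Ioo a b) hem] at h4
  have hw3 := ((hw.mono hsub).congr_rhs concat_ae_left).comp_add hp (startsAt_Ioo a e)
    (startsAt_Ioo α β) hm' (by rw [hc]; ring)
  simp only [add_neg_cancel_left] at hw3
  have hun := hT'.unique hp hu hw3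
  rw [mrNorm_congr hun (hu.deriv_eq hw3 hun)]
  have hK : K * lpNormOn p (Ioo a e) (fun s => f (c + s)) = K * lpNormOn p (Ioo α β) f := by
    have h8 := (h1.1.comp_add hp hm').2
    simp only [add_neg_cancel_left] at h8
    rw [le_antisymm h8 h1.2]
  rw [hK] at h4
  refine le_trans ?_ h4
  have hm2 : ∀ s ∈ Ioo α β, -c + s ∈ Ioo a b := fun s hs => hsub (hm' s hs)
  rw [mrNorm_eq, mrNorm_eq, timeScale_Ioo h.le, timeScale_Ioo (by linarith)]
  refine tripleNorm_mono hp lpNormOn_nonneg lpNormOn_nonneg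
    (mul_nonneg (by linarith) lpNormOn_nonneg) ((hw.1.1.clm ι).comp_add hp hm2).2
    (hw.1.1.comp_add hp hm2).2 ?_
  exact mul_le_mul hl.le (hw.1.2.comp_add hp hm2).2 lpNormOn_nonneg (by linarith)

/-- This lets the constant of the whole interval `(a, b)` serve on all cells. Equal lengths are
treated separately because extension by zero needs an interior cut. -/
theorem aut_wp_K₀ (hp : 1 < p) {A₀ : ℝ → D →L[ℝ] X} {t : ℝ}
    (hT : IsAutMaxReg ι p (Ioi 0) (A₀ t)) (h : α < β) (ha : a ≤ α) (hb : β ≤ b) :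
    WP ι p α β (fun _ => A₀ t) (K₀ ι p a b A₀ t) := by
  have hab : a < b := ha.trans_lt (h.trans_le hb)
  obtain ⟨K, hK0, hK⟩ := aut_wp hp hT hab
  have h1 : WP ι p a b (fun _ => A₀ t) (K₀ ι p a b A₀ t) := hK.mrConst_wp hp hab hK0
  rcases (sub_le_sub hb ha).eq_or_lt with h2 | h2
  · obtain rfl : a = α := by linarith
    obtain rfl : β = b := by linarith
    exact h1
  · obtain ⟨K', _, hK'⟩ := aut_wp hp hT h
    exact h1.of_longer hp hK' h h2

end Constants

/-! ### Bounded orbits of the autonomous problem. -/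

section Semigroup

variable {D X : Type*} [NormedAddCommGroup D] [NormedSpace ℝ D]
  [NormedAddCommGroup X] [NormedSpace ℝ X]
  {ι : D →L[ℝ] X} {p : ℝ} {T : D →L[ℝ] X} {K : ℝ}

/-- Autonomous maximal regularity on all intervals `(0, τ)`, with a constant independent of `τ`. -/
structure AutReg (ι : D →L[ℝ] X) (p : ℝ) (T : D →L[ℝ] X) (K : ℝ) : Prop where
  nonneg : 0 ≤ K
  graph : GraphNormEquiv ι T
  exists_sol : ∀ (τ : ℝ) (f : ℝ → X), MemLpOn p (Ioo 0 τ) f →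
    ∃ u du, Sol ι p (Ioo 0 τ) 0 (fun _ => T) 0 f u du
  bound : ∀ (τ : ℝ), 0 < τ → ∀ (f : ℝ → X), MemLpOn p (Ioo 0 τ) f →
    ∀ u du, Sol ι p (Ioo 0 τ) 0 (fun _ => T) 0 f u du →
    lpNormOn p (Ioo 0 τ) u ≤ K * lpNormOn p (Ioo 0 τ) f ∧
      lpNormOn p (Ioo 0 τ) du ≤ K * lpNormOn p (Ioo 0 τ) f

theorem IsMaxReg.exists_autReg [CompleteSpace X] (hp : 1 < p) (hT : IsAutMaxReg ι p (Ioi 0) T) :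
    ∃ K, AutReg ι p T K := by
  obtain ⟨K, hK0, hK⟩ := hT.exists_bound
  exact ⟨K, hK0, hT.graphNorm 1 (by simp), fun τ f hf => aut_exists_sol hp hT hf,
    fun τ hτ f hf u du hu => aut_bound hp hT hK hτ hf hu⟩

theorem AutReg.unique (hp : 1 < p) (h : AutReg ι p T K) {τ : ℝ} (hτ : 0 < τ) {x : X} {f : ℝ → X}
    {u v : ℝ → D} {du dv : ℝ → X} (hu : Sol ι p (Ioo 0 τ) 0 (fun _ => T) x f u du)
    (hv : Sol ι p (Ioo 0 τ) 0 (fun _ => T) x f v dv) :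
    (∀ᵐ t ∂(volume.restrict (Ioo 0 τ)), u t = v t) ∧
      ∀ᵐ t ∂(volume.restrict (Ioo 0 τ)), du t = dv t := by
  have h1 := hu.sub hp (startsAt_Ioo 0 τ) hv
  rw [sub_self] at h1
  have h2 := (h.bound τ hτ _ memLpOn_zero _ _ (h1.congr_rhs (g := fun _ => 0) (by simp))).1
  rw [lpNormOn_zero, mul_zero] at h2
  have h4 : ∀ᵐ t ∂(volume.restrict (Ioo 0 τ)), u t = v t := by
    filter_upwards [lpNormOn_eq_zero hp h1.1.1 (le_antisymm h2 lpNormOn_nonneg)] with t ht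
      using sub_eq_zero.1 ht
  exact ⟨h4, hu.deriv_eq hv h4⟩

/-- Closedness of `T` as an unbounded operator in `X` with domain `ι(D)`: by the lower graph norm
estimate a Cauchy sequence in the graph comes from one in the complete space `D`. -/
theorem GraphNormEquiv.isClosed [CompleteSpace D] (h : GraphNormEquiv ι T) :
    IsClosed {q : X × X | ∃ d : D, ι d = q.1 ∧ T d = q.2} := by
  obtain ⟨c, C, hc, hC, hcC⟩ := h
  refine isClosed_of_closure_subset fun q hq => ?_
  obtain ⟨s, hs, hsq⟩ := mem_closure_iff_seq_limit.1 hq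
  choose d hd1 hd2 using hs
  have hcau : CauchySeq s := hsq.cauchySeq
  have : CauchySeq d := by
    rw [Metric.cauchySeq_iff'] at hcau ⊢
    intro ε hε
    obtain ⟨N, hN⟩ := hcau (c * ε / 2) (by positivity)
    refine ⟨N, fun n hn => ?_⟩
    have h1 := (hcC (d n - d N)).1
    rw [map_sub, map_sub, hd1, hd1, hd2, hd2] at h1
    have h2 := hN n hn
    rw [dist_eq_norm, Prod.norm_def, max_lt_iff, Prod.fst_sub, Prod.snd_sub] at h2
    rw [dist_eq_norm]
    have h3 : c * ‖d n - d N‖ < c * ε := by linarith [h2.1, h2.2]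
    exact lt_of_mul_lt_mul_left h3 hc.le
  obtain ⟨e, he⟩ := cauchySeq_tendsto_of_complete this
  have t1 : Tendsto (fun n => (ι (d n), T (d n))) atTop (𝓝 (ι e, T e)) :=
    ((ι.continuous.tendsto e).comp he).prodMk_nhds ((T.continuous.tendsto e).comp he)
  have t2 : (fun n => (ι (d n), T (d n))) = s := by
    exact funext fun n => Prod.ext (hd1 n) (hd2 n)
  rw [t2] at t1
  have h3 := tendsto_nhds_unique t1 hsq
  exact ⟨e, congrArg Prod.fst h3, congrArg Prod.snd h3⟩

theorem memLpOn_of_continuous {Y : Type*} [NormedAddCommGroup Y] {f : ℝ → Y} {α β : ℝ}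
    (hf : ContinuousOn f (Icc α β)) : MemLpOn p (Ioo α β) f := by
  obtain ⟨C, hC⟩ := isCompact_Icc.exists_bound_of_continuousOn hf
  refine MemLp.of_bound ((hf.mono Ioo_subset_Icc_self).aestronglyMeasurable measurableSet_Ioo) C ?_
  filter_upwards [ae_restrict_mem measurableSet_Ioo] with t ht using hC t (Ioo_subset_Icc_self ht)

theorem continuousOn_primitive_of_memLpOn {Y : Type*} [NormedAddCommGroup Y] [NormedSpace ℝ Y]
    (hp : 1 < p) {f : ℝ → Y} {τ : ℝ} (hτ : 0 ≤ τ)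
    (hf : MemLpOn p (Ioo 0 τ) f) : ContinuousOn (fun t => ∫ s in (0 : ℝ)..t, f s) (Icc 0 τ) := by
  have h := hf.intervalIntegrable hp hτ le_rfl
  have := intervalIntegral.continuousOn_primitive_interval (μ := volume) (f := f) (a := 0)
    (b := τ) (by
    rw [uIcc_of_le hτ, integrableOn_Icc_iff_integrableOn_Ioc]
    exact (intervalIntegrable_iff_integrableOn_Ioc_of_le hτ).1 h)
  rwa [uIcc_of_le hτ] at this

variable [CompleteSpace D] [CompleteSpace X]

omit [CompleteSpace D] [CompleteSpace X] in
-- The witness is the constant `x` minus the solution with zero initial value and source `T x`.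
theorem AutReg.exists_null (hp : 1 < p) (h : AutReg ι p T K) (τ : ℝ) (x : D) :
    ∃ z dz, Sol ι p (Ioo 0 τ) 0 (fun _ => T) (ι x) (fun _ => 0) z dz := by
  obtain ⟨V, dV, hV⟩ := h.exists_sol τ (fun _ => T x) (memLpOn_const _)
  have hc : Sol ι p (Ioo 0 τ) 0 (fun _ => T) (ι x) (fun _ => T x) (fun _ => x) (fun _ => 0) :=
    ⟨⟨memLpOn_const _, memLpOn_zero, by simp⟩, by simp⟩
  have h1 := hc.sub hp (startsAt_Ioo 0 τ) hV
  rw [sub_zero] at h1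
  exact ⟨_, _, h1.congr_rhs (by simp)⟩

/-- The primitive of a null solution started at `x` solves the problem with right-hand side `x`. -/
theorem Sol.primitive (hp : 1 < p) {τ : ℝ} (hτ : 0 < τ) {x : X} {z : ℝ → D} {dz : ℝ → X}
    (hz : Sol ι p (Ioo 0 τ) 0 (fun _ => T) x (fun _ => 0) z dz) :
    Sol ι p (Ioo 0 τ) 0 (fun _ => T) 0 (fun _ => x) (fun t => ∫ s in (0 : ℝ)..t, z s)
      (fun t => ι (z t)) := by
  refine ⟨⟨memLpOn_of_continuous (continuousOn_primitive_of_memLpOn hp hτ.le hz.1.1),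
    hz.1.1.clm ι, ?_⟩, ?_⟩
  · filter_upwards [ae_restrict_mem measurableSet_Ioo] with t ht
    have hi := hz.1.1.intervalIntegrable hp ht.1.le (Ioo_subset_Ioo_right ht.2.le)
    rw [← ContinuousLinearMap.intervalIntegral_comp_comm ι hi, zero_add]
  · filter_upwards [ae_restrict_mem measurableSet_Ioo, hz.1.3] with t ht h1
    have hs : Ioo 0 t ⊆ Ioo 0 τ := Ioo_subset_Ioo_right ht.2.le
    have hi := hz.1.1.intervalIntegrable hp ht.1.le hs
    have h2 : ∫ s in (0 : ℝ)..t, T (z s) = ∫ s in (0 : ℝ)..t, - dz s :=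
      integral_congr_of_ae_restrict ht.1.le
        ((ae_restrict_of_ae_restrict_of_subset hs hz.2).mono fun s h =>
          eq_neg_of_add_eq_zero_right h)
    rw [← ContinuousLinearMap.intervalIntegral_comp_comm T hi, h1, h2,
      intervalIntegral.integral_neg, add_neg_cancel_right]

/-- Maximal regularity is used twice. The primitive of `z` has source `x` and derivative `ι z`, so
`‖ι z‖_p ≤ K τ^(1/p) ‖x‖`. The function `t z(t)` has source `ι z` and initial value zero, so its
derivative has norm at most `K ‖ι z‖_p`. Integrating that derivative up to `τ` with Hölder's
inequality bounds `τ` times the norm at `τ` by `τ K² ‖x‖`. -/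
theorem AutReg.null_bound (hp : 1 < p) (h : AutReg ι p T K) {τ : ℝ} (hτ : 0 < τ) {x : X}
    {z : ℝ → D} {dz : ℝ → X} (hz : Sol ι p (Ioo 0 τ) 0 (fun _ => T) x (fun _ => 0) z dz) :
    ‖x + ∫ s in (0 : ℝ)..τ, dz s‖ ≤ K ^ 2 * ‖x‖ := by
  have h1 := (h.bound τ hτ _ (memLpOn_const _) _ _ (hz.primitive hp hτ)).2
  rw [lpNormOn_const hp _ hτ.le, sub_zero] at h1
  have h2 : Sol ι p (Ioo 0 τ) 0 (fun _ => T) 0 (fun t => ι (z t)) (fun t => t • z t)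
      (fun t => (1 : ℝ) • ι (z t) + t • dz t) := by
    have hs := hz.1.smul (φ := fun t => t) (φ' := fun _ => 1) hp
      (fun s => hasDerivAt_id s) continuous_const
    rw [zero_smul] at hs
    refine ⟨hs, ?_⟩
    filter_upwards [hz.2] with t ht
    rw [map_smul, one_smul, add_assoc, ← smul_add, ht, smul_zero, add_zero]
  have h3 := (h.bound τ hτ _ (hz.1.1.clm ι) _ _ h2).2
  have h4 := norm_integral_le_lpNormOn hp hτ.le h2.1.2
  have h5 : ∫ s in (0 : ℝ)..τ, ((1 : ℝ) • ι (z s) + s • dz s) =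
      τ • (x + ∫ s in (0 : ℝ)..τ, dz s) := by
    have := integral_product_rule hτ.le x (φ := fun t => t) (φ' := fun _ => 1)
      (fun s => hasDerivAt_id s) continuous_const (hz.1.2.intervalIntegrable hp hτ.le le_rfl)
    rw [zero_smul, sub_zero] at this
    rw [← this]
    refine integral_congr_of_ae_restrict hτ.le ?_
    filter_upwards [hz.1.3] with t ht
    rw [ht]
  rw [h5, norm_smul, Real.norm_eq_abs, abs_of_pos hτ, sub_zero] at h4
  have h6 : τ ^ (1 - 1 / p) * τ ^ (1 / p) = τ := by
    rw [← Real.rpow_add hτ]; simp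
  have hn : 0 ≤ τ ^ (1 - 1 / p) := by positivity
  have h7 : τ * ‖x + ∫ s in (0 : ℝ)..τ, dz s‖ ≤ τ * (K ^ 2 * ‖x‖) :=
    calc _ ≤ τ ^ (1 - 1 / p) * (K * (K * (τ ^ (1 / p) * ‖x‖))) := by
            refine h4.trans (mul_le_mul_of_nonneg_left (h3.trans ?_) hn)
            exact mul_le_mul_of_nonneg_left h1 h.nonneg
      _ = (τ ^ (1 - 1 / p) * τ ^ (1 / p)) * (K ^ 2 * ‖x‖) := by ring
      _ = _ := by rw [h6]
  exact le_of_mul_le_mul_left h7 hτ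

/-- The semigroup generated by `-T`, characterised by its orbits. -/
structure OrbitFamily (ι : D →L[ℝ] X) (p : ℝ) (T : D →L[ℝ] X) (C : ℝ) (S : ℝ → X →L[ℝ] X) :
    Prop where
  bound : ∀ t, 0 ≤ t → ∀ y, ‖S t y‖ ≤ C * ‖y‖
  orbit : ∀ τ, 0 < τ → ∀ x z dz, Sol ι p (Ioo 0 τ) 0 (fun _ => T) (ι x) (fun _ => 0) z dz →
    ∀ t ∈ Icc 0 τ, S t (ι x) = ι x + ∫ s in (0 : ℝ)..t, dz s

/-- By uniqueness the value at `t` depends neither on the time horizon nor on the null solution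
chosen, so it is linear in `x`; the bound by `‖ι x‖` extends it from the dense range of `ι` to `X`.
The summand `1` covers `t = 0`, where the value is `ι x` while `K` may be less than one. -/
theorem AutReg.exists_orbitFamily (hp : 1 < p) (h : AutReg ι p T K) (hι : DenseRange ι) :
    ∃ S, OrbitFamily ι p T (K ^ 2 + 1) S := by
  choose z dz hz using fun τ x => h.exists_null hp τ x
  have hP : ∀ τ, 0 < τ → ∀ x w dw, Sol ι p (Ioo 0 τ) 0 (fun _ => T) (ι x) (fun _ => 0) w dw →
      ∀ t ∈ Icc 0 τ, ι x + ∫ s in (0 : ℝ)..t, dz (|t| + 1) x s = ι x + ∫ s in (0 : ℝ)..t, dw s := by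
    intro τ hτ x w dw hw t ht
    rcases ht.1.eq_or_lt with h0 | h0
    · simp [← h0]
    have h1 := (hz (|t| + 1) x).mono (I := Ioo 0 t)
      (Ioo_subset_Ioo_right (by linarith [le_abs_self t]))
    have h2 := hw.mono (I := Ioo 0 t) (Ioo_subset_Ioo_right ht.2)
    rw [integral_congr_of_ae_restrict h0.le (h.unique hp h0 h1 h2).2]
  have hpos : ∀ t : ℝ, 0 < |t| + 1 := fun t => by positivity
  let P : ℝ → D →ₗ[ℝ] X := fun t =>
    -- The horizon `|t| + 1` is positive and exceeds `t` for every real `t`. Negative times receive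
    -- the zero operator; `OrbitFamily` says nothing about them.
    { toFun := fun x => if 0 ≤ t then ι x + ∫ s in (0 : ℝ)..t, dz (|t| + 1) x s else 0
      map_add' := fun x y => by
        split_ifs with ht
        · have ht' : t ∈ Icc 0 (|t| + 1) := ⟨ht, by linarith [le_abs_self t]⟩
          have h1 := (hz (|t| + 1) x).add hp (startsAt_Ioo _ _) (hz (|t| + 1) y)
          rw [← map_add, add_zero] at h1
          have hs : Ioo 0 t ⊆ Ioo 0 (|t| + 1) := Ioo_subset_Ioo_right ht'.2
          rw [hP _ (hpos t) (x + y) _ _ h1 t ht', intervalIntegral.integral_add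
            ((hz _ x).1.2.intervalIntegrable hp ht hs) ((hz _ y).1.2.intervalIntegrable hp ht hs),
            map_add]
          abel
        · simp
      map_smul' := fun c x => by
        split_ifs with ht
        · have ht' : t ∈ Icc 0 (|t| + 1) := ⟨ht, by linarith [le_abs_self t]⟩
          have h1 := (hz (|t| + 1) x).const_smul c
          rw [← map_smul, smul_zero] at h1
          rw [hP _ (hpos t) (c • x) _ _ h1 t ht', intervalIntegral.integral_smul,
            map_smul, RingHom.id_apply, smul_add]
        · simp }
  have hb : ∀ t x, ‖P t x‖ ≤ (K ^ 2 + 1) * ‖ι x‖ := by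
    intro t x
    by_cases ht : 0 ≤ t
    · have e : P t x = ι x + ∫ s in (0 : ℝ)..t, dz (|t| + 1) x s := if_pos ht
      rw [e]
      rcases ht.eq_or_lt with h0 | h0
      · rw [← h0]
        simp only [intervalIntegral.integral_same, add_zero]
        nlinarith [norm_nonneg (ι x), sq_nonneg K]
      · have h1 := (hz (|t| + 1) x).mono (I := Ioo 0 t)
          (Ioo_subset_Ioo_right (by linarith [le_abs_self t]))
        refine (h.null_bound hp h0 h1).trans ?_
        gcongr; linarith
    · have e : P t x = 0 := if_neg ht
      rw [e, norm_zero]; positivity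
  have hd : DenseRange (ι : D →ₗ[ℝ] X) := hι
  refine ⟨fun t => (P t).extendOfNorm (ι : D →ₗ[ℝ] X), fun t _ y => ?_, ?_⟩
  · exact LinearMap.norm_extendOfNorm_apply_le hd _ (hb t) y
  · intro τ hτ x w dw hw t ht
    have e : P t x = ι x + ∫ s in (0 : ℝ)..t, dz (|t| + 1) x s := if_pos ht.1
    exact (LinearMap.extendOfNorm_eq hd ⟨_, hb t⟩ x).trans (e.trans (hP τ hτ x w dw hw t ht))

end Semigroup

/-! ### The orbits form a strongly continuous semigroup with generator `-T`. -/

section Semigroup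

variable {D X : Type*} [NormedAddCommGroup D] [NormedSpace ℝ D]
  [NormedAddCommGroup X] [NormedSpace ℝ X] [CompleteSpace D] [CompleteSpace X]
  {ι : D →L[ℝ] X} {p : ℝ} {T : D →L[ℝ] X} {K C : ℝ} {S : ℝ → X →L[ℝ] X}

omit [CompleteSpace D] [CompleteSpace X] in
theorem eq_of_eqOn_range (hι : DenseRange ι) {S₁ S₂ : X →L[ℝ] X} (h : ∀ d, S₁ (ι d) = S₂ (ι d)) :
    S₁ = S₂ :=
  ContinuousLinearMap.ext fun y => congrFun
    (hι.equalizer S₁.continuous S₂.continuous (funext h)) y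

omit [CompleteSpace D] [CompleteSpace X] in
theorem OrbitFamily.continuousOn (hp : 1 < p) (h : AutReg ι p T K) (hι : DenseRange ι)
    (hS : OrbitFamily ι p T C S) (hC : 0 ≤ C) (y : X) :
    ContinuousOn (fun t => S t y) (Ici 0) := by
  have hD : ∀ x : D, ContinuousOn (fun t => S t (ι x)) (Ici 0) := by
    intro x t ht
    have ht' : (0 : ℝ) ≤ t := ht
    have hτ : 0 < t + 1 := by linarith
    obtain ⟨z, dz, hz⟩ := h.exists_null hp (t + 1) x
    have h1 : ContinuousOn (fun t => S t (ι x)) (Icc 0 (t + 1)) :=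
      (continuousOn_const.add (continuousOn_primitive_of_memLpOn hp hτ.le hz.1.2)).congr
        (hS.orbit _ hτ x z dz hz)
    refine (h1 t ⟨ht', by linarith⟩).mono_of_mem_nhdsWithin ?_
    exact inter_mem_nhdsWithin (Ici 0) (Iic_mem_nhds (by linarith))
  refine continuousOn_of_uniform_approx_of_continuousOn fun U hU => ?_
  obtain ⟨ε, hε, hεU⟩ := Metric.mem_uniformity_dist.1 hU
  obtain ⟨x, hx⟩ := hι.exists_dist_lt y (show 0 < ε / (C + 1) by positivity)
  refine ⟨_, hD x, fun t ht => hεU ?_⟩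
  rw [dist_eq_norm, ← map_sub]
  refine (hS.bound t ht _).trans_lt ?_
  rw [dist_eq_norm, lt_div_iff₀ (by positivity)] at hx
  nlinarith [norm_nonneg (y - ι x)]

omit [CompleteSpace D] [CompleteSpace X] in
theorem OrbitFamily.zero (hp : 1 < p) (h : AutReg ι p T K) (hι : DenseRange ι)
    (hS : OrbitFamily ι p T C S) : S 0 = ContinuousLinearMap.id ℝ X := by
  refine eq_of_eqOn_range hι fun x => ?_
  obtain ⟨z, dz, hz⟩ := h.exists_null hp 1 x
  simp [hS.orbit 1 one_pos x z dz hz 0 (by simp)]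

omit [CompleteSpace D] [CompleteSpace X] in
-- A null solution is identified with a point of `D` only at almost every time `σ`. From such a `σ`
-- on, its translate is the null solution started at `z σ`, which is the semigroup law at `σ`;
-- continuity in `σ` then removes the exceptional set.
theorem OrbitFamily.add (hp : 1 < p) (h : AutReg ι p T K) (hι : DenseRange ι)
    (hS : OrbitFamily ι p T C S) (hC : 0 ≤ C) {r s : ℝ} (hr : 0 ≤ r) (hs : 0 ≤ s) :
    S (r + s) = (S r).comp (S s) := by
  refine eq_of_eqOn_range hι fun x => ?_
  set τ := r + s + 1 with hτd
  have hτ : 0 < τ := by positivity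
  obtain ⟨z, dz, hz⟩ := h.exists_null hp τ x
  have hae : ∀ᵐ σ ∂(volume.restrict (Ioo 0 (s + 1))), S (r + σ) (ι x) = S r (S σ (ι x)) := by
    have hsub : Ioo 0 (s + 1) ⊆ Ioo 0 τ := Ioo_subset_Ioo_right (by rw [hτd]; linarith)
    filter_upwards [ae_restrict_mem measurableSet_Ioo,
      ae_restrict_of_ae_restrict_of_subset hsub hz.1.3] with σ hσ h1
    have hστ : σ ∈ Icc 0 τ := Ioo_subset_Icc_self (hsub hσ)
    have h2 := hz.1.comp_affine hp (startsAt_Ioo 0 τ) (I := Ioo 0 (τ - σ)) (γ := 0) (c := σ)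
      (r := 1) (startsAt_Ioo _ _) one_ne_zero
      (fun t ht => ⟨by linarith [ht.1, hσ.1], by linarith [ht.2]⟩)
      (by simpa using hz.1.2.intervalIntegrable hp hσ.1.le (Ioo_subset_Ioo_right hστ.2))
    simp only [mul_zero, add_zero, ← h1, one_mul, one_smul] at h2
    have h3 : Sol ι p (Ioo 0 (τ - σ)) 0 (fun _ => T) (ι (z σ)) (fun _ => 0)
        (fun s => z (σ + s)) (fun s => dz (σ + s)) :=
      ⟨h2, ae_comp_add measurableSet_Ioo measurableSet_Ioo
        (fun t ht => ⟨by linarith [ht.1, hσ.1], by linarith [ht.2]⟩) hz.2⟩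
    have hrτ : r + σ ≤ τ := by rw [hτd]; linarith [hσ.2]
    have h4 := hS.orbit (τ - σ) (by rw [hτd]; linarith [hσ.2]) _ _ _ h3 r ⟨hr, by linarith⟩
    rw [hS.orbit τ hτ x z dz hz σ hστ, ← h1, h4, hS.orbit τ hτ x z dz hz (r + σ)
      ⟨by linarith [hσ.1], hrτ⟩, h1, intervalIntegral.integral_comp_add_left, add_assoc, add_zero,
      add_comm r σ, intervalIntegral.integral_add_adjacent_intervals]
    · exact hz.1.2.intervalIntegrable hp hσ.1.le (Ioo_subset_Ioo_right hστ.2)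
    · exact hz.1.2.intervalIntegrable hp (by linarith)
        (Ioo_subset_Ioo hσ.1.le (by linarith))
  have hc := hS.continuousOn hp h hι hC
  have heq := Measure.eqOn_Icc_of_ae_eq (μ := volume) (a := 0) (b := s + 1) (by linarith)
    (f := fun σ => S (r + σ) (ι x)) (g := fun σ => S r (S σ (ι x)))
    (by rwa [← Measure.restrict_congr_set Ioo_ae_eq_Icc])
    ((hc (ι x)).comp (by fun_prop) fun σ hσ => add_nonneg hr hσ.1)
    ((S r).continuous.comp_continuousOn ((hc (ι x)).mono fun σ hσ => hσ.1))
  exact heq ⟨hs, by linarith⟩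

/-- The derivative of the solution with constant right-hand side `y` is the orbit of `y`. -/
theorem OrbitFamily.deriv_eq (hp : 1 < p) (h : AutReg ι p T K) (hι : DenseRange ι)
    (hS : OrbitFamily ι p T C S) (hC : 0 ≤ C) {τ : ℝ} (hτ : 0 < τ) {y : X} {V : ℝ → D}
    {dV : ℝ → X} (hV : Sol ι p (Ioo 0 τ) 0 (fun _ => T) 0 (fun _ => y) V dV) :
    ∀ᵐ t ∂(volume.restrict (Ioo 0 τ)), dV t = S t y := by
  have hSm : ∀ y, MemLpOn p (Ioo 0 τ) (fun t => S t y) := fun y =>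
    memLpOn_of_continuous ((hS.continuousOn hp h hι hC y).mono fun t ht => ht.1)
  set c := (K + C) * τ ^ (1 / p) with hc
  -- For `y = ι x` the solution is the primitive of the null solution, whose derivative is the
  -- orbit. For general `y` the error is controlled by `‖y - ι x‖`, which density makes arbitrarily
  -- small.
  have key : ∀ x : D, lpNormOn p (Ioo 0 τ) (fun t => dV t - S t y) ≤ c * ‖y - ι x‖ := by
    intro x
    obtain ⟨z, dz, hz⟩ := h.exists_null hp τ x
    have h1 := hV.sub hp (startsAt_Ioo 0 τ) (hz.primitive hp hτ)
    rw [sub_zero] at h1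
    have h2 := (h.bound τ hτ _ (memLpOn_const _) _ _ h1).2
    rw [lpNormOn_const hp _ hτ.le, sub_zero] at h2
    have h3 : ∀ᵐ t ∂(volume.restrict (Ioo 0 τ)), dV t - S t y =
        (dV t - ι (z t)) + S t (ι x - y) := by
      filter_upwards [hz.1.3, ae_restrict_mem measurableSet_Ioo] with t h4 ht
      rw [map_sub, hS.orbit τ hτ x z dz hz t (Ioo_subset_Icc_self ht), h4]
      abel
    rw [lpNormOn_congr h3]
    refine (lpNormOn_add_le hp h1.1.2 (hSm _)).trans ?_
    have h5 : lpNormOn p (Ioo 0 τ) (fun t => S t (ι x - y)) ≤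
        C * lpNormOn p (Ioo 0 τ) (fun _ => ι x - y) := by
      refine lpNormOn_le_mul (memLpOn_const _) hC ?_
      filter_upwards [ae_restrict_mem measurableSet_Ioo] with t ht using hS.bound t ht.1.le _
    rw [lpNormOn_const hp _ hτ.le, sub_zero, norm_sub_rev] at h5
    calc _ ≤ K * (τ ^ (1 / p) * ‖y - ι x‖) + C * (τ ^ (1 / p) * ‖y - ι x‖) := add_le_add h2 h5
      _ = _ := by rw [hc]; ring
  have hc0 : 0 ≤ c := by have := h.nonneg; positivity
  have hz : lpNormOn p (Ioo 0 τ) (fun t => dV t - S t y) ≤ 0 := by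
    refine le_of_forall_pos_le_add fun ε hε => ?_
    obtain ⟨x, hx⟩ := hι.exists_dist_lt y (show 0 < ε / (c + 1) by positivity)
    rw [dist_eq_norm, lt_div_iff₀ (by positivity)] at hx
    nlinarith [key x, norm_nonneg (y - ι x)]
  filter_upwards [lpNormOn_eq_zero hp (MemLp.sub hV.1.2 (hSm y))
    (le_antisymm hz lpNormOn_nonneg)] with t ht using sub_eq_zero.1 ht

omit [CompleteSpace D] [CompleteSpace X] in
theorem OrbitFamily.intervalIntegrable (hp : 1 < p) (h : AutReg ι p T K) (hι : DenseRange ι)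
    (hS : OrbitFamily ι p T C S) (hC : 0 ≤ C) (y : X) {a b : ℝ} (ha : 0 ≤ a) (hb : 0 ≤ b) :
    IntervalIntegrable (fun s => S s y) volume a b :=
  ((hS.continuousOn hp h hι hC y).mono fun t ht => (le_min ha hb).trans
    (by rw [mem_uIcc] at ht; rcases ht with ht | ht
        · exact (min_le_left _ _).trans ht.1
        · exact (min_le_right _ _).trans ht.1)).intervalIntegrable

/-- The integrated orbit lies in the domain of `T`. -/
theorem OrbitFamily.exists_integral (hp : 1 < p) (h : AutReg ι p T K) (hι : DenseRange ι)
    (hS : OrbitFamily ι p T C S) (hC : 0 ≤ C) (y : X) {t : ℝ} (ht : 0 < t) :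
    ∃ d : D, ι d = ∫ s in (0 : ℝ)..t, S s y ∧ T d = y - S t y := by
  set τ := t + 1 with hτd
  have hτ : 0 < τ := by positivity
  obtain ⟨V, dV, hV⟩ := h.exists_sol τ (fun _ => y) (memLpOn_const _)
  have hd := hS.deriv_eq hp h hι hC hτ hV
  have hcl := h.graph.isClosed
  let q : ℝ → X × X := fun s => (∫ r in (0 : ℝ)..s, S r y, y - S s y)
  have hq : ∀ᵐ s ∂(volume.restrict (Ioo 0 τ)),
      q s ∈ {q : X × X | ∃ d : D, ι d = q.1 ∧ T d = q.2} := by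
    filter_upwards [hd, hV.1.3, hV.2, ae_restrict_mem measurableSet_Ioo] with s h1 h2 h3 hs
    refine ⟨V s, ?_, ?_⟩
    · rw [h2, zero_add]
      exact integral_congr_of_ae_restrict hs.1.le
        (ae_restrict_of_ae_restrict_of_subset (Ioo_subset_Ioo_right hs.2.le) hd)
    · change T (V s) = y - S s y
      rw [← h1, ← h3, add_sub_cancel_left]
  have hqc : ContinuousOn q (Ioo 0 τ) := by
    refine ContinuousOn.prodMk ?_ (continuousOn_const.sub
      ((hS.continuousOn hp h hι hC y).mono fun s hs => hs.1.le))
    refine (continuousOn_primitive_of_memLpOn hp hτ.le ?_).mono Ioo_subset_Icc_self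
    exact memLpOn_of_continuous ((hS.continuousOn hp h hι hC y).mono fun s hs => hs.1)
  -- The pair `q s` lies in the graph for almost every `s`, hence on a dense set. Since `q` is
  -- continuous and the graph is closed, it lies there for every `s`, in particular for `s = t`.
  have hdense := Measure.dense_of_ae ((ae_restrict_iff' measurableSet_Ioo).1 hq)
  by_contra hcon
  have hopen : IsOpen (Ioo 0 τ ∩ q ⁻¹' {q : X × X | ∃ d : D, ι d = q.1 ∧ T d = q.2}ᶜ) :=
    hqc.isOpen_inter_preimage isOpen_Ioo hcl.isOpen_compl
  obtain ⟨s, hs1, hs2⟩ := hdense.exists_mem_open hopen ⟨t, ⟨ht, by rw [hτd]; linarith⟩, hcon⟩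
  exact hs2.2 (hs1 hs2.1)

/-- The orbit of a point of the domain. -/
theorem OrbitFamily.apply_domain (hp : 1 < p) (h : AutReg ι p T K) (hι : DenseRange ι)
    (hS : OrbitFamily ι p T C S) (hC : 0 ≤ C) (d : D) {t : ℝ} (ht : 0 ≤ t) :
    S t (ι d) = ι d - ∫ s in (0 : ℝ)..t, S s (T d) := by
  have hτ : 0 < t + 1 := by positivity
  obtain ⟨V, dV, hV⟩ := h.exists_sol (t + 1) (fun _ => T d) (memLpOn_const _)
  have hc : Sol ι p (Ioo 0 (t + 1)) 0 (fun _ => T) (ι d) (fun _ => T d) (fun _ => d) (fun _ => 0) :=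
    ⟨⟨memLpOn_const _, memLpOn_zero, by simp⟩, by simp⟩
  have h1 := hc.sub hp (startsAt_Ioo 0 _) hV
  rw [sub_zero] at h1
  have h2 := hS.orbit _ hτ d _ _ (h1.congr_rhs (by simp)) t ⟨ht, by linarith⟩
  rw [h2]
  simp only [zero_sub, intervalIntegral.integral_neg]
  rw [← sub_eq_add_neg, integral_congr_of_ae_restrict ht
    (ae_restrict_of_ae_restrict_of_subset (Ioo_subset_Ioo_right (by linarith))
      (hS.deriv_eq hp h hι hC hτ hV))]

omit [CompleteSpace D] in
theorem OrbitFamily.tendsto_average (hp : 1 < p) (h : AutReg ι p T K) (hι : DenseRange ι)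
    (hS : OrbitFamily ι p T C S) (hC : 0 ≤ C) (y : X) :
    Tendsto (fun r : ℝ≥0 => (r : ℝ)⁻¹ • ∫ s in (0 : ℝ)..r, S s y) (𝓝[>] 0) (𝓝 y) := by
  have hc : Continuous fun s : ℝ => S (max s 0) y :=
    (hS.continuousOn hp h hι hC y).comp_continuous (by fun_prop)
      fun s => mem_Ici.2 (le_max_right _ _)
  have hd : HasDerivAt (fun t => ∫ s in (0 : ℝ)..t, S (max s 0) y) (S (max 0 0) y) 0 :=
    intervalIntegral.integral_hasDerivAt_right (hc.intervalIntegrable _ _)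
      hc.aestronglyMeasurable.stronglyMeasurableAtFilter hc.continuousAt
  rw [max_self, hS.zero hp h hι, hasDerivAt_iff_tendsto_slope_zero] at hd
  have hcoe : Tendsto (fun r : ℝ≥0 => (r : ℝ)) (𝓝[>] 0) (𝓝[≠] 0) := by
    refine tendsto_nhdsWithin_iff.2 ⟨?_, ?_⟩
    · exact (NNReal.continuous_coe.tendsto' 0 0 rfl).mono_left nhdsWithin_le_nhds
    · filter_upwards [self_mem_nhdsWithin] with r hr
      exact NNReal.coe_ne_zero.2 (ne_of_gt hr)
  refine (hd.comp hcoe).congr fun r => ?_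
  simp only [Function.comp, zero_add, intervalIntegral.integral_same, sub_zero]
  congr 1
  refine integral_congr_of_ae_restrict r.2 ?_
  filter_upwards [ae_restrict_mem measurableSet_Ioo] with s hs
  rw [max_eq_left hs.1.le]

/-- The difference quotient at `x` is `-T` applied to the average of the orbit. The averages tend to
`x`, so if the quotients converge, closedness of `T` puts `x` into the domain with the right value.
On the domain the quotient is minus the average of the orbit of `T d`, which converges. -/
theorem OrbitFamily.isSemigroupOf (hp : 1 < p) (h : AutReg ι p T K) (hι : DenseRange ι)
    (hS : OrbitFamily ι p T C S) (hC : 0 ≤ C) : IsSemigroupOf ι T (fun r : ℝ≥0 => S r) := by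
  refine ⟨hS.zero hp h hι, fun r s => hS.add hp h hι hC r.2 s.2, fun x => ?_, fun x y => ?_⟩
  · exact (hS.continuousOn hp h hι hC x).comp_continuous NNReal.continuous_coe fun r => r.2
  constructor
  · intro hlim
    have hcl := h.graph.isClosed
    have hav := hS.tendsto_average hp h hι hC x
    have hmem : ∀ᶠ r : ℝ≥0 in 𝓝[>] 0, ((r : ℝ)⁻¹ • ∫ s in (0 : ℝ)..r, S s x,
        -((r : ℝ)⁻¹ • (S r x - x))) ∈ {q : X × X | ∃ d : D, ι d = q.1 ∧ T d = q.2} := by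
      filter_upwards [self_mem_nhdsWithin] with r hr
      obtain ⟨d, hd1, hd2⟩ := hS.exists_integral hp h hι hC x (t := (r : ℝ)) (NNReal.coe_pos.2 hr)
      refine ⟨(r : ℝ)⁻¹ • d, ?_, ?_⟩
      · rw [map_smul, hd1]
      · rw [map_smul, hd2, ← smul_neg, neg_sub]
    obtain ⟨d, hd1, hd2⟩ := hcl.mem_of_tendsto (hav.prodMk_nhds hlim.neg) hmem
    exact ⟨d, hd1, by rw [hd2, neg_neg]⟩
  · rintro ⟨d, rfl, rfl⟩
    refine (hS.tendsto_average hp h hι hC (T d)).neg.congr fun r => ?_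
    have e := hS.apply_domain hp h hι hC d r.2
    change S r (ι d) = ι d - ∫ s in (0 : ℝ)..r, S s (T d) at e
    rw [e, sub_sub_cancel_left, smul_neg]

end Semigroup

/-! ### Uniqueness of the semigroup and the meaning of `semigroupBound`. -/

section SemigroupBound

variable {D X : Type*} [NormedAddCommGroup D] [NormedSpace ℝ D]
  [NormedAddCommGroup X] [NormedSpace ℝ X] [CompleteSpace D] [CompleteSpace X]
  {ι : D →L[ℝ] X} {p : ℝ} {T : D →L[ℝ] X} {K C : ℝ} {S : ℝ → X →L[ℝ] X}

omit [CompleteSpace D] [CompleteSpace X] in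
-- A semigroup maps the domain of its generator into itself and commutes with the generator there.
theorem IsSemigroupOf.exists_orbit_mem {S' : ℝ≥0 → X →L[ℝ] X} (h' : IsSemigroupOf ι T S') (d : D)
    (r : ℝ≥0) : Tendsto (fun h : ℝ≥0 => (h : ℝ)⁻¹ • (S' (h + r) (ι d) - S' r (ι d))) (𝓝[>] 0)
      (𝓝 (-S' r (T d))) ∧ ∃ e : D, ι e = S' r (ι d) ∧ T e = S' r (T d) := by
  have h1 := ((S' r).continuous.tendsto _).comp ((h'.generator (ι d) (-T d)).2 ⟨d, rfl, rfl⟩)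
  have h2 : Tendsto (fun h : ℝ≥0 => (h : ℝ)⁻¹ • (S' (h + r) (ι d) - S' r (ι d))) (𝓝[>] 0)
      (𝓝 (-S' r (T d))) := by
    rw [map_neg] at h1
    refine h1.congr fun h => ?_
    rw [Function.comp_apply, map_smul, map_sub, add_comm h r, h'.add]
    rfl
  refine ⟨h2, ?_⟩
  obtain ⟨e, he1, he2⟩ := (h'.generator (S' r (ι d)) (-S' r (T d))).1 (h2.congr fun h => by
    rw [h'.add]; rfl)
  exact ⟨e, he1, (neg_injective he2).symm⟩

omit [CompleteSpace D] in
/-- A semigroup is determined by its generator. -/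
theorem OrbitFamily.eq_of_isSemigroupOf (h : AutReg ι p T K) (hι : DenseRange ι)
    (hS : OrbitFamily ι p T C S) {S' : ℝ≥0 → X →L[ℝ] X}
    (h' : IsSemigroupOf ι T S') (r : ℝ≥0) : S' r = S r := by
  refine eq_of_eqOn_range hι fun d => ?_
  -- The orbit of `d` under `S'` lifts to a path `u` in `D`, continuous by the graph norm estimate.
  -- This path is a null solution started at `ι d`, so `OrbitFamily.orbit` identifies it.
  choose u hu1 hu2 using fun r => (h'.exists_orbit_mem d r).2
  have hcu : Continuous u := by
    obtain ⟨c, C', hc, _, hcC⟩ := h.graph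
    rw [continuous_iff_continuousAt]
    intro r₀
    rw [ContinuousAt, tendsto_iff_norm_sub_tendsto_zero]
    have hlim : Tendsto (fun r => c⁻¹ * (‖S' r (ι d) - S' r₀ (ι d)‖ + ‖S' r (T d) - S' r₀ (T d)‖))
        (𝓝 r₀) (𝓝 0) := by
      have hc1 := h'.continuous (ι d)
      have hc2 := h'.continuous (T d)
      have : Continuous fun r => c⁻¹ * (‖S' r (ι d) - S' r₀ (ι d)‖ +
        ‖S' r (T d) - S' r₀ (T d)‖) := by fun_prop
      exact this.tendsto' r₀ 0 (by simp)
    refine squeeze_zero (fun _ => norm_nonneg _) (fun r => ?_) hlim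
    rw [← hu1, ← hu1, ← hu2, ← hu2, ← map_sub, ← map_sub, ← div_eq_inv_mul,
      le_div_iff₀ hc, mul_comm]
    exact (hcC _).1
  have hcS : ∀ y, Continuous fun t : ℝ => S' t.toNNReal y := fun y =>
    (h'.continuous y).comp continuous_real_toNNReal
  set τ : ℝ := r + 1 with hτd
  have hτ : 0 < τ := by positivity
  -- The generator supplies only right derivatives; as they are continuous, the fundamental theorem
  -- of calculus still applies.
  have hint : ∀ t, 0 ≤ t → ∫ s in (0 : ℝ)..t, -S' s.toNNReal (T d) =
      S' t.toNNReal (ι d) - S' (0 : ℝ).toNNReal (ι d) := by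
    intro t ht
    refine intervalIntegral.integral_eq_sub_of_hasDeriv_right (hcS _).continuousOn (fun s hs => ?_)
      ((hcS (T d)).neg.intervalIntegrable _ _)
    rw [min_eq_left ht] at hs
    rw [hasDerivWithinAt_iff_tendsto_slope' (by simp)]
    have hmap : Tendsto (fun σ : ℝ => (σ - s).toNNReal) (𝓝[>] s) (𝓝[>] 0) := by
      refine tendsto_nhdsWithin_iff.2 ⟨?_, ?_⟩
      · have : Continuous fun σ : ℝ => (σ - s).toNNReal := by fun_prop
        exact (this.tendsto' s 0 (by simp)).mono_left nhdsWithin_le_nhds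
      · filter_upwards [self_mem_nhdsWithin] with σ hσ
        simpa using hσ
    refine ((h'.exists_orbit_mem d s.toNNReal).1.comp hmap).congr' ?_
    filter_upwards [self_mem_nhdsWithin] with σ hσ
    have hσ' : s < σ := hσ
    rw [Function.comp_apply, slope_def_module, Real.coe_toNNReal _ (by linarith),
      ← Real.toNNReal_add (by linarith) hs.1.le, sub_add_cancel]
  have hsol : Sol ι p (Ioo 0 τ) 0 (fun _ => T) (ι d) (fun _ => 0) (fun t => u t.toNNReal)
      (fun t => -S' t.toNNReal (T d)) := by
    refine ⟨⟨memLpOn_of_continuous (hcu.comp continuous_real_toNNReal).continuousOn,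
      memLpOn_of_continuous (hcS (T d)).neg.continuousOn, ?_⟩, ae_of_all _ fun t => ?_⟩
    · filter_upwards [ae_restrict_mem measurableSet_Ioo] with t ht
      rw [hint t ht.1.le, hu1, Real.toNNReal_zero, h'.zero, ContinuousLinearMap.id_apply,
        add_sub_cancel]
    · rw [hu2, neg_add_cancel]
  have h1 := hS.orbit τ hτ d _ _ hsol r ⟨r.2, by rw [hτd]; linarith⟩
  rw [hint r r.2, Real.toNNReal_zero, h'.zero, ContinuousLinearMap.id_apply, add_sub_cancel,
    Real.toNNReal_coe] at h1
  exact h1.symm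

omit [CompleteSpace D] [CompleteSpace X] in
theorem semigroupBound_nonneg : 0 ≤ semigroupBound ι T :=
  Real.sSup_nonneg (by rintro m ⟨S, _, r, rfl⟩; exact norm_nonneg _)

/-- A real supremum carries information only for a nonempty set that is bounded above. Nonemptiness
is the existence of the semigroup; boundedness is its uniqueness together with the bound on orbits.
-/
theorem OrbitFamily.norm_le_semigroupBound (hp : 1 < p) (h : AutReg ι p T K) (hι : DenseRange ι)
    (hS : OrbitFamily ι p T C S) (hC : 0 ≤ C) {t : ℝ} (ht : 0 ≤ t) (y : X) :
    ‖S t y‖ ≤ semigroupBound ι T * ‖y‖ := by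
  refine (S t).le_of_opNorm_le ?_ y
  refine le_csSup ⟨C, ?_⟩ ⟨_, hS.isSemigroupOf hp h hι hC, ⟨t, ht⟩, rfl⟩
  rintro m ⟨S', hS', r, rfl⟩
  rw [hS.eq_of_isSemigroupOf h hι hS' r]
  exact (S r).opNorm_le_bound hC (hS.bound r r.2)

theorem OrbitFamily.norm_eq_zero (hp : 1 < p) (h : AutReg ι p T K) (hι : DenseRange ι)
    (hS : OrbitFamily ι p T C S) (hC : 0 ≤ C) (h0 : semigroupBound ι T = 0) (y : X) : ‖y‖ = 0 := by
  have := hS.norm_le_semigroupBound hp h hι hC le_rfl y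
  rw [h0, zero_mul, hS.zero hp h hι] at this
  exact le_antisymm this (norm_nonneg _)

end SemigroupBound

/-! ### Variation of constants. -/

section Duhamel

variable {D X : Type*} [NormedAddCommGroup D] [NormedSpace ℝ D]
  [NormedAddCommGroup X] [NormedSpace ℝ X] [CompleteSpace D] [CompleteSpace X]
  {ι : D →L[ℝ] X} {p : ℝ} {T : D →L[ℝ] X} {K C : ℝ} {S : ℝ → X →L[ℝ] X}

omit [CompleteSpace D] [CompleteSpace X] in
-- Joint continuity provides the measurability of convolution integrands. The truncation `max _ 0`
-- is there because `S` is controlled at nonnegative times only.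
theorem OrbitFamily.continuous_uncurry (hp : 1 < p) (h : AutReg ι p T K) (hι : DenseRange ι)
    (hS : OrbitFamily ι p T C S) (hC : 0 ≤ C) :
    Continuous fun q : ℝ × X => S (max q.1 0) q.2 := by
  rw [continuous_iff_continuousAt]
  rintro ⟨r₀, y₀⟩
  rw [ContinuousAt, tendsto_iff_norm_sub_tendsto_zero]
  have hc : Continuous fun s : ℝ => S (max s 0) y₀ :=
    (hS.continuousOn hp h hι hC y₀).comp_continuous (by fun_prop)
      fun s => mem_Ici.2 (le_max_right _ _)
  have hlim : Tendsto (fun q : ℝ × X => C * ‖q.2 - y₀‖ + ‖S (max q.1 0) y₀ - S (max r₀ 0) y₀‖)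
      (𝓝 (r₀, y₀)) (𝓝 0) := by
    have hc' : Continuous fun q : ℝ × X => S (max q.1 0) y₀ := hc.comp continuous_fst
    have : Continuous fun q : ℝ × X => C * ‖q.2 - y₀‖ + ‖S (max q.1 0) y₀ - S (max r₀ 0) y₀‖ :=
      (continuous_const.mul (continuous_snd.sub continuous_const).norm).add
        (hc'.sub continuous_const).norm
    exact this.tendsto' _ _ (by simp)
  refine squeeze_zero (fun _ => norm_nonneg _) (fun q => ?_) hlim
  calc ‖S (max q.1 0) q.2 - S (max r₀ 0) y₀‖
      = ‖S (max q.1 0) (q.2 - y₀) + (S (max q.1 0) y₀ - S (max r₀ 0) y₀)‖ := by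
        rw [map_sub]; congr 1; abel
    _ ≤ _ := (norm_add_le _ _).trans (add_le_add_left (hS.bound _ (le_max_right _ _) _) _)

omit [CompleteSpace D] [CompleteSpace X] in
theorem OrbitFamily.integrable_prod (hp : 1 < p) (h : AutReg ι p T K) (hι : DenseRange ι)
    (hS : OrbitFamily ι p T C S) (hC : 0 ≤ C) {t : ℝ} {g : ℝ → X}
    (hg : IntegrableOn g (Ioc 0 t)) {φ : ℝ × ℝ → ℝ} (hφ : Continuous φ) :
    Integrable (fun q : ℝ × ℝ => S (max (φ q) 0) (g q.2))
      ((volume.restrict (Ioc 0 t)).prod (volume.restrict (Ioc 0 t))) := by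
  have hg2 : Integrable (fun q : ℝ × ℝ => g q.2)
      ((volume.restrict (Ioc 0 t)).prod (volume.restrict (Ioc 0 t))) := hg.comp_snd _
  refine Integrable.mono' (g := fun q => C * ‖g q.2‖) (hg2.norm.const_mul C) ?_
    (ae_of_all _ fun q => hS.bound _ (le_max_right _ _) _)
  exact (hS.continuous_uncurry hp h hι hC).comp_aestronglyMeasurable
    (hφ.aestronglyMeasurable.prodMk hg2.1)

omit [CompleteSpace D] [CompleteSpace X] in
theorem OrbitFamily.intervalIntegrable_convolution (hp : 1 < p) (h : AutReg ι p T K)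
    (hι : DenseRange ι) (hS : OrbitFamily ι p T C S) (hC : 0 ≤ C) {t : ℝ} (ht : 0 ≤ t) {g : ℝ → X}
    (hg : IntegrableOn g (Ioc 0 t)) {φ : ℝ → ℝ} (hφ : Continuous φ) :
    IntervalIntegrable (fun s => S (max (φ s) 0) (g s)) volume 0 t := by
  rw [intervalIntegrable_iff_integrableOn_Ioc_of_le ht]
  refine Integrable.mono' (g := fun s => C * ‖g s‖) (hg.norm.const_mul C) ?_
    (ae_of_all _ fun q => hS.bound _ (le_max_right _ _) _)
  exact (hS.continuous_uncurry hp h hι hC).comp_aestronglyMeasurable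
    (hφ.aestronglyMeasurable.prodMk hg.1)

/-- Variation of constants, in integrated form. -/
theorem OrbitFamily.integral_duhamel (hp : 1 < p) (h : AutReg ι p T K) (hι : DenseRange ι)
    (hS : OrbitFamily ι p T C S) (hC : 0 ≤ C) {t : ℝ} (ht : 0 ≤ t) {g : ℝ → X}
    {v : ℝ → D} {dv : ℝ → X} (hg : MemLpOn p (Ioo 0 t) g)
    (hv : Sol ι p (Ioo 0 t) 0 (fun _ => T) 0 g v dv) :
    ∫ r in (0 : ℝ)..t, ∫ s in (0 : ℝ)..r, S (max (r - s) 0) (g s) = ∫ r in (0 : ℝ)..t, ι (v r) := by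
  have hI : ∀ {f : ℝ → X}, MemLpOn p (Ioo 0 t) f → IntegrableOn f (Ioc 0 t) := fun hf =>
    (intervalIntegrable_iff_integrableOn_Ioc_of_le ht).1 (hf.intervalIntegrable hp ht le_rfl)
  have hF1 := hS.integrable_prod hp h hι hC (hI hg) (φ := fun q => q.1 - q.2) (by fun_prop)
  have hF2 := hS.integrable_prod hp h hι hC (hI hv.1.2) (φ := fun q => t - q.1) (by fun_prop)
  obtain ⟨a1, -, a3⟩ := integral_triangle_swap' (F := fun r s => S (max (r - s) 0) (g s)) ht hF1
  obtain ⟨b1, b2, b3⟩ := integral_triangle_swap' (F := fun r s => S (max (t - r) 0) (dv s)) ht hF2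
  have hvI := (hv.1.1.clm ι).intervalIntegrable hp ht le_rfl
  have hSv := hS.intervalIntegrable_convolution hp h hι hC ht (hI (hv.1.1.clm ι))
    (φ := fun s => t - s) (by fun_prop)
  -- Insert `g = dv + T v`. The integrated orbit of `T (v s)` is `ι (v s) - S (t - s) (ι (v s))`; in
  -- the term with `dv`, reversing time turns `r - s` into `t - r`, which no longer depends on `s`.
  have key : ∀ᵐ s ∂(volume.restrict (Ioo 0 t)), ∫ r in s..t, S (max (r - s) 0) (g s) =
      (ι (v s) - S (max (t - s) 0) (ι (v s))) + ∫ r in s..t, S (max (t - r) 0) (dv s) := by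
    filter_upwards [hv.2, ae_restrict_mem measurableSet_Ioo] with s h1 hs
    have hts : 0 ≤ t - s := by linarith [hs.2]
    have e1 : ∀ y, ∫ r in s..t, S (max (r - s) 0) y = ∫ r in (0 : ℝ)..(t - s), S r y := by
      intro y
      rw [intervalIntegral.integral_comp_sub_right (fun r => S (max r 0) y), sub_self]
      refine integral_congr_of_ae_restrict hts ?_
      filter_upwards [ae_restrict_mem measurableSet_Ioo] with r hr
      rw [max_eq_left hr.1.le]
    have e2 : ∀ y, ∫ r in s..t, S (max (t - r) 0) y = ∫ r in (0 : ℝ)..(t - s), S r y := by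
      intro y
      rw [intervalIntegral.integral_comp_sub_left (fun r => S (max r 0) y), sub_self]
      refine integral_congr_of_ae_restrict hts ?_
      filter_upwards [ae_restrict_mem measurableSet_Ioo] with r hr
      rw [max_eq_left hr.1.le]
    have hii := fun y => hS.intervalIntegrable hp h hι hC y le_rfl hts
    rw [e1, e2, max_eq_left hts, hS.apply_domain hp h hι hC (v s) hts, sub_sub_cancel, ← h1,
      ← intervalIntegral.integral_add (hii _) (hii _)]
    simp only [map_add, add_comm]
  rw [a1, integral_congr_of_ae_restrict ht key,
    intervalIntegral.integral_add (hvI.sub hSv) b3, intervalIntegral.integral_sub hvI hSv, ← b1]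
  -- After a second use of Fubini the `dv s` with `s ≤ r` add up to `ι (v r)`, and this term cancels
  -- the one with `S (t - s)`.
  have e3 : ∫ r in (0 : ℝ)..t, ∫ s in (0 : ℝ)..r, S (max (t - r) 0) (dv s) =
      ∫ r in (0 : ℝ)..t, S (max (t - r) 0) (ι (v r)) := by
    refine integral_congr_of_ae_restrict ht ?_
    filter_upwards [hv.1.3, ae_restrict_mem measurableSet_Ioo] with r h1 hr
    rw [ContinuousLinearMap.intervalIntegral_comp_comm _
      (hv.1.2.intervalIntegrable hp hr.1.le (Ioo_subset_Ioo_right hr.2.le)), h1, zero_add]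
  rw [e3, sub_add_cancel]

theorem ae_eq_of_integral_eq {E : Type*} [NormedAddCommGroup E] [NormedSpace ℝ E] [CompleteSpace E]
    {f g : ℝ → E} {τ : ℝ} (hτ : 0 ≤ τ) (hf : IntervalIntegrable f volume 0 τ)
    (hg : IntervalIntegrable g volume 0 τ)
    (h : ∀ t ∈ Ioo 0 τ, ∫ s in (0 : ℝ)..t, f s = ∫ s in (0 : ℝ)..t, g s) :
    ∀ᵐ t ∂(volume.restrict (Ioo 0 τ)), f t = g t := by
  rw [ae_restrict_iff' measurableSet_Ioo]
  filter_upwards [hf.ae_hasDerivAt_integral, hg.ae_hasDerivAt_integral] with t h1 h2 ht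
  have htu : t ∈ uIcc 0 τ := by rw [uIcc_of_le hτ]; exact Ioo_subset_Icc_self ht
  refine (h1 htu 0 left_mem_uIcc).unique ((h2 htu 0 left_mem_uIcc).congr_of_eventuallyEq ?_)
  filter_upwards [isOpen_Ioo.mem_nhds ht] with s hs using h s hs

/-- Variation of constants. -/
theorem OrbitFamily.duhamel (hp : 1 < p) (h : AutReg ι p T K) (hι : DenseRange ι)
    (hS : OrbitFamily ι p T C S) (hC : 0 ≤ C) {τ : ℝ} (hτ : 0 ≤ τ) {g : ℝ → X}
    {v : ℝ → D} {dv : ℝ → X} (hg : MemLpOn p (Ioo 0 τ) g)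
    (hv : Sol ι p (Ioo 0 τ) 0 (fun _ => T) 0 g v dv) :
    ∀ᵐ t ∂(volume.restrict (Ioo 0 τ)),
      ι (v t) = ∫ s in (0 : ℝ)..t, S (max (t - s) 0) (g s) := by
  have hF := hS.integrable_prod hp h hι hC
    ((intervalIntegrable_iff_integrableOn_Ioc_of_le hτ).1 (hg.intervalIntegrable hp hτ le_rfl))
    (φ := fun q => q.1 - q.2) (by fun_prop)
  refine ae_eq_of_integral_eq hτ ((hv.1.1.clm ι).intervalIntegrable hp hτ le_rfl)
    (integral_triangle_swap' (F := fun r s => S (max (r - s) 0) (g s)) hτ hF).2.1 fun t ht => ?_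
  have hs : Ioo 0 t ⊆ Ioo 0 τ := Ioo_subset_Ioo_right ht.2.le
  exact (hS.integral_duhamel hp h hι hC ht.1.le (hg.mono hs) (hv.mono hs)).symm

end Duhamel

/-! ### Young's inequality for convolution with an exponential kernel. -/

section Young

/-- Young's inequality for the convolution with a kernel of mass at most one. -/
theorem lintegral_convolution_rpow_le {p : ℝ} (hp : 1 < p) {k h : ℝ → ℝ≥0∞} (hk : Measurable k)
    (hk1 : ∫⁻ r, k r ≤ 1) (hh : AEMeasurable h) :
    ∫⁻ t, (∫⁻ s, k (t - s) * h s) ^ p ≤ ∫⁻ s, h s ^ p := by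
  wlog hm : Measurable h generalizing h
  · have e : h =ᵐ[volume] hh.mk h := hh.ae_eq_mk
    have e1 : ∀ t, ∫⁻ s, k (t - s) * h s = ∫⁻ s, k (t - s) * hh.mk h s := fun t =>
      lintegral_congr_ae (e.mono fun s hs => by simp only [hs])
    have e2 : ∫⁻ s, h s ^ p = ∫⁻ s, hh.mk h s ^ p :=
      lintegral_congr_ae (e.mono fun s hs => by simp only [hs])
    simp only [e1, e2]
    exact this hh.measurable_mk.aemeasurable hh.measurable_mk
  have hp0 : 0 < p := by linarith
  have hkm : ∀ t, Measurable fun s => k (t - s) := fun t => hk.comp (by fun_prop)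
  -- Hölder's inequality for the splitting `k = k^(1/p) k^(1 - 1/p)`; the mass of `k`, at most one,
  -- disposes of the second factor.
  have step : ∀ t, (∫⁻ s, k (t - s) * h s) ^ p ≤ ∫⁻ s, k (t - s) * h s ^ p := by
    intro t
    have h1 := ENNReal.lintegral_mul_norm_pow_le (μ := volume) (f := fun s => k (t - s) * h s ^ p)
      (g := fun s => k (t - s)) ((hkm t).mul (hm.pow_const p)).aemeasurable (hkm t).aemeasurable
      (p := 1 / p) (q := 1 - 1 / p) (by positivity)
      (by rw [sub_nonneg]; exact (div_le_one hp0).2 hp.le) (by ring)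
    have e : ∀ s, (k (t - s) * h s ^ p) ^ (1 / p) * k (t - s) ^ (1 - 1 / p) = k (t - s) * h s := by
      intro s
      rw [ENNReal.mul_rpow_of_nonneg _ _ (by positivity), ← ENNReal.rpow_mul, mul_one_div_cancel
        hp0.ne', ENNReal.rpow_one, mul_right_comm, ← ENNReal.rpow_add_of_nonneg _ _ (by positivity)
        (by rw [sub_nonneg]; exact (div_le_one hp0).2 hp.le)]
      simp
    have hk2 : ∫⁻ s, k (t - s) ≤ 1 := by rwa [lintegral_sub_left_eq_self k t]
    simp only [e] at h1
    have h2 : ∫⁻ s, k (t - s) * h s ≤ (∫⁻ s, k (t - s) * h s ^ p) ^ (1 / p) := by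
      refine h1.trans (mul_le_of_le_one_right' (ENNReal.rpow_le_one hk2 ?_))
      rw [sub_nonneg]; exact (div_le_one hp0).2 hp.le
    calc _ ≤ ((∫⁻ s, k (t - s) * h s ^ p) ^ (1 / p)) ^ p := ENNReal.rpow_le_rpow h2 hp0.le
      _ = _ := by rw [← ENNReal.rpow_mul, one_div_mul_cancel hp0.ne', ENNReal.rpow_one]
  refine (lintegral_mono step).trans ?_
  rw [lintegral_lintegral_swap]
  · have e : ∀ s, ∫⁻ t, k (t - s) * h s ^ p ≤ h s ^ p := by
      intro s
      have hks : Measurable fun t => k (t - s) :=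
        hk.comp (by fun_prop : Measurable fun t : ℝ => t - s)
      rw [lintegral_mul_const _ hks, lintegral_sub_right_eq_self k s]
      exact mul_le_of_le_one_left' hk1
    exact lintegral_mono e
  · exact ((hk.comp (by fun_prop : Measurable fun q : ℝ × ℝ => q.1 - q.2)).mul
      ((hm.pow_const p).comp measurable_snd)).aemeasurable

theorem lintegral_exp_kernel {l : ℝ} (hl : 0 < l) :
    ∫⁻ r, (Ioi (0 : ℝ)).indicator (fun r => ENNReal.ofReal (l * Real.exp (-(l * r)))) r ≤ 1 := by
  rw [lintegral_indicator measurableSet_Ioi, ← ofReal_integral_eq_lintegral_ofReal]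
  · rw [integral_const_mul]
    have := integral_exp_mul_Ioi (a := -l) (by linarith) 0
    simp only [neg_mul, mul_zero, Real.exp_zero] at this
    rw [this]
    simp [hl.ne']
  · have := integrableOn_exp_mul_Ioi (a := -l) (by linarith) 0
    simp only [neg_mul] at this
    exact this.const_mul l
  · exact ae_of_all _ fun r => by positivity

/-- The kernel `l e^{-l r}` on `r > 0` has mass at most one, which accounts for the factor `l` on
the left. Extending kernel and `g` by zero gives a convolution on the whole line. -/
theorem lpNormOn_le_of_exp_convolution {X Y : Type*} [NormedAddCommGroup X] [NormedAddCommGroup Y]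
    {p : ℝ} (hp : 1 < p) {τ l M : ℝ} (hl : 0 < l) (hM : 0 ≤ M) {w : ℝ → X} {g : ℝ → Y}
    (hg : MemLpOn p (Ioo 0 τ) g)
    (hw : ∀ᵐ t ∂(volume.restrict (Ioo 0 τ)),
      ‖w t‖ ≤ M * ∫ s in (0 : ℝ)..t, Real.exp (-(l * (t - s))) * ‖g s‖) :
    l * lpNormOn p (Ioo 0 τ) w ≤ M * lpNormOn p (Ioo 0 τ) g := by
  have hp0 : 0 < p := by linarith
  set k : ℝ → ℝ≥0∞ := (Ioi (0 : ℝ)).indicator fun r => ENNReal.ofReal (l * Real.exp (-(l * r)))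
    with hk
  set h : ℝ → ℝ≥0∞ := (Ioo 0 τ).indicator fun s => ‖g s‖ₑ with hh
  have hkm : Measurable k := Measurable.indicator (by fun_prop) measurableSet_Ioi
  have hhm : AEMeasurable h := (aemeasurable_indicator_iff measurableSet_Ioo).2 hg.1.enorm
  have hY := lintegral_convolution_rpow_le hp hkm (lintegral_exp_kernel hl) hhm
  have h1 : ∀ᵐ t ∂(volume.restrict (Ioo 0 τ)),
      ENNReal.ofReal l * ‖w t‖ₑ ≤ ENNReal.ofReal M * ∫⁻ s, k (t - s) * h s := by
    filter_upwards [hw, ae_restrict_mem measurableSet_Ioo] with t ht ht'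
    have hi : IntervalIntegrable (fun s => Real.exp (-(l * (t - s))) * ‖g s‖) volume 0 t :=
      (hg.intervalIntegrable hp ht'.1.le (Ioo_subset_Ioo_right ht'.2.le)).norm.continuousOn_mul
        (by fun_prop)
    rw [intervalIntegrable_iff_integrableOn_Ioo_of_le ht'.1.le] at hi
    rw [intervalIntegral.integral_of_le ht'.1.le, integral_Ioc_eq_integral_Ioo] at ht
    have h2 : l * ‖w t‖ ≤ M * ∫ s in Ioo 0 t, l * (Real.exp (-(l * (t - s))) * ‖g s‖) := by
      rw [integral_const_mul]
      calc l * ‖w t‖ ≤ l * (M * _) := mul_le_mul_of_nonneg_left ht hl.le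
        _ = _ := by ring
    have h3 := ENNReal.ofReal_le_ofReal h2
    rw [ENNReal.ofReal_mul hl.le, ENNReal.ofReal_mul hM, ofReal_norm,
      ofReal_integral_eq_lintegral_ofReal (hi.const_mul l)
        (ae_of_all _ fun s => by positivity)] at h3
    refine h3.trans (mul_le_mul_right ?_ _)
    rw [← lintegral_indicator measurableSet_Ioo]
    refine lintegral_mono fun s => ?_
    by_cases hs : s ∈ Ioo 0 t
    · have hs2 : s ∈ Ioo 0 τ := ⟨hs.1, hs.2.trans ht'.2⟩
      have hs3 : t - s ∈ Ioi (0 : ℝ) := sub_pos.2 hs.2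
      rw [indicator_of_mem hs, hk, hh, indicator_of_mem hs2, indicator_of_mem hs3, ← mul_assoc,
        ENNReal.ofReal_mul (by positivity), ofReal_norm]
    · rw [indicator_of_notMem hs]; exact zero_le
  have h4 : ENNReal.ofReal l * eLpNorm w (ENNReal.ofReal p) (volume.restrict (Ioo 0 τ)) ≤
      ENNReal.ofReal M * eLpNorm g (ENNReal.ofReal p) (volume.restrict (Ioo 0 τ)) := by
    rw [eLpNorm_eq_lintegral_rpow_enorm_toReal (ofReal_ne_zero hp) ENNReal.ofReal_ne_top,
      eLpNorm_eq_lintegral_rpow_enorm_toReal (ofReal_ne_zero hp) ENNReal.ofReal_ne_top,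
      ENNReal.toReal_ofReal hp0.le, ← ENNReal.rpow_le_rpow_iff hp0,
      ENNReal.mul_rpow_of_nonneg _ _ hp0.le, ENNReal.mul_rpow_of_nonneg _ _ hp0.le,
      ← ENNReal.rpow_mul, ← ENNReal.rpow_mul, one_div_mul_cancel hp0.ne', ENNReal.rpow_one,
      ENNReal.rpow_one]
    have e1 : ∫⁻ s, h s ^ p = ∫⁻ s in Ioo 0 τ, ‖g s‖ₑ ^ p := by
      rw [← lintegral_indicator measurableSet_Ioo]
      refine lintegral_congr fun s => ?_
      by_cases hs : s ∈ Ioo 0 τ <;> simp [hh, hs, hp0]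
    rw [← e1]
    refine le_trans ?_ (mul_le_mul_right hY _)
    rw [← lintegral_const_mul' _ _ (ENNReal.rpow_ne_top_of_nonneg hp0.le ENNReal.ofReal_ne_top),
      ← lintegral_const_mul' _ _ (ENNReal.rpow_ne_top_of_nonneg hp0.le ENNReal.ofReal_ne_top)]
    refine (lintegral_mono_ae (h1.mono fun t ht => ?_)).trans (setLIntegral_le_lintegral _ _)
    rw [← ENNReal.mul_rpow_of_nonneg _ _ hp0.le, ← ENNReal.mul_rpow_of_nonneg _ _ hp0.le]
    exact ENNReal.rpow_le_rpow ht hp0.le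
  have h5 := ENNReal.toReal_mono (ENNReal.mul_ne_top ENNReal.ofReal_ne_top hg.2.ne) h4
  rwa [ENNReal.toReal_mul, ENNReal.toReal_mul, ENNReal.toReal_ofReal hl.le,
    ENNReal.toReal_ofReal hM] at h5

end Young

/-! ### Shifting the operator by a multiple of `ι`. -/

section ExponentialShift

variable {D X : Type*} [NormedAddCommGroup D] [NormedSpace ℝ D]
  [NormedAddCommGroup X] [NormedSpace ℝ X]
  {ι : D →L[ℝ] X} {p : ℝ} {J : Set ℝ} {α β : ℝ} {x y : X} {u v : ℝ → D} {du dv f g : ℝ → X}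
  {A A' : ℝ → D →L[ℝ] X} {T : D →L[ℝ] X}

theorem lpNormOn_comp_add_eq {Y : Type*} [NormedAddCommGroup Y] {f : ℝ → Y} (hp : 1 < p)
    (hf : MemLpOn p (Ioo α β) f) :
    lpNormOn p (Ioo 0 (β - α)) (fun s => f (α + s)) = lpNormOn p (Ioo α β) f := by
  have h1 := hf.comp_add hp (I := Ioo 0 (β - α)) (c := α)
    fun s hs => ⟨by linarith [hs.1], by linarith [hs.2]⟩
  have h2 := (h1.1.comp_add hp (I := Ioo α β) (c := -α)
    fun s hs => ⟨by linarith [hs.1], by linarith [hs.2]⟩).2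
  simp only [add_neg_cancel_left] at h2
  exact le_antisymm h1.2 h2

theorem hasDerivAt_exp_shift (l α s : ℝ) :
    HasDerivAt (fun t => Real.exp (l * (t - α))) (l * Real.exp (l * (s - α))) s := by
  have h := (((hasDerivAt_id s).sub_const α).const_mul l).exp
  simpa [mul_comm] using h

/-- The derivative of the weight absorbs `l ι`. The sign of `l` is free, so the same lemma serves
the shift and its removal. -/
theorem Sol.exp_smul [CompleteSpace X] (hp : 1 < p) (l : ℝ) (hu : Sol ι p (Ioo α β) α A x f u du)
    (hA : ∀ t, A t = A' t + l • ι) :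
    Sol ι p (Ioo α β) α A' x (fun t => Real.exp (l * (t - α)) • f t)
      (fun t => Real.exp (l * (t - α)) • u t)
      (fun t => (l * Real.exp (l * (t - α))) • ι (u t) + Real.exp (l * (t - α)) • du t) := by
  have h := hu.1.smul hp (hasDerivAt_exp_shift l α) (by fun_prop)
  rw [sub_self, mul_zero, Real.exp_zero, one_smul] at h
  refine ⟨h, ?_⟩
  filter_upwards [hu.2] with t ht
  rw [← ht, hA]
  simp only [map_smul, add_apply, smul_apply, smul_add,
    smul_smul, mul_comm l]
  abel

theorem memLpOn_exp_smul {Y : Type*} [NormedAddCommGroup Y] [NormedSpace ℝ Y] {f : ℝ → Y}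
    (l : ℝ) (hf : MemLpOn p (Ioo α β) f) :
    MemLpOn p (Ioo α β) (fun t => Real.exp (l * (t - α)) • f t) :=
  hf.continuous_smul (by fun_prop)

variable [CompleteSpace D] [CompleteSpace X]

/-- The `L^p` estimate for `λ (d/dt + T + λ)⁻¹`. -/
theorem Sol.mul_lpNormOn_le (hp : 1 < p) (hι : DenseRange ι) (hT : IsAutMaxReg ι p (Ioi 0) T)
    {l : ℝ} (hl : 0 < l) (h : α ≤ β) (hg : MemLpOn p (Ioo α β) g)
    (hu : Sol ι p (Ioo α β) α (fun _ => T + l • ι) 0 g u du) :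
    l * lpNormOn p (Ioo α β) (fun t => ι (u t)) ≤
      semigroupBound ι T * lpNormOn p (Ioo α β) g := by
  obtain ⟨K, hK⟩ := IsMaxReg.exists_autReg hp hT
  obtain ⟨S, hS⟩ := hK.exists_orbitFamily hp hι
  have hC : 0 ≤ K ^ 2 + 1 := by positivity
  rw [← lpNormOn_comp_add_eq hp hg, ← lpNormOn_comp_add_eq hp (hu.1.1.clm ι)]
  have hm : ∀ s ∈ Ioo 0 (β - α), α + s ∈ Ioo α β :=
    fun s hs => ⟨by linarith [hs.1], by linarith [hs.2]⟩
  have hg' := (hg.comp_add hp hm).1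
  have hu' := hu.comp_add hp (startsAt_Ioo _ _) (startsAt_Ioo 0 (β - α)) hm (by ring)
  -- The weight `e^{l t}` reduces the problem to `T`, where variation of constants applies; dividing
  -- by the weight again produces the kernel `e^{-l (t - s)}`.
  have hv := hu'.exp_smul hp l (A' := fun _ => T) (fun _ => rfl)
  have hd := hS.duhamel hp hK hι hC (sub_nonneg.2 h) (memLpOn_exp_smul l hg') hv
  refine lpNormOn_le_of_exp_convolution hp hl semigroupBound_nonneg hg' ?_
  filter_upwards [hd, ae_restrict_mem measurableSet_Ioo] with t ht ht'
  rw [map_smul] at ht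
  have e : ι (u (α + t)) = Real.exp (-(l * t)) • ∫ s in (0 : ℝ)..t,
      S (max (t - s) 0) (Real.exp (l * (s - 0)) • g (α + s)) := by
    rw [← ht, smul_smul, ← Real.exp_add]; simp
  rw [e, ← intervalIntegral.integral_smul, ← intervalIntegral.integral_const_mul]
  have hi : IntervalIntegrable (fun s => ‖g (α + s)‖) volume 0 t :=
    (hg'.intervalIntegrable hp ht'.1.le (Ioo_subset_Ioo_right ht'.2.le)).norm
  refine intervalIntegral.norm_integral_le_of_norm_le ht'.1.le (ae_of_all _ fun s _ => ?_)
    ((hi.continuousOn_mul (by fun_prop)).const_mul _)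
  rw [norm_smul, map_smul, norm_smul, Real.norm_eq_abs, Real.norm_eq_abs, Real.abs_exp,
    Real.abs_exp, ← mul_assoc, ← Real.exp_add, mul_left_comm]
  have := hS.norm_le_semigroupBound hp hK hι hC (le_max_right (t - s) 0) (g (α + s))
  have e2 : -(l * t) + l * (s - 0) = -(l * (t - s)) := by ring
  rw [e2]
  gcongr

omit [CompleteSpace D] in
theorem WP.exists_sol_shift (hp : 1 < p)
    (h : ∀ f : ℝ → X, MemLpOn p (Ioo α β) f → ∃ u du, Sol ι p (Ioo α β) α A 0 f u du) (l : ℝ)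
    (hA : ∀ t, A t = A' t + l • ι) (f : ℝ → X) (hf : MemLpOn p (Ioo α β) f) :
    ∃ u du, Sol ι p (Ioo α β) α A' 0 f u du := by
  obtain ⟨u, du, hu⟩ := h _ (memLpOn_exp_smul (-l) hf)
  refine ⟨_, _, (hu.exp_smul hp l hA).congr_rhs (ae_of_all _ fun t => ?_)⟩
  rw [smul_smul, ← Real.exp_add]; simp

/-- Moving `l ι u` to the right leaves `T` with source `f - l ι u`, and `‖l ι u‖_p ≤ M ‖f‖_p`. Hence
the factor `M + 1`, which does not depend on `l`. -/
theorem WP.shift {K : ℝ} (hp : 1 < p) (hι : DenseRange ι) (hT : IsAutMaxReg ι p (Ioi 0) T)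
    (h : α ≤ β) (hK : 0 ≤ K) (hwp : WP ι p α β (fun _ => T) K) {l : ℝ} (hl : 0 ≤ l) :
    WP ι p α β (fun _ => T + l • ι) (K * (semigroupBound ι T + 1)) := by
  refine ⟨WP.exists_sol_shift hp hwp.1 (-l) (fun t => by simp), fun f hf u du hu => ?_⟩
  have h1 : Sol ι p (Ioo α β) α (fun _ => T) 0 (fun t => f t - l • ι (u t)) u du := by
    refine ⟨hu.1, ?_⟩
    filter_upwards [hu.2] with t ht
    rw [← ht]
    simp only [add_apply, smul_apply]
    abel
  have hm : MemLpOn p (Ioo α β) (fun t => l • ι (u t)) := MemLp.const_smul (hu.1.1.clm ι) l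
  refine (hwp.2 _ (MemLp.sub hf hm) u du h1).trans ?_
  rw [mul_assoc]
  refine mul_le_mul_of_nonneg_left ((lpNormOn_sub_le hp hf hm).trans ?_) hK
  rw [lpNormOn_const_smul, abs_of_nonneg hl]
  have h2 : l * lpNormOn p (Ioo α β) (fun t => ι (u t)) ≤
      semigroupBound ι T * lpNormOn p (Ioo α β) f := by
    rcases hl.eq_or_lt with rfl | hl
    · rw [zero_mul]; exact mul_nonneg semigroupBound_nonneg lpNormOn_nonneg
    · exact hu.mul_lpNormOn_le hp hι hT hl h hf
  linarith

end ExponentialShift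

/-! ### Perturbation of a frozen operator and the constant `G`. -/

section Perturbation

variable {D X : Type*} [NormedAddCommGroup D] [NormedSpace ℝ D]
  [NormedAddCommGroup X] [NormedSpace ℝ X]
  {ι : D →L[ℝ] X} {p : ℝ} {α β : ℝ} {A A' : ℝ → D →L[ℝ] X} {T : D →L[ℝ] X}

/-- Relatively small perturbations preserve maximal regularity. -/
theorem WP.perturb [CompleteSpace X] (hp : 1 < p) {K θ : ℝ} (hK : 0 ≤ K) (hθ₀ : 0 ≤ θ)
    (hθ : θ < 1) (h : WP ι p α β A K)
    (hm : ∀ u, MemLpOn p (Ioo α β) u → MemLpOn p (Ioo α β) (fun t => A' t (u t) - A t (u t)))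
    (hb : ∀ g u du, MemLpOn p (Ioo α β) g → Sol ι p (Ioo α β) α A 0 g u du →
      lpNormOn p (Ioo α β) (fun t => A' t (u t) - A t (u t)) ≤ θ * lpNormOn p (Ioo α β) g) :
    WP ι p α β A' (K / (1 - θ)) := by
  have h1θ : 0 < 1 - θ := by linarith
  refine ⟨fun f hf => ?_, fun f hf u du hu => ?_⟩
  · have : Fact (1 ≤ ENNReal.ofReal p) := ⟨one_le_ofReal hp⟩
    let L := Lp X (ENNReal.ofReal p) (volume.restrict (Ioo α β))
    choose u du hu using fun g : L => h.1 (g : ℝ → X) (Lp.memLp g)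
    have hf' : ∀ g : L, MemLp (fun t => f t - (A' t (u g t) - A t (u g t))) (ENNReal.ofReal p)
        (volume.restrict (Ioo α β)) := fun g => MemLp.sub hf (hm _ (hu g).1.1)
    -- The unknown is the source `g`, with `u g` the solution for `A`: the equation for `A'` with
    -- source `f` says that `g` is a fixed point of `Φ`.
    let Φ : L → L := fun g => (hf' g).toLp _
    have hΦ : ContractingWith ⟨θ, hθ₀⟩ Φ := by
      refine ⟨by exact_mod_cast hθ, LipschitzWith.of_dist_le_mul fun g k => ?_⟩
      rw [dist_eq_norm, dist_eq_norm, ← MemLp.toLp_sub, Lp.norm_toLp, Lp.norm_def]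
      have h1 := (hu g).sub hp (startsAt_Ioo α β) (hu k)
      rw [sub_zero] at h1
      have hgk : MemLpOn p (Ioo α β) (fun t => g t - k t) := (Lp.memLp g).sub (Lp.memLp k)
      have h2 := hb _ _ _ hgk h1
      rw [← lpNormOn_neg] at h2
      have e1 : lpNormOn p (Ioo α β) (fun t => g t - k t) =
          (eLpNorm (g - k : L) (ENNReal.ofReal p) (volume.restrict (Ioo α β))).toReal := by
        unfold lpNormOn
        exact congrArg _ (eLpNorm_congr_ae (Lp.coeFn_sub g k).symm)
      rw [e1] at h2
      refine le_trans (le_of_eq ?_) h2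
      unfold lpNormOn
      congr 2
      ext t
      simp only [Pi.sub_apply, map_sub]
      abel
    obtain ⟨g, hg⟩ : ∃ g, Φ g = g := ⟨_, hΦ.fixedPoint_isFixedPt⟩
    refine ⟨u g, du g, (hu g).1, ?_⟩
    have h3 : (g : ℝ → X) =ᵐ[volume.restrict (Ioo α β)]
        fun t => f t - (A' t (u g t) - A t (u g t)) := by
      conv_lhs => rw [← hg]
      exact MemLp.coeFn_toLp (hf' g)
    filter_upwards [(hu g).2, h3] with t h4 h5
    rw [h5] at h4
    rw [eq_sub_iff_add_eq] at h4
    rw [← h4]; abel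
  -- With respect to `A` the source of `u` is `f - (A' - A) u`; its norm `G` satisfies `G ≤ ‖f‖ + θ
  -- G`.
  · have hB := hm u hu.1.1
    have h1 : Sol ι p (Ioo α β) α A 0 (fun t => f t - (A' t (u t) - A t (u t))) u du :=
      ⟨hu.1, by filter_upwards [hu.2] with t ht; rw [← ht]; abel⟩
    have hg : MemLpOn p (Ioo α β) (fun t => f t - (A' t (u t) - A t (u t))) := MemLp.sub hf hB
    have h2 := hb _ _ _ hg h1
    have h3 := lpNormOn_sub_le hp hf hB
    refine (h.2 _ hg u du h1).trans ?_
    rw [div_mul_eq_mul_div, le_div_iff₀ h1θ, mul_assoc]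
    refine mul_le_mul_of_nonneg_left ?_ hK
    nlinarith

/-- Convexity of the power at `x + z = m (x/m) + (1 - m) (z/(1 - m))`. -/
theorem add_rpow_le_weighted {p x z m : ℝ} (hp : 1 < p) (hx : 0 ≤ x) (hz : 0 ≤ z)
    (hm : m ∈ Ioo (0 : ℝ) 1) :
    (x + z) ^ p ≤ m ^ (1 - p) * x ^ p + (1 - m) ^ (1 - p) * z ^ p := by
  have hm0 := hm.1
  have hm1 : 0 < 1 - m := by linarith [hm.2]
  have h := (convexOn_rpow hp.le).2 (div_nonneg hx hm0.le) (div_nonneg hz hm1.le) hm0.le hm1.le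
    (by ring)
  simp only [smul_eq_mul] at h
  have e : ∀ {c y : ℝ}, 0 < c → 0 ≤ y → c * (y / c) ^ p = c ^ (1 - p) * y ^ p := by
    intro c y hc hy
    rw [Real.div_rpow hy hc.le, Real.rpow_sub hc, Real.rpow_one]; ring
  rw [mul_div_cancel₀ _ hm0.ne', mul_div_cancel₀ _ hm1.ne', e hm0 hx, e hm1 hz] at h
  exact h

theorem cp_nonneg {p ν : ℝ} (hp : 1 < p) : 0 ≤ cp p ν := by
  have h0 : 0 ≤ p := by linarith
  unfold cp kappa
  rw [add_sub_cancel]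
  refine mul_nonneg (Real.rpow_nonneg (Real.iInf_nonneg fun m => le_max_of_le_left ?_) _)
    (Real.rpow_nonneg ?_ _)
  · have := m.2.1
    have : 0 ≤ (m : ℝ) ^ (1 - p) * |ν| ^ p := by positivity
    linarith
  · have h1 : 1 ≤ Real.exp (p * max (-ν) 0) := Real.one_le_exp (by positivity)
    have h2 : Real.exp (-(p * max ν 0)) ≤ 1 := Real.exp_le_one_iff.2 (by
      have : 0 ≤ p * max ν 0 := by positivity
      linarith)
    linarith

/-- This is the cost of removing a shift: the weight contributes `e^ν`, and its derivative adds `ν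
x` to `z`. The infimum in `cp` comes from the free parameter `m` in the weighted convexity bound for
`(ν x + z)^p`. At the nonpositive argument `-ν` the exponential factor of `cp` is just `e^ν`. -/
theorem tripleNorm_le_cp {p x y z x' y' z' ν : ℝ} (hp : 1 < p) (hν : 0 ≤ ν) (hx : 0 ≤ x)
    (hy : 0 ≤ y) (hz : 0 ≤ z) (hx' : 0 ≤ x') (hy' : 0 ≤ y') (hz' : 0 ≤ z')
    (h1 : x' ≤ Real.exp ν * x) (h2 : y' ≤ Real.exp ν * y)
    (h3 : z' ≤ Real.exp ν * (ν * x + z)) :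
    tripleNorm p x' y' z' ≤ cp p (-ν) * tripleNorm p x y z := by
  have hp0 : 0 < p := by linarith
  have hN := tripleNorm_nonneg (p := p) hx hy hz
  have key : tripleNorm p x' y' z' ≤ Real.exp ν * tripleNorm p x y (ν * x + z) := by
    rw [← tripleNorm_mul hp hx hy (by positivity) (Real.exp_pos ν).le]
    exact tripleNorm_mono hp hx' hy' hz' h1 h2 h3
  set I := ⨅ μ : Ioo (0 : ℝ) 1,
    max (1 + (μ : ℝ) ^ (1 - p) * |-ν| ^ p) ((1 - (μ : ℝ)) ^ (1 - p)) with hI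
  have hI0 : 0 ≤ I := Real.iInf_nonneg fun m => le_max_of_le_left (by
    have := m.2.1
    positivity)
  have hcp : cp p (-ν) = I ^ (1 / p) * Real.exp ν := by
    unfold cp kappa
    rw [add_sub_cancel, neg_neg, max_eq_left hν, max_eq_right (by linarith : -ν ≤ 0), mul_zero,
      neg_zero, Real.exp_zero, add_sub_cancel_left, ← Real.exp_mul, mul_comm p ν, mul_assoc,
      mul_one_div_cancel hp0.ne', mul_one]
  rw [hcp, mul_comm (I ^ (1 / p)), mul_assoc]
  refine key.trans (mul_le_mul_of_nonneg_left ?_ (Real.exp_pos ν).le)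
  have hmN : ∀ m ∈ Ioo (0 : ℝ) 1, x ^ p + y ^ p + (ν * x + z) ^ p ≤
      max (1 + m ^ (1 - p) * |-ν| ^ p) ((1 - m) ^ (1 - p)) * (x ^ p + y ^ p + z ^ p) := by
    intro m hm
    have h4 := add_rpow_le_weighted hp (mul_nonneg hν hx) hz hm
    rw [Real.mul_rpow hν hx] at h4
    rw [abs_neg, abs_of_nonneg hν]
    set c := max (1 + m ^ (1 - p) * ν ^ p) ((1 - m) ^ (1 - p))
    have c1 : 1 + m ^ (1 - p) * ν ^ p ≤ c := le_max_left _ _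
    have c2 : (1 - m) ^ (1 - p) ≤ c := le_max_right _ _
    have hm0 := hm.1
    have c3 : 1 ≤ c := le_trans (by
      have : 0 ≤ m ^ (1 - p) * ν ^ p := by positivity
      linarith) c1
    have hxp := Real.rpow_nonneg hx p
    have hyp := Real.rpow_nonneg hy p
    have hzp := Real.rpow_nonneg hz p
    nlinarith [mul_le_mul_of_nonneg_right c1 hxp, mul_le_mul_of_nonneg_right c2 hzp,
      mul_le_mul_of_nonneg_right c3 hyp]
  rw [tripleNorm_le_iff hp hx hy (by positivity) (by positivity),
    Real.mul_rpow (by positivity) hN, ← Real.rpow_mul hI0, one_div_mul_cancel hp0.ne',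
    Real.rpow_one, tripleNorm_rpow hp hx hy hz]
  have hS : 0 ≤ x ^ p + y ^ p + z ^ p := by positivity
  have : Nonempty (Ioo (0 : ℝ) 1) := ⟨⟨1 / 2, by norm_num, by norm_num⟩⟩
  rw [hI, Real.iInf_mul_of_nonneg hS]
  exact le_ciInf fun m => hmN m m.2

theorem norm_le_exp_mul {Y : Type*} [NormedAddCommGroup Y] [NormedSpace ℝ Y] {l t : ℝ} (hl : 0 ≤ l)
    (ht : t ∈ Ioo α β) (y : Y) :
    ‖y‖ ≤ Real.exp (l * (β - α)) * ‖Real.exp (-l * (t - α)) • y‖ := by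
  rw [norm_smul, Real.norm_eq_abs, Real.abs_exp, ← mul_assoc, ← Real.exp_add]
  refine le_mul_of_one_le_left (norm_nonneg y) (Real.one_le_exp ?_)
  nlinarith [ht.2]

/-- As `l ≥ 0`, the weight `e^{-l (t - α)}` does not enlarge the source; the whole cost lies in
recovering `u` from the weighted solution. -/
theorem WP.unshift [CompleteSpace X] (hp : 1 < p) (h : α ≤ β) {K l : ℝ}
    (hl : 0 ≤ l) (hK : 0 ≤ K) (hA : ∀ t, A t = A' t + l • ι) (hwp : WP ι p α β A K) :
    WP ι p α β A' (cp p (-(l * (β - α))) * K) := by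
  have hτ : 0 ≤ β - α := by linarith
  refine ⟨WP.exists_sol_shift hp hwp.1 l hA, fun f hf u du hu => ?_⟩
  have hv := hu.exp_smul hp (-l) (A' := A) (fun t => by rw [hA]; simp)
  have h1 := hwp.2 _ (memLpOn_exp_smul (-l) hf) _ _ hv
  have h2 : lpNormOn p (Ioo α β) (fun t => Real.exp (-l * (t - α)) • f t) ≤
      1 * lpNormOn p (Ioo α β) f := by
    refine lpNormOn_le_mul hf zero_le_one ?_
    filter_upwards [ae_restrict_mem measurableSet_Ioo] with t ht
    rw [norm_smul, Real.norm_eq_abs, Real.abs_exp]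
    have : Real.exp (-l * (t - α)) ≤ 1 := Real.exp_le_one_iff.2 (by nlinarith [ht.1])
    gcongr
  rw [one_mul] at h2
  refine le_trans ?_ (b := cp p (-(l * (β - α))) * mrNorm ι p (Ioo α β)
    (fun t => Real.exp (-l * (t - α)) • u t) (fun t => (-l * Real.exp (-l * (t - α))) • ι (u t) +
      Real.exp (-l * (t - α)) • du t)) (by
    rw [mul_assoc]
    exact mul_le_mul_of_nonneg_left (h1.trans (mul_le_mul_of_nonneg_left h2 hK)) (cp_nonneg hp))
  rw [mrNorm_eq, mrNorm_eq, timeScale_Ioo h]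
  have hE := Real.exp_pos (l * (β - α))
  have hsm : MemLpOn p (Ioo α β) (fun t => l • ι (Real.exp (-l * (t - α)) • u t)) :=
    MemLp.const_smul (hv.1.1.clm ι) l
  have hdv : MemLpOn p (Ioo α β) (fun t => l • ι (Real.exp (-l * (t - α)) • u t) +
      ((-l * Real.exp (-l * (t - α))) • ι (u t) + Real.exp (-l * (t - α)) • du t)) :=
    MemLp.add hsm hv.1.2
  refine tripleNorm_le_cp hp (mul_nonneg hl hτ) lpNormOn_nonneg lpNormOn_nonneg
    (mul_nonneg hτ lpNormOn_nonneg) lpNormOn_nonneg lpNormOn_nonneg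
    (mul_nonneg hτ lpNormOn_nonneg) ?_ ?_ ?_
  · refine lpNormOn_le_mul (hv.1.1.clm ι) hE.le ?_
    filter_upwards [ae_restrict_mem measurableSet_Ioo] with t ht
    rw [map_smul]; exact norm_le_exp_mul hl ht _
  · refine lpNormOn_le_mul hv.1.1 hE.le ?_
    filter_upwards [ae_restrict_mem measurableSet_Ioo] with t ht using norm_le_exp_mul hl ht _
  · have h3 := lpNormOn_le_mul (f := du) hdv hE.le (by
      filter_upwards [ae_restrict_mem measurableSet_Ioo] with t ht
      refine (norm_le_exp_mul hl ht (du t)).trans (le_of_eq ?_)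
      congr 2
      rw [map_smul, smul_smul, ← add_assoc, ← add_smul]
      simp)
    have h4 := lpNormOn_add_le hp hsm hv.1.2
    rw [lpNormOn_const_smul, abs_of_nonneg hl] at h4
    calc _ ≤ (β - α) * (Real.exp (l * (β - α)) * _) := mul_le_mul_of_nonneg_left
          (h3.trans (mul_le_mul_of_nonneg_left h4 hE.le)) hτ
      _ = _ := by ring

theorem lpNormOn_norm {Y : Type*} [NormedAddCommGroup Y] {J : Set ℝ} {f : ℝ → Y} :
    lpNormOn p J (fun t => ‖f t‖) = lpNormOn p J f :=
  congrArg ENNReal.toReal (eLpNorm_norm f)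

/-- `μ ‖ι u‖_p ≤ ‖g‖_p / 4` for the problem shifted by `4 M μ`. -/
theorem Sol.lpNormOn_ι_le_quarter [CompleteSpace D] [CompleteSpace X] (hp : 1 < p)
    (hι : DenseRange ι) (hT : IsAutMaxReg ι p (Ioi 0) T) (h : α ≤ β) {μ : ℝ} (hμ : 0 ≤ μ)
    {g : ℝ → X} {u : ℝ → D} {du : ℝ → X} (hg : MemLpOn p (Ioo α β) g)
    (hu : Sol ι p (Ioo α β) α (fun _ => T + (4 * semigroupBound ι T * μ) • ι) 0 g u du) :
    μ * lpNormOn p (Ioo α β) (fun t => ι (u t)) ≤ 1 / 4 * lpNormOn p (Ioo α β) g := by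
  have hg0 : 0 ≤ lpNormOn p (Ioo α β) g := lpNormOn_nonneg
  rcases hμ.eq_or_lt with rfl | hμ
  · linarith
  -- If `M = 0` there is no shift to help, but then the identity `S 0` is zero and all norms in `X`
  -- vanish.
  rcases (semigroupBound_nonneg (ι := ι) (T := T)).eq_or_lt with h0 | h0
  · obtain ⟨K, hK⟩ := IsMaxReg.exists_autReg hp hT
    obtain ⟨S, hS⟩ := hK.exists_orbitFamily hp hι
    have : lpNormOn p (Ioo α β) (fun t => ι (u t)) = 0 := by
      rw [← lpNormOn_norm]
      simp only [hS.norm_eq_zero hp hK hι (by positivity) h0.symm]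
      exact lpNormOn_zero
    rw [this]; linarith
  · have := hu.mul_lpNormOn_le hp hι hT (by positivity) h hg
    rw [mul_assoc, mul_comm 4, mul_assoc, mul_le_mul_iff_right₀ h0] at this
    linarith

theorem lpNormOn_le_add_mul {Y Z W : Type*} [NormedAddCommGroup Y] [NormedAddCommGroup Z]
    [NormedAddCommGroup W] {J : Set ℝ} {f : ℝ → Y} {g : ℝ → Z} {k : ℝ → W} (hp : 1 < p)
    (hg : MemLpOn p J g) (hk : MemLpOn p J k) {c d : ℝ} (hc : 0 ≤ c) (hd : 0 ≤ d)
    (h : ∀ᵐ t ∂(volume.restrict J), ‖f t‖ ≤ c * ‖g t‖ + d * ‖k t‖) :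
    lpNormOn p J f ≤ c * lpNormOn p J g + d * lpNormOn p J k := by
  have h1 : MemLpOn p J (fun t => c • ‖g t‖) := (MemLp.norm hg).const_smul c
  have h2 : MemLpOn p J (fun t => d • ‖k t‖) := (MemLp.norm hk).const_smul d
  have h3 := lpNormOn_add_le hp h1 h2
  have h4 : MemLpOn p J (fun t => c • ‖g t‖ + d • ‖k t‖) := MemLp.add h1 h2
  have e1 : lpNormOn p J (fun t => c • ‖g t‖) = c * lpNormOn p J g := by
    rw [lpNormOn_const_smul, lpNormOn_norm, abs_of_nonneg hc]
  have e2 : lpNormOn p J (fun t => d • ‖k t‖) = d * lpNormOn p J k := by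
    rw [lpNormOn_const_smul, lpNormOn_norm, abs_of_nonneg hd]
  rw [e1, e2] at h3
  have h5 := lpNormOn_le_mul h4 zero_le_one (f := f) (h.mono fun t ht => by
    rw [one_mul, smul_eq_mul, smul_eq_mul]
    exact ht.trans (Real.le_norm_self _))
  rw [one_mul] at h5
  exact h5.trans h3

/-- Maximal regularity on a cell on which `A` is close to `T`. -/
theorem WP.of_close [CompleteSpace D] [CompleteSpace X] (hp : 1 < p) (hι : DenseRange ι)
    (hT : IsAutMaxReg ι p (Ioi 0) T) (h : α ≤ β) {K μ : ℝ} (hK : 0 ≤ K) (hμ : 0 ≤ μ)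
    (hwp : WP ι p α β (fun _ => T) K)
    (hm : ∀ x, AEStronglyMeasurable (fun t => A t x) (volume.restrict (Ioo α β)))
    (hb : ∀ t ∈ Ioo α β, ∀ x, ‖A t x - T x‖ ≤
      1 / (2 * (K + 1) * (semigroupBound ι T + 1)) * ‖x‖ + μ * ‖ι x‖) :
    WP ι p α β A (G p (β - α) μ (semigroupBound ι T) K) := by
  set M := semigroupBound ι T with hM
  have hM0 : 0 ≤ M := semigroupBound_nonneg
  set ε := 1 / (2 * (K + 1) * (M + 1)) with hε
  have hε0 : 0 ≤ ε := by positivity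
  -- With this shift `μ ‖ι u‖ ≤ ‖g‖ / 4`, while `ε K (M + 1) ≤ 1/2`. So the perturbation has
  -- relative size `3/4`, and `1 / (1 - 3/4)` is the factor `4` in `G`.
  set l := 4 * M * μ with hl
  have hl0 : 0 ≤ l := by positivity
  have hdiff : ∀ (t : ℝ) (x : D), (A t + l • ι) x - (T + l • ι) x = A t x - T x := by
    intro t x
    simp
  have h1 : WP ι p α β (fun t => A t + l • ι) (K * (M + 1) / (1 - 3 / 4)) := by
    refine (hwp.shift hp hι hT h hK hl0).perturb hp (by positivity) (by norm_num) (by norm_num)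
      (fun u hu => ?_) (fun g u du hg hu => ?_)
    · simp only [hdiff]
      refine MemLpOn.of_le_mul (c := ε + μ * ‖ι‖) hu
        ((aestronglyMeasurable_clm_apply hm hu.1).sub (hu.clm T).1) ?_
      filter_upwards [ae_restrict_mem measurableSet_Ioo] with t ht
      refine (hb t ht _).trans ?_
      rw [add_mul, mul_assoc]
      have := ι.le_opNorm (u t)
      gcongr
    · simp only [hdiff]
      have h2 := lpNormOn_le_add_mul (f := fun t => A t (u t) - T (u t)) hp hu.1.1
        (hu.1.1.clm ι) hε0 hμ (by
          filter_upwards [ae_restrict_mem measurableSet_Ioo] with t ht using hb t ht _)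
      have h3 := hu.lpNormOn_ι_le_quarter hp hι hT h hμ hg
      have h4 := (lpNormOn_le_mrNorm hp).trans ((hwp.shift hp hι hT h hK hl0).2 g hg u du hu)
      have hg0 : 0 ≤ lpNormOn p (Ioo α β) g := lpNormOn_nonneg
      have h5 : ε * (K * (M + 1)) ≤ 1 / 2 := by
        rw [hε, div_mul_eq_mul_div, div_le_div_iff₀ (by positivity) (by norm_num)]
        nlinarith
      have h6 := mul_le_mul_of_nonneg_left h4 hε0
      rw [← hM, ← mul_assoc] at h6
      have h7 := mul_le_mul_of_nonneg_right h5 hg0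
      linarith
  have h2 := h1.unshift hp h hl0 (by
    have : (0 : ℝ) ≤ 1 - 3 / 4 := by norm_num
    positivity) (fun t => rfl)
  refine h2.mono (le_of_eq ?_)
  have e : l * (β - α) = 4 * M * (β - α) * μ := by rw [hl]; ring
  rw [G, e]; ring

end Perturbation

/-! ### The constant `Q` as a value at the best reflection speed. -/

section Constants

theorem one_div_conjExponent {p : ℝ} (hp : 1 < p) : 1 / Real.conjExponent p = 1 - 1 / p := by
  have : p ≠ 0 := by linarith
  rw [Real.conjExponent, one_div_div, sub_div, div_self this]

/-- `Q p T C g` is obtained by optimizing the speed `r` of the reflection. -/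
theorem exists_le_Q {p T C g : ℝ} (hp : 1 < p) (hT : 0 < T) (hC : 0 ≤ C) (hg : 0 ≤ g) :
    ∃ r, 0 < r ∧ r ≤ 1 ∧
      r⁻¹ ^ (1 / p) * (1 + 2 ^ (1 - 1 / p) * max (C * g) (r * (g / T))) ≤ Q p T C g := by
  have hp0 : 0 < p := by linarith
  have hp1 : 0 < p - 1 := by linarith
  have h2q : (0 : ℝ) < 2 ^ (1 - 1 / p) := by positivity
  have hw : 0 < (2 : ℝ) ^ (1 - 1 / p) * (p - 1) := by positivity
  have hgT : 0 ≤ g / T := by positivity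
  unfold Q
  simp only [one_div_conjExponent hp]
  split_ifs with h1 h2
  -- Here the stationary point `1 / (w g / T)` is at least one, beyond the admissible speeds, so the
  -- largest speed is taken.
  · exact ⟨1, one_pos, le_rfl, by simp⟩
  · push Not at h1
    have hgT' : 0 < g / T := by
      by_contra h
      have : g / T = 0 := le_antisymm (not_lt.1 h) hgT
      rw [this] at h1; linarith
    set w := (2 : ℝ) ^ (1 - 1 / p) * (p - 1) with hwdef
    -- The stationary point of `r^(-1/p) (1 + 2^(1/q) r g / T)`. The case condition says that it is
    -- at least `C T`, so the maximum is attained by its second entry.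
    refine ⟨(w * (g / T))⁻¹, by positivity, inv_le_one_of_one_le₀ h1.le, le_of_eq ?_⟩
    have e1 : (w * (g / T))⁻¹ * (g / T) = w⁻¹ := by
      rw [mul_inv, mul_assoc, inv_mul_cancel₀ hgT'.ne', mul_one]
    have e2 : C * g ≤ w⁻¹ := by
      rw [← one_div, le_div_iff₀ hw]
      have : w * (g / T) * (C * T) = C * g * w := by field_simp
      linarith
    have e3 : 1 / (p * Real.conjExponent p) = (1 - 1 / p) * (1 / p) := by
      rw [← one_div_conjExponent hp]; ring
    have e4 : 1 + (2 : ℝ) ^ (1 - 1 / p) * w⁻¹ = p / (p - 1) := by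
      rw [hwdef, mul_inv, ← mul_assoc, mul_inv_cancel₀ h2q.ne', one_mul]
      field_simp
      ring
    have e5 : (p - 1) ^ (1 - 1 / p) * (p - 1) ^ (1 / p) = p - 1 := by
      rw [← Real.rpow_add hp1]; simp
    have hq : (p - 1) ^ (1 - 1 / p) ≠ 0 := by positivity
    rw [e1, max_eq_right e2, inv_inv, Real.mul_rpow hw.le hgT, hwdef,
      Real.mul_rpow h2q.le hp1.le, ← Real.rpow_mul (by norm_num), ← hwdef, e4, e3]
    rw [show p / (p - 1) = p / ((p - 1) ^ (1 - 1 / p) * (p - 1) ^ (1 / p)) by rw [e5]]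
    have hq' : (p - 1) ^ (1 / p) ≠ 0 := by positivity
    field_simp
  · push Not at h1 h2
    have hC' : 0 < C := by
      by_contra h
      have : C = 0 := le_antisymm (not_lt.1 h) hC
      rw [this] at h2; norm_num at h2
    have hCT : 0 < C * T := by positivity
    -- For `r ≤ C T` the maximum is `C g` and the expression decreases in `r`, so the largest such
    -- `r ≤ 1` is taken.
    refine ⟨min (C * T) 1, by positivity, min_le_right _ _, ?_⟩
    have e1 : (min (C * T) 1)⁻¹ = max (1 / (C * T)) 1 := by
      rcases le_total (C * T) 1 with h | h
      · rw [min_eq_left h, one_div, max_eq_left (one_le_inv_iff₀.2 ⟨hCT, h⟩)]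
      · rw [min_eq_right h, one_div, max_eq_right (inv_le_one_of_one_le₀ h), inv_one]
    have e2 : min (C * T) 1 * (g / T) ≤ C * g := by
      calc _ ≤ C * T * (g / T) := mul_le_mul_of_nonneg_right (min_le_left _ _) hgT
        _ = C * g := by field_simp
    rw [e1, max_eq_left e2]

theorem Q_nonneg {p T C g : ℝ} (hp : 1 < p) (hT : 0 < T) (hC : 0 ≤ C) (hg : 0 ≤ g) :
    0 ≤ Q p T C g := by
  obtain ⟨r, hr, -, h⟩ := exists_le_Q hp hT hC hg
  refine le_trans ?_ h
  have : 0 ≤ max (C * g) (r * (g / T)) := le_max_of_le_left (by positivity)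
  positivity

end Constants

/-! ### Gluing two adjacent intervals. -/

section Gluing

variable {D X : Type*} [NormedAddCommGroup D] [NormedSpace ℝ D]
  [NormedAddCommGroup X] [NormedSpace ℝ X]
  {ι : D →L[ℝ] X} {p : ℝ} {a c d : ℝ} {A : ℝ → D →L[ℝ] X} {K g C : ℝ} {f : ℝ → X}

/-- A function on `(a, c)` is continued to `(c, d)` by a solution of the homogeneous equation. -/
theorem WP.exists_null_extension (hp : 1 < p) (hac : a < c) (hcd : c < d) (hg : 0 ≤ g)
    (h : WP ι p c d A g)
    (hm : ∀ x, AEStronglyMeasurable (fun t => A t x) (volume.restrict (Ioo c d)))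
    (hC0 : 0 ≤ C) (hC : ∀ᵐ t ∂(volume.restrict (Ioo c d)), ∀ x, ‖A t x‖ ≤ C * ‖x‖)
    {u : ℝ → D} {du : ℝ → X} (hu : Sob ι p (Ioo a c) a 0 u du) {r : ℝ} (hr : 0 < r) (hr1 : r ≤ 1) :
    ∃ v dv, Sol ι p (Ioo c d) c A (∫ s in a..c, du s) (fun _ => 0) v dv ∧
      mrNorm ι p (Ioo c d) v dv ≤ ((d - c) / (c - a)) ^ (1 / p) * (r⁻¹ ^ (1 / p) *
        (1 + 2 ^ (1 - 1 / p) * max (C * g) (r * (g / (d - c))))) * mrNorm ι p (Ioo a c) u du := by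
  have hσ : 0 < c - a := by linarith
  have hT : 0 < d - c := by linarith
  -- The reflection `s ↦ c - k (s - c)` sends `(c, d)` onto `(c - r (c - a), c)`, which lies in `(a,
  -- c)` because `r ≤ 1`.
  set k := r * ((c - a) / (d - c)) with hk
  have hk0 : 0 < k := by positivity
  have hkT : k * (d - c) = r * (c - a) := by rw [hk]; field_simp
  have hmem : ∀ s ∈ Ioo c d, (c + k * c) + -k * s ∈ Ioo a c := by
    intro s hs
    constructor
    · have : k * (s - c) < k * (d - c) := mul_lt_mul_of_pos_left (by linarith [hs.2]) hk0
      nlinarith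
    · have := mul_pos hk0 (sub_pos.2 hs.1)
      linarith
  have hkk : |-k|⁻¹ = (d - c) / (c - a) * r⁻¹ := by
    rw [abs_neg, abs_of_pos hk0, hk]; field_simp
  have ec : (c + k * c) + -k * c = c := by ring
  have hz := hu.comp_affine hp (startsAt_Ioo a c) (startsAt_Ioo c d) (neg_ne_zero.2 hk0.ne') hmem
    (by rw [ec]; exact hu.2.intervalIntegrable hp hac.le le_rfl)
  rw [ec, zero_add] at hz
  set z : ℝ → D := fun s => u ((c + k * c) + -k * s) with hzdef
  set dz : ℝ → X := fun s => -k • du ((c + k * c) + -k * s) with hdzdef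
  set Λ := ((d - c) / (c - a) * r⁻¹) ^ (1 / p) with hΛ
  have hΛ0 : 0 ≤ Λ := by positivity
  have n1 : lpNormOn p (Ioo c d) z ≤ Λ * lpNormOn p (Ioo a c) u := by
    have := (hu.1.comp_affine hp (neg_ne_zero.2 hk0.ne') hmem).2
    rwa [hkk] at this
  have n2 : lpNormOn p (Ioo c d) (fun s => ι (z s)) ≤
      Λ * lpNormOn p (Ioo a c) (fun s => ι (u s)) := by
    have := ((hu.1.clm ι).comp_affine hp (neg_ne_zero.2 hk0.ne') hmem).2
    rwa [hkk] at this
  have n3 : lpNormOn p (Ioo c d) dz ≤ k * (Λ * lpNormOn p (Ioo a c) du) := by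
    have := (hu.2.comp_affine hp (neg_ne_zero.2 hk0.ne') hmem).2
    rw [hkk] at this
    rw [hdzdef, lpNormOn_const_smul, abs_neg, abs_of_pos hk0]
    exact mul_le_mul_of_nonneg_left this hk0.le
  have x1 : 0 ≤ lpNormOn p (Ioo a c) (fun s => ι (u s)) := lpNormOn_nonneg
  have x2 : 0 ≤ lpNormOn p (Ioo a c) u := lpNormOn_nonneg
  have x3 : 0 ≤ lpNormOn p (Ioo a c) du := lpNormOn_nonneg
  have hmz : mrNorm ι p (Ioo c d) z dz ≤ Λ * mrNorm ι p (Ioo a c) u du := by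
    rw [mrNorm_eq, mrNorm_eq, timeScale_Ioo hac.le, timeScale_Ioo hcd.le,
      ← tripleNorm_mul hp x1 x2 (by positivity) hΛ0]
    refine tripleNorm_mono hp lpNormOn_nonneg lpNormOn_nonneg (mul_nonneg hT.le lpNormOn_nonneg)
      n2 n1 ?_
    calc _ ≤ (d - c) * (k * (Λ * lpNormOn p (Ioo a c) du)) := mul_le_mul_of_nonneg_left n3 hT.le
      _ = r * (Λ * ((c - a) * lpNormOn p (Ioo a c) du)) := by
          linear_combination (Λ * lpNormOn p (Ioo a c) du) * hkT
      _ ≤ _ := mul_le_of_le_one_left (by positivity) hr1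
  have hAz := memLpOn_clm_apply hm hC hz.1
  have hF : MemLpOn p (Ioo c d) (fun t => dz t + A t (z t)) := MemLp.add hz.2 hAz
  have nF : lpNormOn p (Ioo c d) (fun t => dz t + A t (z t)) ≤
      max C (r / (d - c)) * (2 ^ (1 - 1 / p) * (Λ * mrNorm ι p (Ioo a c) u du)) := by
    have h1 : lpNormOn p (Ioo c d) (fun t => A t (z t)) ≤ C * lpNormOn p (Ioo c d) z :=
      lpNormOn_le_mul hz.1 hC0 (hC.mono fun t ht => ht _)
    have h2 := add_le_two_rpow_mul_tripleNorm hp x1 x2 (mul_nonneg hσ.le x3)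
    rw [mrNorm_eq, timeScale_Ioo hac.le]
    set m := max C (r / (d - c))
    have m1 : C ≤ m := le_max_left _ _
    have m2 : r / (d - c) ≤ m := le_max_right _ _
    have hm0 : 0 ≤ m := hC0.trans m1
    calc _ ≤ k * (Λ * lpNormOn p (Ioo a c) du) + C * (Λ * lpNormOn p (Ioo a c) u) :=
          (lpNormOn_add_le hp hz.2 hAz).trans
            (add_le_add n3 (h1.trans (mul_le_mul_of_nonneg_left n1 hC0)))
      _ = r / (d - c) * (Λ * ((c - a) * lpNormOn p (Ioo a c) du)) +
          C * (Λ * lpNormOn p (Ioo a c) u) := by rw [hk]; ring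
      _ ≤ m * (Λ * ((c - a) * lpNormOn p (Ioo a c) du)) + m * (Λ * lpNormOn p (Ioo a c) u) := by
          gcongr
      _ = m * (Λ * (lpNormOn p (Ioo a c) u + (c - a) * lpNormOn p (Ioo a c) du)) := by ring
      _ ≤ m * (Λ * (2 ^ (1 - 1 / p) * _)) := by gcongr
      _ = _ := by ring
  -- The reflection `z` has the right trace at `c` but the source `z' + A z`; subtracting the
  -- solution `y` with this source and zero initial value makes the equation homogeneous.
  obtain ⟨y, dy, hy⟩ := h.1 _ hF
  have ny := h.2 _ hF y dy hy
  have hzS : Sol ι p (Ioo c d) c A (∫ s in a..c, du s) (fun t => dz t + A t (z t)) z dz :=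
    ⟨hz, ae_of_all _ fun _ => rfl⟩
  have hv := hzS.sub hp (startsAt_Ioo c d) hy
  rw [sub_zero] at hv
  refine ⟨_, _, hv.congr_rhs (by simp), ?_⟩
  have hy' := hy.const_smul (-1)
  have h3 := mrNorm_add_le (ι := ι) hp hz.1 hz.2 hy'.1.1 hy'.1.2
  have e4 : mrNorm ι p (Ioo c d) (fun t => (-1 : ℝ) • y t) (fun t => (-1 : ℝ) • dy t) =
      mrNorm ι p (Ioo c d) y dy := by
    simp only [mrNorm_eq, map_smul, lpNormOn_const_smul, abs_neg, abs_one, one_mul]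
  rw [e4] at h3
  simp only [neg_smul, one_smul, ← sub_eq_add_neg] at h3
  refine h3.trans ?_
  have e5 : max (C * g) (r * (g / (d - c))) = g * max C (r / (d - c)) := by
    rw [mul_max_of_nonneg _ _ hg]
    congr 1 <;> ring
  have e6 : ((d - c) / (c - a)) ^ (1 / p) * r⁻¹ ^ (1 / p) = Λ := by
    rw [hΛ, Real.mul_rpow (by positivity) (by positivity)]
  rw [e5, ← mul_assoc (((d - c) / (c - a)) ^ (1 / p)), e6]
  calc _ ≤ Λ * mrNorm ι p (Ioo a c) u du +
        g * (max C (r / (d - c)) * (2 ^ (1 - 1 / p) * (Λ * mrNorm ι p (Ioo a c) u du))) :=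
        add_le_add hmz (ny.trans (mul_le_mul_of_nonneg_left nF hg))
    _ = _ := by ring

/-- The derivative is weighted by the length of the interval, so passing to the longer interval
costs the ratio of the lengths; apart from this the `p`-th powers of the pieces add. -/
theorem mrNorm_le_of_split (hp : 1 < p) (hac : a < c) (hcd : c < d) {u : ℝ → D} {du : ℝ → X}
    (hu : MemLpOn p (Ioo a d) u) (hdu : MemLpOn p (Ioo a d) du) :
    mrNorm ι p (Ioo a d) u du ≤ (d - a) / (c - a) * mrNorm ι p (Ioo a c) u du +
      (d - a) / (d - c) * mrNorm ι p (Ioo c d) u du := by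
  have hσ : 0 < c - a := by linarith
  have hT : 0 < d - c := by linarith
  have hL : 0 < d - a := by linarith
  have hp0 : 0 < p := by linarith
  have k1 : 1 ≤ (d - a) / (c - a) := (one_le_div hσ).2 (by linarith)
  have k2 : 1 ≤ (d - a) / (d - c) := (one_le_div hT).2 (by linarith)
  have m1 : 0 ≤ mrNorm ι p (Ioo a c) u du := mrNorm_nonneg
  have m2 : 0 ≤ mrNorm ι p (Ioo c d) u du := mrNorm_nonneg
  have key : mrNorm ι p (Ioo a d) u du ^ p ≤ ((d - a) / (c - a) * mrNorm ι p (Ioo a c) u du) ^ p +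
      ((d - a) / (d - c) * mrNorm ι p (Ioo c d) u du) ^ p := by
    rw [Real.mul_rpow (by positivity) m1, Real.mul_rpow (by positivity) m2]
    simp only [mrNorm_eq, timeScale_Ioo hac.le, timeScale_Ioo hcd.le,
      timeScale_Ioo (hac.trans hcd).le]
    rw [tripleNorm_rpow hp lpNormOn_nonneg lpNormOn_nonneg (mul_nonneg hL.le lpNormOn_nonneg),
      tripleNorm_rpow hp lpNormOn_nonneg lpNormOn_nonneg (mul_nonneg hσ.le lpNormOn_nonneg),
      tripleNorm_rpow hp lpNormOn_nonneg lpNormOn_nonneg (mul_nonneg hT.le lpNormOn_nonneg),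
      Real.mul_rpow hL.le lpNormOn_nonneg, Real.mul_rpow hσ.le lpNormOn_nonneg,
      Real.mul_rpow hT.le lpNormOn_nonneg, lpNormOn_rpow_split hp hac hcd hu,
      lpNormOn_rpow_split hp hac hcd (hu.clm ι), lpNormOn_rpow_split hp hac hcd hdu]
    have e1 : ((d - a) / (c - a)) ^ p * (c - a) ^ p = (d - a) ^ p := by
      rw [← Real.mul_rpow (by positivity) hσ.le, div_mul_cancel₀ _ hσ.ne']
    have e2 : ((d - a) / (d - c)) ^ p * (d - c) ^ p = (d - a) ^ p := by
      rw [← Real.mul_rpow (by positivity) hT.le, div_mul_cancel₀ _ hT.ne']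
    have k1' := Real.one_le_rpow k1 hp0.le
    have k2' := Real.one_le_rpow k2 hp0.le
    have a1 := le_mul_of_one_le_left (lpNormOn_rpow_nonneg (p := p) (I := Ioo a c) (f := u)) k1'
    have a2 := le_mul_of_one_le_left (lpNormOn_rpow_nonneg (p := p) (I := Ioo a c)
      (f := fun t => ι (u t))) k1'
    have b1 := le_mul_of_one_le_left (lpNormOn_rpow_nonneg (p := p) (I := Ioo c d) (f := u)) k2'
    have b2 := le_mul_of_one_le_left (lpNormOn_rpow_nonneg (p := p) (I := Ioo c d)
      (f := fun t => ι (u t))) k2'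
    rw [mul_add, mul_add, mul_add, mul_add, ← mul_assoc _ ((c - a) ^ p), e1,
      ← mul_assoc _ ((d - c) ^ p), e2]
    linarith
  rw [← Real.rpow_le_rpow_iff mrNorm_nonneg (by positivity) hp0]
  exact key.trans (Real.add_rpow_le_rpow_add (by positivity) (by positivity) hp.le)

/-- Maximal regularity on two adjacent intervals yields maximal regularity on their union. -/
theorem WP.glue (hp : 1 < p) (hac : a < c) (hcd : c < d) (hK : 0 ≤ K) (hg : 0 ≤ g)
    (h1 : WP ι p a c A K) (h2 : WP ι p c d A g)
    (hm : ∀ x, AEStronglyMeasurable (fun t => A t x) (volume.restrict (Ioo c d)))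
    (hC0 : 0 ≤ C) (hC : ∀ᵐ t ∂(volume.restrict (Ioo c d)), ∀ x, ‖A t x‖ ≤ C * ‖x‖) :
    WP ι p a d A ((d - a) / (d - c) * g + ((d - a) / (c - a) + ((d - a) / (c - a)) ^ (1 / p) *
      ((d - a) / (d - c)) ^ (1 / Real.conjExponent p) * Q p (d - c) C g) * K) := by
  have hσ : 0 < c - a := by linarith
  have hT : 0 < d - c := by linarith
  have hL : 0 < d - a := by linarith
  obtain ⟨r, hr, hr1, hrQ⟩ := exists_le_Q hp hT hC0 hg
  have hsub1 : Ioo a c ⊆ Ioo a d := Ioo_subset_Ioo_right hcd.le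
  have hsub2 : Ioo c d ⊆ Ioo a d := Ioo_subset_Ioo_left hac.le
  refine ⟨fun f hf => ?_, fun f hf u du hu => ?_⟩
  · obtain ⟨u, du, hu⟩ := h1.1 f (hf.mono hsub1)
    obtain ⟨v, dv, hv, -⟩ := h2.exists_null_extension hp hac hcd hg hm hC0 hC hu.1 hr hr1
    obtain ⟨w, dw, hw⟩ := h2.1 f (hf.mono hsub2)
    have h3 := hv.add hp (startsAt_Ioo c d) hw
    rw [add_zero, ← zero_add (∫ s in a..c, du s), ← Ioo_inter_Ioi' hac.le] at h3
    have h4 := Sol.concat hp (startsAt_Ioo a d) ⟨hac, hcd⟩ hu h3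
    exact ⟨_, _, h4.congr_rhs (ae_of_all _ fun t => by simp [concat])⟩
  · have hu1 := hu.mono hsub1
    have hu2 : Sol ι p (Ioo c d) c A (∫ s in a..c, du s) f u du := by
      have := hu.1.restart hp hac.le hcd.le
      rw [zero_add] at this
      exact ⟨this, (hu.mono hsub2).2⟩
    -- On `(c, d)` the solution is split as `v + (u - v)`: `v` carries the trace at `c`, and `u - v`
    -- has source `f` and zero initial value.
    obtain ⟨v, dv, hv, hvb⟩ := h2.exists_null_extension hp hac hcd hg hm hC0 hC hu1.1 hr hr1
    have h3 := hu2.sub hp (startsAt_Ioo c d) hv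
    rw [sub_self] at h3
    have h4 := h2.2 f (hf.mono hsub2) _ _ (h3.congr_rhs (by simp))
    have h5 := mrNorm_add_le (ι := ι) hp hv.1.1 hv.1.2 h3.1.1 h3.1.2
    simp only [add_sub_cancel] at h5
    have h6 := h1.2 f (hf.mono hsub1) u du hu1
    have f1 := mul_le_mul_of_nonneg_left (lpNormOn_mono_set hsub1 hf) hK
    have f2 := mul_le_mul_of_nonneg_left (lpNormOn_mono_set hsub2 hf) hg
    have hQ := Q_nonneg hp hT hC0 hg
    have h7 : mrNorm ι p (Ioo c d) v dv ≤ ((d - c) / (c - a)) ^ (1 / p) * Q p (d - c) C g *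
        (K * lpNormOn p (Ioo a d) f) := by
      refine hvb.trans ?_
      gcongr
      · exact mrNorm_nonneg
      · exact h6.trans f1
    -- With `κ₁ = (d - a)/(c - a)` and `κ₂ = (d - a)/(d - c)`, the ratio `(d - c)/(c - a)` is `κ₁ /
    -- κ₂`, and `κ₂ κ₂^(-1/p) = κ₂^(1/q)`.
    have e1 : (d - a) / (d - c) * ((d - c) / (c - a)) ^ (1 / p) =
        ((d - a) / (c - a)) ^ (1 / p) * ((d - a) / (d - c)) ^ (1 / Real.conjExponent p) := by
      have hk : 0 < (d - a) / (d - c) := by positivity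
      have e : (d - a) / (c - a) = (d - a) / (d - c) * ((d - c) / (c - a)) := by field_simp
      rw [one_div_conjExponent hp, e, Real.mul_rpow hk.le (by positivity), mul_right_comm,
        ← Real.rpow_add hk]
      simp
    refine (mrNorm_le_of_split hp hac hcd hu.1.1 hu.1.2).trans ?_
    calc _ ≤ (d - a) / (c - a) * (K * lpNormOn p (Ioo a d) f) + (d - a) / (d - c) *
          (((d - c) / (c - a)) ^ (1 / p) * Q p (d - c) C g * (K * lpNormOn p (Ioo a d) f) +
            g * lpNormOn p (Ioo a d) f) := by
          gcongr
          · exact h6.trans f1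
          · exact h5.trans (add_le_add h7 (h4.trans f2))
      _ = _ := by rw [← e1]; ring

end Gluing

/-! ### Induction over the cells. -/

section Subdivision

theorem H_nonneg {p : ℝ} {τ : ℕ → ℝ} {j : ℕ} {C g : ℝ} (hp : 1 < p) (h0 : τ 0 < τ (j - 1))
    (h1 : τ (j - 1) < τ j) (hC : 0 ≤ C) (hg : 0 ≤ g) : 0 ≤ H p τ j C g := by
  have hQ := Q_nonneg hp (sub_pos.2 h1) hC hg
  have k1 : 0 ≤ (τ j - τ 0) / (τ (j - 1) - τ 0) := div_nonneg (by linarith) (by linarith)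
  have k2 : 0 ≤ (τ j - τ 0) / (τ j - τ (j - 1)) := div_nonneg (by linarith) (by linarith)
  unfold H
  positivity

/-- This recursion is the constant of `WP.glue` when one more cell is attached on the right. -/
theorem Kbound_succ (p : ℝ) (N : ℕ) (τ : ℕ → ℝ) (C : ℝ) (g : ℕ → ℝ) :
    Kbound p (N + 1) τ C g = (τ (N + 1) - τ 0) / (τ (N + 1) - τ N) * g (N + 1) +
      H p τ (N + 1) C (g (N + 1)) * Kbound p N τ C g := by
  unfold Kbound
  rw [Finset.sum_Icc_succ_top (by omega), add_comm, Finset.mul_sum]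
  congr 1
  · simp
  · refine Finset.sum_congr rfl fun i hi => ?_
    rw [Finset.prod_Icc_succ_top (by have := (Finset.mem_Icc.1 hi).2; omega)]
    ring

variable {D X : Type*} [NormedAddCommGroup D] [NormedSpace ℝ D]
  [NormedAddCommGroup X] [NormedSpace ℝ X]
  {ι : D →L[ℝ] X} {p : ℝ} {A : ℝ → D →L[ℝ] X} {C : ℝ}

theorem WP.of_subdivision (hp : 1 < p) {N : ℕ} {τ g : ℕ → ℝ}
    (hτ : ∀ i, 1 ≤ i → i ≤ N → τ (i - 1) < τ i) (hg : ∀ i, 1 ≤ i → i ≤ N → 0 ≤ g i)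
    (h : ∀ i, 1 ≤ i → i ≤ N → WP ι p (τ (i - 1)) (τ i) A (g i))
    (hm : ∀ i, 1 ≤ i → i ≤ N → ∀ x,
      AEStronglyMeasurable (fun t => A t x) (volume.restrict (Ioo (τ (i - 1)) (τ i))))
    (hC0 : 0 ≤ C) (hC : ∀ i, 1 ≤ i → i ≤ N →
      ∀ᵐ t ∂(volume.restrict (Ioo (τ (i - 1)) (τ i))), ∀ x, ‖A t x‖ ≤ C * ‖x‖)
    (n : ℕ) (hn : 1 ≤ n) (hnN : n ≤ N) :
    τ 0 < τ n ∧ 0 ≤ Kbound p n τ C g ∧ WP ι p (τ 0) (τ n) A (Kbound p n τ C g) := by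
  induction n, hn using Nat.le_induction with
  | base =>
    have h1 := hτ 1 le_rfl hnN
    have e : Kbound p 1 τ C g = g 1 := by
      simp only [Nat.sub_self] at h1
      have : τ 1 - τ 0 ≠ 0 := by linarith
      simp [Kbound, div_self this]
    rw [e]
    exact ⟨h1, hg 1 le_rfl hnN, h 1 le_rfl hnN⟩
  | succ n hn ih =>
    obtain ⟨i1, i2, i3⟩ := ih (by omega)
    have hn1 : 1 ≤ n + 1 := by omega
    have h1 := hτ (n + 1) hn1 hnN
    have h2 := h (n + 1) hn1 hnN
    have h3 := hm (n + 1) hn1 hnN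
    have h4 := hC (n + 1) hn1 hnN
    have hg1 := hg (n + 1) hn1 hnN
    rw [Nat.add_sub_cancel] at h1 h2 h3 h4
    refine ⟨i1.trans h1, ?_, ?_⟩
    · rw [Kbound_succ]
      have := H_nonneg hp (j := n + 1) i1 h1 hC0 hg1
      have : 0 ≤ (τ (n + 1) - τ 0) / (τ (n + 1) - τ n) := div_nonneg (by linarith) (by linarith)
      positivity
    · rw [Kbound_succ]
      exact WP.glue hp i1 h1 i2 hg1 i3 h2 h3 hC0 h4

end Subdivision

/-! ### Construction of the subdivision. -/

section AdaptedSubdivision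

variable {a b : ℝ} {ρ : ℝ → ℝ}

/-- A minimal cover of `[a, b]` by intervals `(s - ρ s, s + ρ s)`. -/
theorem exists_minimal_cover (hρ : ∀ s ∈ Icc a b, 0 < ρ s) :
    ∃ F : Finset ℝ, (∀ s ∈ F, s ∈ Icc a b) ∧
      (∀ y ∈ Icc a b, ∃ s ∈ F, s - ρ s < y ∧ y < s + ρ s) ∧
      ∀ s ∈ F, ∃ y ∈ Icc a b, (s - ρ s < y ∧ y < s + ρ s) ∧
        ∀ v ∈ F, v ≠ s → ¬ (v - ρ v < y ∧ y < v + ρ v) := by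
  classical
  let P : Finset ℝ → Prop := fun F => (∀ s ∈ F, s ∈ Icc a b) ∧
    ∀ y ∈ Icc a b, ∃ s ∈ F, s - ρ s < y ∧ y < s + ρ s
  have hex : ∃ F, P F := by
    obtain ⟨F, hF, hcov⟩ := isCompact_Icc.elim_nhds_subcover (fun s => Ioo (s - ρ s) (s + ρ s))
      (fun s hs => Ioo_mem_nhds (by linarith [hρ s hs]) (by linarith [hρ s hs]))
    refine ⟨F, hF, fun y hy => ?_⟩
    obtain ⟨s, hs, hys⟩ := mem_iUnion₂.1 (hcov hy)
    exact ⟨s, hs, hys⟩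
  -- In a cover of least cardinality no interval can be dropped, so each contains a point covered by
  -- no other.
  obtain ⟨F, hF, hmin⟩ := WellFounded.has_min (measure Finset.card).wf {F | P F} hex
  refine ⟨F, hF.1, hF.2, fun s hs => ?_⟩
  by_contra! h
  refine hmin (F.erase s) ⟨fun v hv => hF.1 v (Finset.mem_of_mem_erase hv), fun y hy => ?_⟩
    (Finset.card_erase_lt_of_mem hs)
  obtain ⟨v, hv, hvy⟩ := hF.2 y hy
  by_cases hvs : v = s
  · obtain ⟨w, hw, hws, h1⟩ := h y hy (hvs ▸ hvy)
    exact ⟨w, Finset.mem_erase.2 ⟨hws, hw⟩, h1⟩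
  · exact ⟨v, Finset.mem_erase.2 ⟨hvs, hv⟩, hvy⟩

/-- The elements of a finite set of reals in increasing order, indexed from `1`. -/
theorem exists_enumeration (F : Finset ℝ) : ∃ t : ℕ → ℝ,
    (∀ i, 1 ≤ i → i ≤ F.card → t i ∈ F) ∧
    (∀ i j, 1 ≤ i → i < j → j ≤ F.card → t i < t j) ∧
    ∀ v ∈ F, ∃ i, 1 ≤ i ∧ i ≤ F.card ∧ t i = v := by
  let e := F.orderEmbOfFin rfl
  refine ⟨fun i => if h : i - 1 < F.card then e ⟨i - 1, h⟩ else 0, fun i h1 h2 => ?_,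
    fun i j h1 h2 h3 => ?_, fun v hv => ?_⟩
  · simp only [show i - 1 < F.card by omega, dif_pos]
    exact Finset.orderEmbOfFin_mem F rfl _
  · simp only [show i - 1 < F.card by omega, show j - 1 < F.card by omega, dif_pos]
    exact e.strictMono (Fin.mk_lt_mk.2 (by omega))
  · have : v ∈ Set.range e := by rw [Finset.range_orderEmbOfFin]; exact hv
    obtain ⟨k, hk⟩ := this
    refine ⟨k + 1, by omega, by have := k.2; omega, ?_⟩
    simp [hk]

/-- In a minimal cover no interval contains another on `[a, b]`, so left and right ends increase
with the centers. Consecutive intervals meet, at least at an end point, and the cuts are the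
midpoints between the left end of the next and the right end of the present interval. The point `y
s` covered by `s` alone separates the intervals before `s` from those after it, which keeps cells
long. -/
theorem exists_isAdaptedSubdivision (hab : a < b) (hρ : ∀ s ∈ Icc a b, 0 < ρ s) :
    ∃ N τ t, IsAdaptedSubdivision a b ρ N τ t := by
  obtain ⟨F, hF, hcov, hpriv⟩ := exists_minimal_cover hρ
  choose! y hy hys hyv using hpriv
  have hl : ∀ s ∈ F, ∀ v ∈ F, s < v → s - ρ s < v - ρ v := by
    intro s hs v hv h
    by_contra! h'
    exact hyv s hs v hv h.ne' ⟨by linarith [(hys s hs).1], by linarith [(hys s hs).2]⟩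
  have hr : ∀ s ∈ F, ∀ v ∈ F, s < v → s + ρ s < v + ρ v := by
    intro s hs v hv h
    by_contra! h'
    exact hyv v hv s hs h.ne ⟨by linarith [(hys v hv).1], by linarith [(hys v hv).2]⟩
  have hyr : ∀ s ∈ F, ∀ v ∈ F, s < v → s + ρ s ≤ y v := by
    intro s hs v hv h
    by_contra! h'
    exact hyv v hv s hs h.ne ⟨(hl s hs v hv h).trans (hys v hv).1, h'⟩
  have hyl : ∀ s ∈ F, ∀ v ∈ F, s < v → y s ≤ v - ρ v := by
    intro s hs v hv h
    by_contra! h'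
    exact hyv s hs v hv h.ne' ⟨h', (hys s hs).2.trans (hr s hs v hv h)⟩
  obtain ⟨t, htF, htlt, hts⟩ := exists_enumeration F
  set N := F.card with hN
  have hN1 : 1 ≤ N := by
    obtain ⟨s, hs, -⟩ := hcov a (left_mem_Icc.2 hab.le)
    exact Finset.card_pos.2 ⟨s, hs⟩
  -- A gap would leave the right end of the `i`-th interval uncovered: earlier intervals end no
  -- later, and later ones begin beyond it.
  have hover : ∀ i, 1 ≤ i → i < N → t (i + 1) - ρ (t (i + 1)) ≤ t i + ρ (t i) := by
    intro i h1 h2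
    have hi := htF i h1 h2.le
    have hi' := htF (i + 1) (by omega) h2
    by_contra! h
    have hri : t i + ρ (t i) ∈ Icc a b := by
      have := hρ _ (hF _ hi)
      have := hρ _ (hF _ hi')
      constructor
      · linarith [(hF _ hi).1]
      · linarith [(hF _ hi').2]
    obtain ⟨v, hv, hv1, hv2⟩ := hcov _ hri
    obtain ⟨j, hj1, hj2, rfl⟩ := hts v hv
    rcases lt_trichotomy j i with hj | rfl | hj
    · exact absurd hv2 (not_lt.2 (hr _ hv _ hi (htlt j i hj1 hj h2.le)).le)
    · exact lt_irrefl _ hv2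
    · rcases (show i + 1 ≤ j from hj).eq_or_lt with rfl | hj'
      · linarith
      · linarith [hl _ hi' _ hv (htlt (i + 1) j (by omega) hj' hj2)]
  have hfirst : t 1 - ρ (t 1) < a := by
    obtain ⟨v, hv, hv1, -⟩ := hcov a (left_mem_Icc.2 hab.le)
    obtain ⟨j, hj1, hj2, rfl⟩ := hts v hv
    rcases hj1.eq_or_lt with rfl | hj
    · exact hv1
    · exact (hl _ (htF 1 le_rfl hN1) _ hv (htlt 1 j le_rfl hj hj2)).trans hv1
  have hlast : b < t N + ρ (t N) := by
    obtain ⟨v, hv, -, hv2⟩ := hcov b (right_mem_Icc.2 hab.le)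
    obtain ⟨j, hj1, hj2, rfl⟩ := hts v hv
    rcases hj2.eq_or_lt with rfl | hj
    · exact hv2
    · exact hv2.trans (hr _ hv _ (htF N hN1 le_rfl) (htlt j N hj1 hj le_rfl))
  obtain ⟨τ, hτ0, hτN, hτi⟩ : ∃ τ : ℕ → ℝ, τ 0 = a ∧ τ N = b ∧ ∀ i, 1 ≤ i → i < N →
      τ i = (t (i + 1) - ρ (t (i + 1)) + (t i + ρ (t i))) / 2 := by
    refine ⟨fun i => if i = 0 then a else if i = N then b else
      (t (i + 1) - ρ (t (i + 1)) + (t i + ρ (t i))) / 2, by simp, ?_, fun i h1 h2 => ?_⟩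
    · simp [show N ≠ 0 by omega]
    · simp [show i ≠ 0 by omega, h2.ne]
  have ht1 := hF _ (htF 1 le_rfl hN1)
  have htN := hF _ (htF N hN1 le_rfl)
  have hinter : ∀ i, 1 ≤ i → i < N → t i < τ i ∧ τ i < t (i + 1) := by
    intro i h1 h2
    have hi := htF i h1 h2.le
    have hi' := htF (i + 1) (by omega) h2
    have hlt := htlt i (i + 1) h1 (by omega) h2
    have := hl _ hi _ hi' hlt
    have := hr _ hi _ hi' hlt
    rw [hτi i h1 h2]
    constructor <;> linarith
  have hright : ∀ i, 1 ≤ i → i ≤ N → t i ≤ τ i ∧ τ i ≤ t i + ρ (t i) := by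
    intro i h1 h2
    rcases h2.eq_or_lt with rfl | h2
    · rw [hτN]; exact ⟨htN.2, hlast.le⟩
    · refine ⟨(hinter i h1 h2).1.le, ?_⟩
      rw [hτi i h1 h2]
      linarith [hover i h1 h2]
  have hleft : ∀ i, 1 ≤ i → i ≤ N → τ (i - 1) ≤ t i ∧ t i - ρ (t i) ≤ τ (i - 1) := by
    intro i h1 h2
    rcases h1.eq_or_lt with rfl | h1
    · rw [Nat.sub_self, hτ0]; exact ⟨ht1.1, hfirst.le⟩
    · obtain ⟨k, rfl⟩ : ∃ k, i = k + 1 := ⟨i - 1, by omega⟩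
      rw [Nat.add_sub_cancel]
      refine ⟨(hinter k (by omega) (by omega)).2.le, ?_⟩
      rw [hτi k (by omega) (by omega)]
      linarith [hover k (by omega) (by omega)]
  refine ⟨N, τ, t, hN1, hτ0, hτN, ht1.1, htN.2, hinter, fun i h1 h2 => ?_, fun i h1 h2 => ?_,
    fun i h1 h2 => ?_, fun h2 i hi => ?_⟩
  · obtain ⟨a1, a2⟩ := hleft i h1 h2
    obtain ⟨b1, b2⟩ := hright i h1 h2
    exact ⟨abs_le.2 ⟨by linarith, by linarith⟩, abs_le.2 ⟨by linarith, by linarith⟩⟩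
  · linarith [(hleft i h1 h2).2, (hright i h1 h2).2]
  · obtain ⟨k, rfl⟩ : ∃ k, i = k + 1 := ⟨i - 1, by omega⟩
    rw [Nat.add_sub_cancel, hτi k (by omega) (by omega), hτi (k + 1) (by omega) h2]
    have f0 := htF k (by omega) (by omega)
    have f1 := htF (k + 1) (by omega) (by omega)
    have f2 := htF (k + 1 + 1) (by omega) (by omega)
    have l1 := htlt k (k + 1) (by omega) (by omega) (by omega)
    have l2 := htlt (k + 1) (k + 1 + 1) (by omega) (by omega) (by omega)
    -- The length is `ρ` of the middle center plus half the distance from the right end of the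
    -- previous interval to the left end of the next; the private point between them makes this
    -- distance nonnegative.
    linarith [hyr _ f0 _ f1 l1, hyl _ f1 _ f2 l2]
  · rcases hi with rfl | rfl
    · rw [Nat.sub_self, hτ0, hτi 1 le_rfl (by omega)]
      have f1 := htF 1 le_rfl hN1
      have f2 := htF (1 + 1) (by omega) (by omega)
      have l1 := htlt 1 (1 + 1) le_rfl (by omega) (by omega)
      -- At an end cell the private point lies in `[a, b]` and takes the place of the missing
      -- neighbor, so only half of `ρ` is certain.
      linarith [hyl _ f1 _ f2 l1, (hy _ f1).1, ht1.1]
    · obtain ⟨k, hk⟩ : ∃ k, N = k + 1 := ⟨N - 1, by omega⟩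
      have f0 := htF k (by omega) (by omega)
      have f1 := htF N (by omega) le_rfl
      have l1 := htlt k N (by omega) (by omega) le_rfl
      have h4 := hτi k (by omega) (by omega)
      rw [← hk] at h4
      rw [hτN, show N - 1 = k by omega, h4]
      linarith [hyr _ f0 _ f1 l1, (hy _ f1).2, htN.2]

end AdaptedSubdivision

/-! ### Linear growth of `Q` and `H`. -/

section LinearGrowth

/-- `L` adds up the coefficients of the three regimes, so no case distinction in `g` remains. The
middle one uses `x^(1/p) ≤ 1 + x`. -/
theorem Q_linear_growth {p T C : ℝ} (hp : 1 < p) (hT : 0 < T) (hC : 0 ≤ C) :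
    ∃ L, 0 ≤ L ∧ ∀ g, 0 ≤ g → Q p T C g ≤ L * (1 + g) := by
  have hp0 : 0 < p := by linarith
  set m := (2 : ℝ) ^ (1 / Real.conjExponent p) with hm
  have hm0 : 0 < m := by positivity
  set c₂ := 2 ^ (1 / (p * Real.conjExponent p)) * p / (p - 1) ^ (1 / Real.conjExponent p) with hc₂
  have hc₂0 : 0 ≤ c₂ := by
    have : 0 ≤ p - 1 := by linarith
    positivity
  set c₃ := (max (1 / (C * T)) 1) ^ (1 / p) with hc₃
  have hc₃0 : 0 ≤ c₃ := Real.rpow_nonneg (le_max_of_le_right zero_le_one) _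
  refine ⟨(1 + m * (C + 1 / T)) + c₂ * (1 + 1 / T) + c₃ * (1 + m * C), by positivity,
    fun g hg => ?_⟩
  have b1 : (1 + m * (C + 1 / T)) * (1 + g) = 1 + m * (C * g + g / T) + (m * (C + 1 / T) + g) := by
    ring
  have b2 : c₂ * (1 + 1 / T) * (1 + g) = c₂ * (1 + g / T) + c₂ * (g + 1 / T) := by ring
  have b3 : c₃ * (1 + m * C) * (1 + g) = c₃ * (1 + m * (C * g)) + c₃ * (g + m * C) := by ring
  have n1 : 0 ≤ m * (C + 1 / T) + g := by positivity
  have n2 : 0 ≤ c₂ * (g + 1 / T) := by positivity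
  have n3 : 0 ≤ c₃ * (g + m * C) := by positivity
  have p1 : 0 ≤ 1 + m * (C * g + g / T) := by positivity
  have p2 : 0 ≤ c₂ * (1 + g / T) := by positivity
  have p3 : 0 ≤ c₃ * (1 + m * (C * g)) := by positivity
  rw [add_mul, add_mul, b1, b2, b3]
  unfold Q
  simp only [← hm, ← hc₂, ← hc₃]
  split_ifs
  · have : max (C * g) (g / T) ≤ C * g + g / T :=
      max_le (le_add_of_nonneg_right (by positivity)) (le_add_of_nonneg_left (by positivity))
    have := mul_le_mul_of_nonneg_left this hm0.le
    linarith
  · have h1 : (g / T) ^ (1 / p) ≤ 1 + g / T := by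
      have hgT : 0 ≤ g / T := by positivity
      calc (g / T) ^ (1 / p) ≤ (1 + g / T) ^ (1 / p) := by gcongr; linarith
        _ ≤ (1 + g / T) ^ (1 : ℝ) := Real.rpow_le_rpow_of_exponent_le (by linarith)
            ((div_le_one hp0).2 hp.le)
        _ = _ := Real.rpow_one _
    have := mul_le_mul_of_nonneg_left h1 hc₂0
    linarith
  · linarith

theorem H_linear_growth {p : ℝ} {τ : ℕ → ℝ} {j : ℕ} {C : ℝ} (hp : 1 < p) (h0 : τ 0 < τ (j - 1))
    (h1 : τ (j - 1) < τ j) (hC : 0 ≤ C) : ∃ L, ∀ g, 0 ≤ g → H p τ j C g ≤ L * (1 + g) := by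
  obtain ⟨L, hL, hQ⟩ := Q_linear_growth hp (sub_pos.2 h1) hC
  have k1 : 0 ≤ (τ j - τ 0) / (τ (j - 1) - τ 0) := div_nonneg (by linarith) (by linarith)
  have k2 : 0 ≤ (τ j - τ 0) / (τ j - τ (j - 1)) := div_nonneg (by linarith) (by linarith)
  unfold H
  set κ₁ := (τ j - τ 0) / (τ (j - 1) - τ 0)
  set m := κ₁ ^ (1 / p) * ((τ j - τ 0) / (τ j - τ (j - 1))) ^ (1 / Real.conjExponent p)
  have hm : 0 ≤ m := by positivity
  refine ⟨κ₁ + m * L, fun g hg => ?_⟩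
  have := mul_le_mul_of_nonneg_left (hQ g hg) hm
  have : 0 ≤ κ₁ * g := by positivity
  linarith

end LinearGrowth

/-! ### Consequences of (A1): boundedness, cells, graph norms. -/

section Assumption

variable {D X : Type*} [NormedAddCommGroup D] [NormedSpace ℝ D]
  [NormedAddCommGroup X] [NormedSpace ℝ X]
  {ι : D →L[ℝ] X} {p a b : ℝ} {A A₀ : ℝ → D →L[ℝ] X} {B : ℝ → ℝ → D →L[ℝ] X} {δ η : ℝ → ℝ}

/-- Relatively continuous operators are bounded. -/
theorem IsRelCont.exists_bound (h : IsRelCont ι a b A) :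
    ∃ C, 0 ≤ C ∧ ∀ t ∈ Icc a b, ∀ x, ‖A t x‖ ≤ C * ‖x‖ := by
  obtain ⟨⟨d, e⟩, hd, he, hde⟩ := h.relCont 1 one_pos
  simp only at hd he hde
  -- Walk from `a` to `t` in steps of length at most `d`; each step adds at most `1 + e ‖ι‖` to the
  -- operator norm.
  have key : ∀ k : ℕ, ∀ t ∈ Icc a b, t - a ≤ k * d → ∀ x,
      ‖A t x‖ ≤ (‖A a‖ + k * (1 + e * ‖ι‖)) * ‖x‖ := by
    intro k
    induction k with
    | zero =>
      intro t ht hk x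
      have : t = a := le_antisymm (by simpa using hk) ht.1
      simpa [this] using (A a).le_opNorm x
    | succ k ih =>
      intro t ht hk x
      push_cast at hk ⊢
      have hs : max a (t - d) ∈ Icc a b :=
        ⟨le_max_left _ _, max_le (ht.1.trans ht.2) (by linarith [ht.2])⟩
      have hsk : max a (t - d) - a ≤ k * d := by
        rcases max_cases a (t - d) with h | h
        · rw [h.1, sub_self]; positivity
        · rw [h.1]; linarith
      have h1 := ih _ hs hsk x
      have hmt : max a (t - d) ≤ t := max_le ht.1 (by linarith)
      have h2 := hde x t ht _ hs (by
        rw [abs_of_nonneg (by linarith)]; linarith [le_max_right a (t - d)])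
      have h3 := mul_le_mul_of_nonneg_left (ι.le_opNorm x) he
      have h4 := norm_le_norm_add_norm_sub' (A t x) (A (max a (t - d)) x)
      linarith
  obtain ⟨k, hk⟩ := exists_nat_ge ((b - a) / d)
  refine ⟨‖A a‖ + k * (1 + e * ‖ι‖), by positivity, fun t ht x => key k t ht ?_ x⟩
  rw [div_le_iff₀ hd] at hk
  linarith [ht.2]

/-- The uniform bound `C` ensures that the essential supremum is finite, so that passing to a real
number loses nothing. -/
theorem ae_le_opLinftyNorm {J : Set ℝ} (hJ : MeasurableSet J) {C : ℝ}
    (hC : ∀ t ∈ J, ‖A t‖ ≤ C) :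
    ∀ᵐ t ∂(volume.restrict J), ∀ x, ‖A t x‖ ≤ opLinftyNorm J A * ‖x‖ := by
  have hfin : essSup (fun t => ‖A t‖ₑ) (volume.restrict J) ≠ ∞ := by
    refine ne_top_of_le_ne_top (ENNReal.ofReal_ne_top (r := C)) (essSup_le_of_ae_le _ ?_)
    filter_upwards [ae_restrict_mem hJ] with t ht
    rw [← ofReal_norm]
    exact ENNReal.ofReal_le_ofReal (hC t ht)
  filter_upwards [ENNReal.ae_le_essSup (μ := volume.restrict J) fun t => ‖A t‖ₑ] with t ht x
  refine ((A t).le_opNorm x).trans (mul_le_mul_of_nonneg_right ?_ (norm_nonneg x))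
  rw [← toReal_enorm]
  exact ENNReal.toReal_mono hfin ht

/-- The test functions `(t - a) x` yield the equivalence of the graph norm. -/
theorem WP.graphNormEquiv [CompleteSpace X] {T : D →L[ℝ] X} {K : ℝ} (hp : 1 < p)
    (hab : a < b) (hK : 0 ≤ K) (h : WP ι p a b (fun _ => T) K) : GraphNormEquiv ι T := by
  have hL : 0 < b - a := sub_pos.2 hab
  have hid : MemLpOn p (Ioo a b) (fun t : ℝ => t - a) :=
    memLpOn_of_continuous (by fun_prop)
  set c := lpNormOn p (Ioo a b) (fun t : ℝ => t - a) with hc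
  have hc0 : 0 < c := by
    refine lt_of_le_of_ne lpNormOn_nonneg fun h0 => ?_
    have h1 := lpNormOn_eq_zero hp hid h0.symm
    have h2 : ∀ᵐ t ∂(volume.restrict (Ioo a b)), False := by
      filter_upwards [h1, ae_restrict_mem measurableSet_Ioo] with t h3 h4
      linarith [h4.1]
    rw [ae_iff] at h2
    simp only [not_false_eq_true, ofPred_true, Measure.restrict_apply_univ, Real.volume_Ioo,
      ENNReal.ofReal_eq_zero] at h2
    linarith
  set m := K * ((b - a) ^ (1 / p) * (1 + (b - a))) with hm
  have hm0 : 0 ≤ m := by positivity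
  have hlow : ∀ x, c * ‖x‖ ≤ m * (‖ι x‖ + ‖T x‖) := by
    intro x
    have hu : Sol ι p (Ioo a b) a (fun _ => T) 0 (fun t => ι x + (t - a) • T x)
        (fun t => (t - a) • x) (fun _ => ι x) := by
      refine ⟨⟨memLpOn_of_continuous (by fun_prop), memLpOn_const _, ae_of_all _ fun t => ?_⟩,
        ae_of_all _ fun t => ?_⟩
      · simp
      · simp
    have hf : MemLpOn p (Ioo a b) (fun t => ι x + (t - a) • T x) :=
      memLpOn_of_continuous (by fun_prop)
    have h1 := (lpNormOn_le_mrNorm hp).trans (h.2 _ hf _ _ hu)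
    have e1 : c * ‖x‖ ≤ lpNormOn p (Ioo a b) (fun t => (t - a) • x) := by
      rw [hc, mul_comm, ← abs_of_nonneg (norm_nonneg x), ← lpNormOn_const_smul]
      rw [← one_mul (lpNormOn p (Ioo a b) fun t => (t - a) • x)]
      refine lpNormOn_le_mul (memLpOn_of_continuous (by fun_prop)) zero_le_one
        (ae_of_all _ fun t => ?_)
      rw [one_mul, norm_smul, norm_smul, norm_norm, mul_comm]
    have e2 : lpNormOn p (Ioo a b) (fun t => ι x + (t - a) • T x) ≤
        1 * lpNormOn p (Ioo a b) (fun _ => (1 + (b - a)) * (‖ι x‖ + ‖T x‖)) := by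
      refine lpNormOn_le_mul (memLpOn_const _) zero_le_one ?_
      filter_upwards [ae_restrict_mem measurableSet_Ioo] with t ht
      rw [one_mul, Real.norm_of_nonneg (by positivity)]
      refine (norm_add_le _ _).trans ?_
      rw [norm_smul, Real.norm_of_nonneg (by linarith [ht.1])]
      have : (t - a) * ‖T x‖ ≤ (b - a) * ‖T x‖ := by
        have := ht.2.le
        gcongr
      have : 0 ≤ (b - a) * ‖ι x‖ := by positivity
      nlinarith [norm_nonneg (T x)]
    rw [one_mul, lpNormOn_const hp _ hab.le, Real.norm_of_nonneg (by positivity)] at e2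
    calc c * ‖x‖ ≤ _ := e1.trans h1
      _ ≤ K * _ := mul_le_mul_of_nonneg_left e2 hK
      _ = _ := by rw [hm]; ring
  refine ⟨c / (m + 1), ‖ι‖ + ‖T‖ + 1, by positivity, by positivity, fun x => ⟨?_, ?_⟩⟩
  · rw [div_mul_eq_mul_div, div_le_iff₀ (by positivity)]
    refine (hlow x).trans ?_
    have : 0 ≤ ‖ι x‖ + ‖T x‖ := by positivity
    linarith
  · have h1 := ι.le_opNorm x
    have h2 := T.le_opNorm x
    have := norm_nonneg x
    linarith

theorem eps₀_pos (t : ℝ) : 0 < eps₀ ι p a b A₀ t := by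
  have h1 : 0 ≤ K₀ ι p a b A₀ t := mrConst_nonneg
  have h2 : 0 ≤ M₀ ι A₀ t := semigroupBound_nonneg
  unfold eps₀
  positivity

theorem G_nonneg {τ μ M K : ℝ} (hp : 1 < p) (hM : 0 ≤ M) (hK : 0 ≤ K) : 0 ≤ G p τ μ M K := by
  have : 0 ≤ cp p (-(4 * M * τ * μ)) := cp_nonneg hp
  unfold G
  positivity

variable [CompleteSpace D] [CompleteSpace X]

theorem AssumptionA1.wp_cell (hA : AssumptionA1 ι p a b A A₀ B δ η) (hp : 1 < p)
    (hι : DenseRange ι) {t α β : ℝ} (ht : t ∈ Icc a b) (hα : a ≤ α) (hαβ : α < β) (hβ : β ≤ b)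
    (hm : ∀ x, AEStronglyMeasurable (fun t => A t x) (volume.restrict (Ioo α β)))
    (h : ∀ s ∈ Ioo α β, |t - s| ≤ δ (eps₀ ι p a b A₀ t)) :
    WP ι p α β A (G p (β - α) (η (eps₀ ι p a b A₀ t)) (M₀ ι A₀ t) (K₀ ι p a b A₀ t)) := by
  have hε : 0 < eps₀ ι p a b A₀ t := eps₀_pos t
  refine WP.of_close hp hι (hA.pointwise_mr t ht) hαβ.le mrConst_nonneg
    (hA.range _ hε).2.1 (aut_wp_K₀ hp (hA.pointwise_mr t ht) hαβ hα hβ) hm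
    fun s hs x => ?_
  have hs' : s ∈ Ioo a b := ⟨hα.trans_lt hs.1, hs.2.trans_le hβ⟩
  have e : A s x - A₀ t x = B t s x := by
    rw [hA.decomposition t ht s hs']; simp
  rw [e]
  exact hA.perturbation x t ht s hs' (h s hs)

/-- The operator `A t`, kept constant in time, differs from `A₀ t` by `B t t`, to which the
perturbation bound applies at distance zero. It therefore has maximal regularity on `(a, b)`, which
forces the equivalence of norms. -/
theorem AssumptionA1.graphNormEquiv (hA : AssumptionA1 ι p a b A A₀ B δ η) (hp : 1 < p)
    (hι : DenseRange ι) {t : ℝ} (ht : t ∈ Ioo a b) : GraphNormEquiv ι (A t) := by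
  have hab : a < b := ht.1.trans ht.2
  have ht' := Ioo_subset_Icc_self ht
  have hε : 0 < eps₀ ι p a b A₀ t := eps₀_pos t
  refine WP.graphNormEquiv hp hab (G_nonneg hp semigroupBound_nonneg mrConst_nonneg)
    (WP.of_close (A := fun _ => A t) hp hι (hA.pointwise_mr t ht') hab.le mrConst_nonneg
      (hA.range _ hε).2.1 (aut_wp_K₀ hp (hA.pointwise_mr t ht') hab le_rfl le_rfl)
      (fun x => aestronglyMeasurable_const) fun s hs x => ?_)
  have e : A t x - A₀ t x = B t t x := by
    rw [hA.decomposition t ht' t ht]; simp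
  rw [e]
  refine hA.perturbation x t ht' t ht ?_
  rw [sub_self, abs_zero]
  exact (hA.range _ hε).1.le

end Assumption

/-! ### Order properties of an adapted subdivision. -/

section Subdivision

variable {a b : ℝ} {ρ : ℝ → ℝ} {N : ℕ} {τ t : ℕ → ℝ}

theorem IsAdaptedSubdivision.strictMono_step (h : IsAdaptedSubdivision a b ρ N τ t)
    (hab : a < b) {i : ℕ} (h1 : 1 ≤ i) (h2 : i ≤ N) :
    τ (i - 1) ≤ t i ∧ t i ≤ τ i ∧ τ (i - 1) < τ i := by
  have hr : t i ≤ τ i := by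
    rcases h2.eq_or_lt with rfl | h2
    · rw [h.right]; exact h.last
    · exact (h.interlaced i h1 h2).1.le
  have hl : τ (i - 1) ≤ t i := by
    rcases h1.eq_or_lt with rfl | h1
    · rw [Nat.sub_self, h.left]; exact h.first
    · have := (h.interlaced (i - 1) (by omega) (by omega)).2.le
      rwa [Nat.sub_add_cancel (by omega)] at this
  refine ⟨hl, hr, ?_⟩
  rcases h2.eq_or_lt with rfl | h2
  · rcases h1.eq_or_lt with rfl | h1
    · rw [h.right, Nat.sub_self, h.left]; exact hab
    · have := (h.interlaced (i - 1) (by omega) (by omega)).2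
      rw [Nat.sub_add_cancel (by omega)] at this
      exact this.trans_le hr
  · exact hl.trans_lt (h.interlaced i h1 h2).1

theorem IsAdaptedSubdivision.le_of_le (h : IsAdaptedSubdivision a b ρ N τ t) (hab : a < b) {i j : ℕ}
    (hij : i ≤ j) (hj : j ≤ N) : τ i ≤ τ j := by
  induction j, hij using Nat.le_induction with
  | base => exact le_rfl
  | succ j hij ih =>
    have := (h.strictMono_step hab (i := j + 1) (by omega) hj).2.2.le
    rw [Nat.add_sub_cancel] at this
    exact (ih (by omega)).trans this

end Subdivision

end MaxReg

end

/-! ### Assembly of the theorem. -/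

theorem mainTheorem1
    {D X : Type*} [NormedAddCommGroup D] [NormedSpace ℝ D] [CompleteSpace D]
    [NormedAddCommGroup X] [NormedSpace ℝ X] [CompleteSpace X]
    (ι : D →L[ℝ] X) (hι_inj : Function.Injective ι) (hι_dense : DenseRange ι)
    (hι_compact : IsCompactOperator ι)
    (p : ℝ) (hp : 1 < p) (a b : ℝ) (hab : a < b)
    (A A₀ : ℝ → D →L[ℝ] X) (B : ℝ → ℝ → D →L[ℝ] X) (δ η : ℝ → ℝ)
    (hA : MaxReg.AssumptionA1 ι p a b A A₀ B δ η) :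
    MaxReg.IsMaxReg ι p (Set.Ioo a b) A ∧
    ∃ (N : ℕ) (τ t : ℕ → ℝ),
      MaxReg.IsAdaptedSubdivision a b (fun s => δ (MaxReg.eps₀ ι p a b A₀ s)) N τ t ∧
      MaxReg.mrConst ι p (Set.Ioo a b) A ≤
        MaxReg.Kbound p N τ (MaxReg.opLinftyNorm (Set.Ioo a b) A)
          (fun i => MaxReg.G p (τ i - τ (i - 1)) (η (MaxReg.eps₀ ι p a b A₀ (t i)))
            (MaxReg.M₀ ι A₀ (t i)) (MaxReg.K₀ ι p a b A₀ (t i))) ∧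
      ∀ C : ℝ, 0 ≤ C → ∀ j : ℕ, 2 ≤ j → j ≤ N →
        ∃ L : ℝ, ∀ g : ℝ, 0 ≤ g → MaxReg.H p τ j C g ≤ L * (1 + g) := by
  obtain ⟨N, τ, t, hτ⟩ := MaxReg.exists_isAdaptedSubdivision
    (ρ := fun s => δ (MaxReg.eps₀ ι p a b A₀ s)) hab
    fun s _ => (hA.range _ (MaxReg.eps₀_pos s)).1
  obtain ⟨C, -, hC⟩ := hA.relCont.exists_bound
  have hAnorm : ∀ s ∈ Set.Ioo a b, ‖A s‖ ≤ max C 0 := fun s hs =>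
    (A s).opNorm_le_bound (le_max_right _ _) fun x =>
      (hC s (Set.Ioo_subset_Icc_self hs) x).trans
        (mul_le_mul_of_nonneg_right (le_max_left _ _) (norm_nonneg x))
  have hCinf := MaxReg.ae_le_opLinftyNorm measurableSet_Ioo hAnorm
  have hCinf0 : 0 ≤ MaxReg.opLinftyNorm (Set.Ioo a b) A := ENNReal.toReal_nonneg
  have hm : ∀ x, MeasureTheory.AEStronglyMeasurable (fun s => A s x)
      (MeasureTheory.volume.restrict (Set.Ioo a b)) := fun x =>
    (hA.relCont.stronglyMeasurable x).mono_measure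
      (MeasureTheory.Measure.restrict_mono Set.Ioo_subset_Icc_self le_rfl)
  have hsub : ∀ i, 1 ≤ i → i ≤ N → a ≤ τ (i - 1) ∧ τ i ≤ b := fun i h1 h2 =>
    ⟨hτ.left ▸ hτ.le_of_le hab (Nat.zero_le _) (by omega), hτ.right ▸ hτ.le_of_le hab h2 le_rfl⟩
  have hIoo : ∀ i, 1 ≤ i → i ≤ N → Set.Ioo (τ (i - 1)) (τ i) ⊆ Set.Ioo a b := fun i h1 h2 =>
    Set.Ioo_subset_Ioo (hsub i h1 h2).1 (hsub i h1 h2).2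
  have hmi : ∀ i, 1 ≤ i → i ≤ N → ∀ x, MeasureTheory.AEStronglyMeasurable (fun s => A s x)
      (MeasureTheory.volume.restrict (Set.Ioo (τ (i - 1)) (τ i))) := fun i h1 h2 x =>
    (hm x).mono_measure (MeasureTheory.Measure.restrict_mono (hIoo i h1 h2) le_rfl)
  obtain ⟨-, hK, hwp⟩ := MaxReg.WP.of_subdivision (ι := ι) (A := A)
    (g := fun i => MaxReg.G p (τ i - τ (i - 1)) (η (MaxReg.eps₀ ι p a b A₀ (t i)))
      (MaxReg.M₀ ι A₀ (t i)) (MaxReg.K₀ ι p a b A₀ (t i))) hp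
    (fun i h1 h2 => (hτ.strictMono_step hab h1 h2).2.2)
    (fun i _ _ => MaxReg.G_nonneg hp MaxReg.semigroupBound_nonneg MaxReg.mrConst_nonneg)
    (fun i h1 h2 => by
      obtain ⟨s1, s2, s3⟩ := hτ.strictMono_step hab h1 h2
      obtain ⟨d1, d2⟩ := hτ.dist i h1 h2
      refine hA.wp_cell hp hι_dense ⟨(hsub i h1 h2).1.trans s1, s2.trans (hsub i h1 h2).2⟩
        (hsub i h1 h2).1 s3 (hsub i h1 h2).2 (hmi i h1 h2) fun s hs => ?_
      -- Both ends of the cell are within `ρ` of its center, hence so is every point between them.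
      rw [abs_le] at d1 d2 ⊢
      exact ⟨by linarith [hs.2], by linarith [hs.1]⟩)
    hmi hCinf0
    (fun i h1 h2 => MeasureTheory.ae_restrict_of_ae_restrict_of_subset (hIoo i h1 h2) hCinf)
    N hτ.one_le le_rfl
  rw [hτ.left, hτ.right] at hwp
  refine ⟨hwp.isMaxReg hp hab hK (fun x => ?_) fun s hs => hA.graphNormEquiv hp hι_dense hs,
    N, τ, t, hτ, hwp.mrConst_le hp hab hK, fun C hC0 j h1 h2 => ?_⟩
  · refine MeasureTheory.memLp_top_of_bound (hm x) (C * ‖x‖) ?_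
    filter_upwards [MeasureTheory.ae_restrict_mem measurableSet_Ioo] with s hs
    exact hC s (Set.Ioo_subset_Icc_self hs) x
  -- Since `j ≥ 2`, the first cell lies to the left of `τ (j - 1)`, so the denominator `τ (j - 1) -
  -- τ 0` is positive.
  · refine MaxReg.H_linear_growth hp ?_ (hτ.strictMono_step hab (by omega) h2).2.2 hC0
    have := (hτ.strictMono_step hab (i := 1) le_rfl hτ.one_le).2.2
    rw [Nat.sub_self] at this
    exact this.trans_le (hτ.le_of_le hab (by omega) (by omega))
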